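/- Let $(V,Y,\mathbf 1,\omega)$ be a vertex operator algebra over $\mathbb C$, $g$ an automorphism of $V$ of finite order $T$, and $V^r=\{v\in V: gv=e^{2\pi i r/T}v\}$ for $0\le r<T$. Put $\delta_0=1$ and $\delta_r=0$ for $r\neq 0$. Let $O_g(V)\subseteq V$ be the span of all $u\circ_g v=\mathrm{Res}_z\,\frac{(1+z)^{\mathrm{wt}\,u-1+\delta_r+r/T}}{z^{1+\delta_r}}Y(u,z)v$ with $u\in V^r$ homogeneous and $v\in V$, and let $A_g(V)=V/O_g(V)$, an associative algebra with unit $\mathbf 1+O_g(V)$ under the product induced by the bilinear product $u*_gv=\mathrm{Res}_z\,\frac{(1+z)^{\mathrm{wt}\,u}}{z}Y(u,z)v$ for homogeneous $u\in V^0$ and $u*_gv=0$ for $u\in V^r$, $r\ne0$. Let $\mathcal L(V,g)=\bigoplus_{r=0}^{T-1}t^{r/T}\mathbb C[t,t^{-1}]\otimes V^r$, $D=\frac{d}{dt}\otimes 1+1\otimes L(-1)$, and let $V[g]=\mathcal L(V,g)/D\mathcal L(V,g)$ be the Lie algebra with bracket $[a(p),b(q)]=\sum_{i\ge 0}\binom{p}{i}(a_ib)(p+q-i)$,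 where $a(q)$ is the image of $t^q\otimes a$. It is $\frac1T\mathbb Z$-graded by $\deg a(q)=\mathrm{wt}\,a-q-1$; let $V[g]_-$ be its part of negative degree and $V[g]_0$ its part of degree $0$. For a unital $A_g(V)$-module $U$, let $P=V[g]_-\oplus V[g]_0$ act on $U$ so that $V[g]_-$ acts as $0$ and $a(\mathrm{wt}\,a-1)$ acts as $a+O_g(V)$ for homogeneous $a\in V^0$, and let $M(U)=U(V[g])\otimes_{U(P)}U$, graded by $\frac1T\mathbb Z_{\ge0}$ with $U$ in degree $0$. An admissible $g$-twisted $V$-module is a weak $g$-twisted $V$-module $M$ with a grading $M=\bigoplus_{n\in\frac1T\mathbb Z_{\ge 0}}M(n)$ such that $v_mM(n)\subseteq M(n+\mathrm{wt}\,v-m-1)$ for homogeneous $v\in V$; morphisms are the grade-preserving linear maps commuting with all $v_m$. For such $M$, $\Omega(M)$ is the space of all $w\in M$ with $a_qw=0$ for all homogeneous $a\in V$ and all $q$ with $\mathrm{wt}\,a-q-1<0$; it is an $A_g(V)$-module on which $a+O_g(V)$ acts as $a_{\mathrm{wt}\,a-1}$ for homogeneous $a\in V^0$, and $\Omega$ is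 a functor (by restriction of morphisms) to $A_g(V)$-modules. Then for every $A_g(V)$-module $U$, among the graded $V[g]$-submodules of $M(U)$ that meet $U$ in $0$ there is a largest one, $J$; thus $J$ is the unique maximal graded $V[g]$-submodule with $J\cap U=0$. The quotient $L(U)=M(U)/J$, with $v_q$ acting as $v(q)$ for $v\in V^r$ and $q\in \frac rT+\mathbb Z$ (and as $0$ for other $q$) and with the grading induced from $M(U)$, is an admissible $g$-twisted $V$-module, and the natural map $U\to L(U)$ is an isomorphism of $A_g(V)$-modules from $U$ onto $\Omega(L(U))$. Moreover, $L$ is a functor from $A_g(V)$-modules to admissible $g$-twisted $V$-modules, where $L(f)$ extends $f$ on the images of the modules $U$, and these isomorphisms $U\cong\Omega(L(U))$ form a natural isomorphism between the identity functor and $\Omega\circ L$. -/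

import Mathlib

open CategoryTheory

universe u v

/-- A vertex operator algebra over `ℂ`. The vertex operators are given through their modes:
`mode n a b` is `a_n b`, where `Y(a, z) = ∑ a_n z^{-n-1}`. The Jacobi identity is stated
coefficientwise (coefficient of `z₀^{-n-1} z₁^{-m-1} z₂^{-k-1}`); all sums over `i` are finite.
With `ω = conf`, `L(n) = ω_{n+1}`, and the homogeneous space `V_n` is the eigenspace of `L(0)` for
the integer `n`. -/
class VertexOperatorAlgebra (V : Type u) [AddCommGroup V] [Module ℂ V] where
  mode : ℤ → V →ₗ[ℂ] V →ₗ[ℂ] V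
  vac : V
  conf : V
  rank : ℂ
  trunc : ∀ a b : V, ∃ N : ℤ, ∀ n ≥ N, mode n a b = 0
  vac_mode : ∀ (n : ℤ) (b : V), mode n vac b = if n = -1 then b else 0
  mode_vac : ∀ (n : ℤ) (a : V), 0 ≤ n → mode n a vac = 0
  mode_neg_one_vac : ∀ a : V, mode (-1) a vac = a
  jacobi : ∀ (a b c : V) (m n k : ℤ),
    ∑ᶠ i : ℕ, Ring.choose (m : ℂ) i • mode (m + k - i) (mode (n + i) a b) c =
      ∑ᶠ i : ℕ, ((-1) ^ i * Ring.choose (n : ℂ) i) •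
        (mode (m + n - i) a (mode (k + i) b c) -
          (-1 : ℂ) ^ n • mode (n + k - i) b (mode (m + i) a c))
  virasoro : ∀ (m n : ℤ) (b : V),
    mode (m + 1) conf (mode (n + 1) conf b) - mode (n + 1) conf (mode (m + 1) conf b) =
      ((m : ℂ) - n) • mode (m + n + 1) conf b +
        (if m + n = 0 then ((m : ℂ) ^ 3 - m) / 12 * rank else 0) • b
  deriv : ∀ (n : ℤ) (a b : V), mode n (mode 0 conf a) b = -(n : ℂ) • mode (n - 1) a b
  graded : DirectSum.IsInternal fun n : ℤ => Module.End.eigenspace (mode 1 conf) (n : ℂ)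
  finite_dim : ∀ n : ℤ, FiniteDimensional ℂ (Module.End.eigenspace (mode 1 conf) (n : ℂ))
  bounded_below : ∃ N : ℤ, ∀ n < N, Module.End.eigenspace (mode 1 conf) (n : ℂ) = ⊥

namespace VertexOperatorAlgebra

noncomputable section

variable {V : Type u} [AddCommGroup V] [Module ℂ V] [VertexOperatorAlgebra V]

variable (V) in
/-- The space `V_n` of vectors of weight `n`. -/
def wtSpace (n : ℤ) : Submodule ℂ V :=
  Module.End.eigenspace (mode 1 (conf : V)) (n : ℂ)

theorem mem_wtSpace {n : ℤ} {a : V} : a ∈ wtSpace V n ↔ mode 1 (conf : V) a = (n : ℂ) • a :=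
  Module.End.mem_eigenspace_iff

theorem bijective_coe :
    Function.Bijective (DirectSum.coeLinearMap fun n => wtSpace V n) := graded

variable (V) in
/-- The map from `V` to the direct sum of its weight spaces. -/
def wtEquiv : V ≃ₗ[ℂ] DirectSum ℤ fun n => wtSpace V n :=
  (LinearEquiv.ofBijective (DirectSum.coeLinearMap fun n => wtSpace V n) bijective_coe).symm

/-- The linear map on `V` which is `F n` on `V_n`. -/
def byWeight {W : Type*} [AddCommGroup W] [Module ℂ W] (F : ℤ → V →ₗ[ℂ] W) : V →ₗ[ℂ] W :=
  DirectSum.toModule ℂ ℤ W (fun n => (F n).comp (wtSpace V n).subtype) ∘ₗ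
    (wtEquiv V).toLinearMap

theorem byWeight_apply {W : Type*} [AddCommGroup W] [Module ℂ W] (F : ℤ → V →ₗ[ℂ] W)
    {n : ℤ} {a : V} (ha : a ∈ wtSpace V n) : byWeight F a = F n a := by
  have h : wtEquiv V a = DirectSum.lof ℂ ℤ (fun n => wtSpace V n) n ⟨a, ha⟩ := by
    rw [wtEquiv, LinearEquiv.symm_apply_eq]
    simp [LinearEquiv.ofBijective_apply, DirectSum.coeLinearMap_lof]
  simp [byWeight, h]

theorem wt_induction {p : V → Prop} (x : V) (hom : ∀ n, ∀ a ∈ wtSpace V n, p a)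
    (zero : p 0) (add : ∀ a b, p a → p b → p (a + b)) : p x := by
  have h : x ∈ ⨆ n, wtSpace V n := by
    have := (graded (V := V)).submodule_iSup_eq_top
    change (⨆ n, wtSpace V n) = ⊤ at this
    rw [this]; trivial
  exact Submodule.iSup_induction _ (motive := p) h hom zero add

theorem finite_support_mode (a b : V) (k : ℤ) {W : Type*} [AddCommGroup W] [Module ℂ W]
    (F : ℕ → V →ₗ[ℂ] W) : (Function.support fun i : ℕ => F i (mode (k + i) a b)).Finite := by
  obtain ⟨N, hN⟩ := trunc a b
  refine (Set.finite_Iio (N - k).toNat).subset fun i hi => ?_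
  by_contra h
  apply hi
  simp only [Set.mem_Iio, not_lt] at h
  have : mode (k + i) a b = 0 := hN _ (by omega)
  simp [this]

/-- The bilinear map `(a, b) ↦ ∑_{i ≥ 0} F_i (a_{k+i} b)`; the sum is finite. -/
def modeSum {W : Type*} [AddCommGroup W] [Module ℂ W] (k : ℤ) (F : ℕ → V →ₗ[ℂ] W) :
    V →ₗ[ℂ] V →ₗ[ℂ] W :=
  LinearMap.mk₂ ℂ (fun a b => ∑ᶠ i : ℕ, F i (mode (k + i) a b))
    (fun a a' b => by
      simp only [map_add, LinearMap.add_apply]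
      exact finsum_add_distrib (finite_support_mode a b k F) (finite_support_mode a' b k F))
    (fun c a b => by simp only [map_smul, LinearMap.smul_apply, smul_finsum])
    (fun a b b' => by
      simp only [map_add]
      exact finsum_add_distrib (finite_support_mode a b k F) (finite_support_mode a b' k F))
    (fun c a b => by simp only [map_smul, smul_finsum])

theorem modeSum_apply {W : Type*} [AddCommGroup W] [Module ℂ W] (k : ℤ) (F : ℕ → V →ₗ[ℂ] W)
    (a b : V) : modeSum k F a b = ∑ᶠ i : ℕ, F i (mode (k + i) a b) := rfl

/-- `Res_z (1 + z)^x z^k Y(a, z) b = ∑_{i ≥ 0} (x choose i) a_{k+i} b`. -/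
def res (x : ℂ) (k : ℤ) : V →ₗ[ℂ] V →ₗ[ℂ] V :=
  modeSum k fun i => Ring.choose x i • LinearMap.id

theorem finsum_range {W : Type*} [AddCommMonoid W] (f : ℕ → W) (N : ℕ) (h : ∀ i ≥ N, f i = 0) :
    ∑ᶠ i, f i = ∑ i ∈ Finset.range N, f i := by
  apply finsum_eq_sum_of_support_subset
  intro i hi
  by_contra hn
  exact hi (h i (by simpa using hn))

/-- The commutator formula. -/
theorem commutator (a b c : V) (m k : ℤ) :
    mode m a (mode k b c) - mode k b (mode m a c) =
      ∑ᶠ i : ℕ, Ring.choose (m : ℂ) i • mode (m + k - i) (mode i a b) c := by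
  have h := jacobi a b c m 0 k
  simp only [zero_add, add_zero, Int.cast_zero] at h
  rw [h, finsum_range _ 1]
  · simp
  · intro i hi
    rw [Ring.choose_zero_pos _ (by omega)]
    simp

theorem mode_mem_wtSpace {n w : ℤ} {a b : V} (ha : a ∈ wtSpace V n) (hb : b ∈ wtSpace V w)
    (m : ℤ) : mode m a b ∈ wtSpace V (n + w - m - 1) := by
  rw [mem_wtSpace] at *
  have h := commutator (conf : V) a b 1 m
  rw [finsum_range _ 2] at h
  · simp only [Finset.sum_range_succ, Finset.sum_range_zero, zero_add, Ring.choose_zero_right,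
      Nat.cast_zero, Nat.cast_one, Int.cast_one, Ring.choose_one_right, one_smul, deriv, ha, hb,
      map_smul, LinearMap.smul_apply, sub_zero] at h
    rw [sub_eq_iff_eq_add] at h
    rw [h, show (1 + m - 1 : ℤ) = m by ring, ← add_smul, ← add_smul]
    congr 1
    push_cast
    ring
  · intro i hi
    rw [Int.cast_one, ← Nat.cast_one, Ring.choose_natCast, Nat.choose_eq_zero_of_lt (by omega)]
    simp

end

end VertexOperatorAlgebra

open VertexOperatorAlgebra in
/-- An automorphism of a vertex operator algebra, of finite order `T`. -/
structure FiniteOrderAut (V : Type u) [AddCommGroup V] [Module ℂ V] [VertexOperatorAlgebra V] where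
  toEquiv : V ≃ₗ[ℂ] V
  map_mode : ∀ (n : ℤ) (a b : V), toEquiv (mode n a b) = mode n (toEquiv a) (toEquiv b)
  map_vac : toEquiv vac = vac
  map_conf : toEquiv conf = conf
  T : ℕ
  T_pos : 0 < T
  order_eq : orderOf toEquiv = T

namespace FiniteOrderAut

noncomputable section

open VertexOperatorAlgebra

variable {V : Type u} [AddCommGroup V] [Module ℂ V] [VertexOperatorAlgebra V]
variable (g : FiniteOrderAut V)

/-- The eigenspace of `g` for the eigenvalue `e^{2πiq}`. The space written `V^r` is
`g.eig (r / T)`. -/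
def eig (q : ℚ) : Submodule ℂ V :=
  Module.End.eigenspace (g.toEquiv : V →ₗ[ℂ] V) (Complex.exp (2 * Real.pi * Complex.I * q))

theorem mem_eig {q : ℚ} {a : V} :
    a ∈ g.eig q ↔ g.toEquiv a = Complex.exp (2 * Real.pi * Complex.I * q) • a :=
  Module.End.mem_eigenspace_iff

theorem exp_sub_int (p : ℚ) (i : ℤ) : Complex.exp (2 * Real.pi * Complex.I * (p - i : ℚ)) =
    Complex.exp (2 * Real.pi * Complex.I * p) := by
  rw [Complex.exp_eq_exp_iff_exists_int]
  exact ⟨-i, by push_cast; ring⟩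

theorem mode_mem_eig {p q : ℚ} {a b : V} (ha : a ∈ g.eig p) (hb : b ∈ g.eig q) (m : ℤ) :
    mode m a b ∈ g.eig (p + q) := by
  rw [mem_eig] at *
  rw [map_mode, ha, hb]
  simp only [map_smul, LinearMap.smul_apply, smul_smul, ← Complex.exp_add]
  congr 2
  push_cast
  ring

theorem pow_T (a : V) : (g.toEquiv ^ g.T) a = a := by
  rw [← g.order_eq, pow_orderOf_eq_one]
  rfl

theorem pow_mem_wtSpace {n : ℤ} {a : V} (ha : a ∈ wtSpace V n) (k : ℕ) :
    (g.toEquiv ^ k) a ∈ wtSpace V n := by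
  induction k with
  | zero => simpa using ha
  | succ k ih =>
    rw [pow_succ', LinearEquiv.mul_apply]
    rw [mem_wtSpace] at *
    have := congrArg g.toEquiv ih
    rwa [map_mode, map_conf, map_smul] at this

/-- The averaging operator `T⁻¹ ∑_{k < T} e^{-2πiqk} g^k`. -/
def avg (q : ℚ) : V →ₗ[ℂ] V :=
  (g.T : ℂ)⁻¹ • ∑ k ∈ Finset.range g.T,
    Complex.exp (-(2 * Real.pi * Complex.I * q * k)) • ((g.toEquiv ^ k : V ≃ₗ[ℂ] V) : V →ₗ[ℂ] V)

theorem avg_apply (q : ℚ) (a : V) : g.avg q a = (g.T : ℂ)⁻¹ • ∑ k ∈ Finset.range g.T,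
    Complex.exp (-(2 * Real.pi * Complex.I * q * k)) • (g.toEquiv ^ k) a := by
  simp [avg, LinearMap.sum_apply]

open Classical in
/-- The projection of `V` onto `g.eig q` along the other eigenspaces of `g`. It is `0` when `q`
is not in `(1/T)ℤ`, since then `g.eig q = 0`. -/
def proj (q : ℚ) : V →ₗ[ℂ] V := if ∃ k : ℤ, q = k / g.T then g.avg q else 0

theorem T_ne : (g.T : ℂ) ≠ 0 := by exact_mod_cast g.T_pos.ne'

theorem proj_mem (q : ℚ) (a : V) : g.proj q a ∈ g.eig q := by
  unfold proj
  split_ifs with h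
  · obtain ⟨m, rfl⟩ := h
    rw [mem_eig, avg_apply, map_smul, map_sum, smul_comm]
    congr 1
    have key : ∀ k : ℕ, g.toEquiv (Complex.exp (-(2 * Real.pi * Complex.I * ((m / g.T : ℚ)) * k)) •
        (g.toEquiv ^ k) a) = Complex.exp (2 * Real.pi * Complex.I * ((m / g.T : ℚ))) •
        (Complex.exp (-(2 * Real.pi * Complex.I * ((m / g.T : ℚ)) * (k + 1 : ℕ))) •
          (g.toEquiv ^ (k + 1)) a) := by
      intro k
      rw [map_smul, smul_smul, ← Complex.exp_add, pow_succ', LinearEquiv.mul_apply]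
      congr 2
      push_cast
      ring
    rw [Finset.sum_congr rfl fun k _ => key k, ← Finset.smul_sum]
    congr 1
    have e := Finset.sum_range_succ (fun k : ℕ =>
      Complex.exp (-(2 * Real.pi * Complex.I * ((m / g.T : ℚ)) * k)) • (g.toEquiv ^ k) a) g.T
    rw [Finset.sum_range_succ'] at e
    have h1 : Complex.exp (-(2 * Real.pi * Complex.I * ((m / g.T : ℚ)) * g.T)) = 1 := by
      rw [Complex.exp_eq_one_iff]
      refine ⟨-m, ?_⟩
      have := g.T_ne
      push_cast
      field_simp
    rw [h1, pow_T, one_smul] at e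
    simpa using e
  · exact Submodule.zero_mem _

theorem proj_apply {q : ℚ} {a : V} (ha : a ∈ g.eig q) : g.proj q a = a := by
  by_cases h0 : a = 0
  · rw [h0, map_zero]
  have hpow : ∀ k : ℕ, (g.toEquiv ^ k) a = Complex.exp (2 * Real.pi * Complex.I * q * k) • a := by
    intro k
    induction k with
    | zero => simp
    | succ k ih =>
      rw [pow_succ', LinearEquiv.mul_apply, ih, map_smul, g.mem_eig.mp ha, smul_smul,
        ← Complex.exp_add]
      congr 2
      push_cast
      ring
  have hT := g.T_ne
  have hq : ∃ k : ℤ, q = k / g.T := by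
    have h1 := hpow g.T
    rw [pow_T] at h1
    have h2 : Complex.exp (2 * Real.pi * Complex.I * q * g.T) = 1 := by
      by_contra hne
      have : (Complex.exp (2 * Real.pi * Complex.I * q * g.T) - 1) • a = 0 := by
        rw [sub_smul, ← h1, one_smul, sub_self]
      exact (smul_ne_zero (sub_ne_zero.mpr hne) h0) this
    obtain ⟨k, hk⟩ := Complex.exp_eq_one_iff.mp h2
    refine ⟨k, ?_⟩
    have h3 : (q : ℂ) * g.T = k := by
      have : (2 * Real.pi * Complex.I : ℂ) ≠ 0 := Complex.two_pi_I_ne_zero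
      apply mul_left_cancel₀ this
      linear_combination hk
    have hT' : (g.T : ℚ) ≠ 0 := by exact_mod_cast g.T_pos.ne'
    rw [eq_div_iff hT']
    exact_mod_cast h3
  rw [proj, if_pos hq, avg_apply, inv_smul_eq_iff₀ hT]
  simp only [hpow, smul_smul, ← Complex.exp_add, neg_add_cancel, Complex.exp_zero, one_smul,
    Finset.sum_const, Finset.card_range, Nat.cast_smul_eq_nsmul]

theorem proj_mem_wtSpace {n : ℤ} {a : V} (ha : a ∈ wtSpace V n) (q : ℚ) :
    g.proj q a ∈ wtSpace V n := by
  unfold proj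
  split_ifs with h
  · rw [avg_apply]
    exact Submodule.smul_mem _ _ (Submodule.sum_mem _ fun k _ =>
      Submodule.smul_mem _ _ (g.pow_mem_wtSpace ha k))
  · exact Submodule.zero_mem _

theorem sum_proj (a : V) : ∑ r ∈ Finset.range g.T, g.proj (r / g.T) a = a := by
  have h : ∀ r : ℕ, g.proj (r / g.T) a = g.avg (r / g.T) a := fun r => by
    rw [proj, if_pos ⟨r, by simp⟩]
  have hT := g.T_ne
  set ζ := Complex.exp (2 * Real.pi * Complex.I / g.T) with hζ
  have hp : IsPrimitiveRoot ζ g.T := Complex.isPrimitiveRoot_exp _ g.T_pos.ne'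
  simp only [h, avg_apply, ← Finset.smul_sum]
  rw [Finset.sum_comm, inv_smul_eq_iff₀ hT]
  simp only [← Finset.sum_smul]
  have e : ∀ k ∈ Finset.range g.T, (∑ r ∈ Finset.range g.T,
      Complex.exp (-(2 * Real.pi * Complex.I * ((r / g.T : ℚ) : ℂ) * k))) =
      if k = 0 then (g.T : ℂ) else 0 := by
    intro k hk
    have e1 : ∀ r : ℕ, Complex.exp (-(2 * Real.pi * Complex.I * ((r / g.T : ℚ) : ℂ) * k)) =
        ((ζ ^ k)⁻¹) ^ r := by
      intro r
      rw [hζ, ← Complex.exp_nat_mul, ← Complex.exp_neg, ← Complex.exp_nat_mul]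
      congr 1
      push_cast
      field_simp
    simp only [e1]
    split_ifs with h0
    · simp [h0]
    · have hne : (ζ ^ k)⁻¹ ≠ 1 := by
        rw [ne_eq, inv_eq_one]
        exact hp.pow_ne_one_of_pos_of_lt h0 (Finset.mem_range.mp hk)
      rw [geom_sum_eq hne, inv_pow, ← pow_mul, mul_comm, pow_mul, hp.pow_eq_one]
      simp
  rw [Finset.sum_congr rfl fun k hk => by rw [e k hk]]
  simp [g.T_pos]

theorem eig_induction {p : V → Prop} (x : V) (hom : ∀ r < g.T, ∀ a ∈ g.eig (r / g.T), p a)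
    (zero : p 0) (add : ∀ a b, p a → p b → p (a + b)) : p x := by
  rw [← g.sum_proj x]
  exact Finset.sum_induction _ p add zero fun r hr =>
    hom r (Finset.mem_range.mp hr) _ (g.proj_mem _ x)

end

end FiniteOrderAut

namespace FiniteOrderAut

noncomputable section

open VertexOperatorAlgebra

variable {V : Type u} [AddCommGroup V] [Module ℂ V] [VertexOperatorAlgebra V]
variable (g : FiniteOrderAut V)

/-- `δ_r` is `1` for `r = 0` and `0` otherwise. -/
def delta (r : ℕ) : ℕ := if r = 0 then 1 else 0

/-- `u ∘_g v = Res_z (1 + z)^{wt u - 1 + δ_r + r/T} z^{-1-δ_r} Y(u, z) v` for `u ∈ V^r` of weight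
`n`. -/
def circ (n : ℤ) (r : ℕ) (a b : V) : V :=
  res ((n : ℂ) - 1 + delta r + r / g.T) (-1 - delta r) a b

/-- `O_g(V)`, the linear span of all `u ∘_g v`. -/
def Og : Submodule ℂ V :=
  Submodule.span ℂ {x | ∃ (n : ℤ) (r : ℕ) (a b : V), r < g.T ∧ a ∈ wtSpace V n ∧
    a ∈ g.eig (r / g.T) ∧ x = g.circ n r a b}

/-- The bilinear product `*_g` on `V`: for `a` homogeneous in `V^0`,
`a *_g b = Res_z (1 + z)^{wt a} z^{-1} Y(a, z) b`, and `a *_g b = 0` for `a ∈ V^r`, `r ≠ 0`. -/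
def star : V →ₗ[ℂ] V →ₗ[ℂ] V := byWeight (fun n => res (n : ℂ) (-1)) ∘ₗ g.proj 0

/-- The underlying space of the algebra `A_g(V)`; its product is induced by `*_g` and its unit is
the image of the vacuum. -/
abbrev Ag : Type u := V ⧸ g.Og

/-- A (left, unital) module for the associative algebra `A_g(V)`: a complex vector space with a
linear map from `A_g(V)` to its endomorphisms that respects products and the unit. -/
structure AgMod where
  carrier : Type v
  [addCommGroup : AddCommGroup carrier]
  [module : Module ℂ carrier]
  rho : g.Ag →ₗ[ℂ] Module.End ℂ carrier
  rho_one : rho (g.Og.mkQ vac) = 1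
  rho_mul : ∀ a b : V, rho (g.Og.mkQ (g.star a b)) = rho (g.Og.mkQ a) * rho (g.Og.mkQ b)

attribute [instance] AgMod.addCommGroup AgMod.module

variable {g}

/-- The morphisms of `A_g(V)`-modules. -/
@[ext]
structure AgMod.Hom (U W : AgMod.{u, v} g) where
  toLin : U.carrier →ₗ[ℂ] W.carrier
  comm : ∀ (a : g.Ag) (x : U.carrier), toLin (U.rho a x) = W.rho a (toLin x)

instance : Category (AgMod.{u, v} g) where
  Hom := AgMod.Hom
  id U := ⟨LinearMap.id, fun _ _ => rfl⟩
  comp f h := ⟨h.toLin ∘ₗ f.toLin, fun a x => by simp [f.comm, h.comm]⟩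

variable (g)

/-- The axioms of a weak `g`-twisted `V`-module `M`, with vertex operators given through their
modes: `Y n v` is the operator `v_n` (`n ∈ ℚ`), where `Y_M(v, z) = ∑ v_n z^{-n-1}`. The twisted
Jacobi identity is stated coefficientwise (coefficient of `z₀^{-n-1} z₁^{-m-1} z₂^{-k-1}`); both
sides of it vanish for `u ∈ V^r` unless `m ∈ r/T + ℤ`, and all sums over `i` are finite. -/
structure IsWeakTwisted {M : Type v} [AddCommGroup M] [Module ℂ M]
    (Y : ℚ → V →ₗ[ℂ] Module.End ℂ M) : Prop where
  support : ∀ r < g.T, ∀ a ∈ g.eig (r / g.T), ∀ n : ℚ, (¬ ∃ j : ℤ, n = r / g.T + j) → Y n a = 0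
  trunc : ∀ (a : V) (w : M), ∃ N : ℚ, ∀ n ≥ N, Y n a w = 0
  vacuum : ∀ n : ℚ, Y n vac = if n = -1 then 1 else 0
  jacobi : ∀ r < g.T, ∀ a ∈ g.eig (r / g.T), ∀ (b : V) (w : M) (m : ℚ) (n : ℤ) (k : ℚ),
    (∃ j : ℤ, m = r / g.T + j) →
    ∑ᶠ i : ℕ, Ring.choose (m : ℂ) i • Y (m + k - i) (mode (n + i) a b) w =
      ∑ᶠ i : ℕ, ((-1) ^ i * Ring.choose (n : ℂ) i) •
        (Y (m + n - i) a (Y (k + i) b w) - (-1 : ℂ) ^ n • Y (n + k - i) b (Y (m + i) a w))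

/-- The axioms of an admissible `g`-twisted `V`-module: a weak `g`-twisted module with a grading
`M = ⊕ M(n)`, `n ∈ (1/T)ℤ_+`, such that `v_m M(n) ⊆ M(n + wt v - m - 1)` for homogeneous `v`. The
grading is indexed by `ℚ`, with `M(n) = 0` for `n` outside of `(1/T)ℤ_+`. -/
structure IsAdmissible {M : Type v} [AddCommGroup M] [Module ℂ M]
    (Y : ℚ → V →ₗ[ℂ] Module.End ℂ M) (gr : ℚ → Submodule ℂ M) : Prop where
  weak : g.IsWeakTwisted Y
  internal : DirectSum.IsInternal gr
  gr_support : ∀ n : ℚ, (¬ ∃ k : ℕ, n = k / g.T) → gr n = ⊥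
  map_gr : ∀ (w : ℤ), ∀ a ∈ wtSpace V w, ∀ (m n : ℚ), ∀ x ∈ gr n, Y m a x ∈ gr (n + w - m - 1)

/-- An admissible `g`-twisted `V`-module. -/
structure AdmMod where
  carrier : Type v
  [addCommGroup : AddCommGroup carrier]
  [module : Module ℂ carrier]
  Y : ℚ → V →ₗ[ℂ] Module.End ℂ carrier
  gr : ℚ → Submodule ℂ carrier
  isAdmissible : g.IsAdmissible Y gr

attribute [instance] AdmMod.addCommGroup AdmMod.module

variable {g}

/-- The morphisms of admissible `g`-twisted `V`-modules: the grade-preserving linear maps that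
commute with all `v_n`. -/
@[ext]
structure AdmMod.Hom (M N : AdmMod.{u, v} g) where
  toLin : M.carrier →ₗ[ℂ] N.carrier
  comm : ∀ (n : ℚ) (a : V) (x : M.carrier), toLin (M.Y n a x) = N.Y n a (toLin x)
  map_gr : ∀ (n : ℚ), ∀ x ∈ M.gr n, toLin x ∈ N.gr n

instance : Category (AdmMod.{u, v} g) where
  Hom := AdmMod.Hom
  id M := ⟨LinearMap.id, fun _ _ _ => rfl, fun _ _ h => h⟩
  comp f h := ⟨h.toLin ∘ₗ f.toLin, fun n a x => by simp [f.comm, h.comm],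
    fun n x hx => h.map_gr n _ (f.map_gr n x hx)⟩

/-! ### The functor `Ω` -/

section Omega

variable {M : Type v} [AddCommGroup M] [Module ℂ M]

/-- The space of lowest weight vectors: those killed by all `a_q` of negative degree
`wt a - q - 1`, for `a` homogeneous. -/
def Omega (Y : ℚ → V →ₗ[ℂ] Module.End ℂ M) : Submodule ℂ M where
  carrier := {x | ∀ n : ℤ, ∀ a ∈ wtSpace V n, ∀ q : ℚ, n - q - 1 < 0 → Y q a x = 0}
  zero_mem' := fun n a _ q _ => map_zero _
  add_mem' := fun hx hy n a ha q hq => by rw [map_add, hx n a ha q hq, hy n a ha q hq, add_zero]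
  smul_mem' := fun c x hx n a ha q hq => by rw [map_smul, hx n a ha q hq, smul_zero]

/-- The linear map `o` from `V` to endomorphisms with `o(a) = a_{wt a - 1}` for homogeneous `a`.
On a `g`-twisted module it vanishes on `V^r`, `r ≠ 0`. -/
def oMap (Y : ℚ → V →ₗ[ℂ] Module.End ℂ M) : V →ₗ[ℂ] Module.End ℂ M :=
  byWeight fun n => Y ((n : ℚ) - 1)

theorem oMap_apply (Y : ℚ → V →ₗ[ℂ] Module.End ℂ M) {n : ℤ} {a : V} (ha : a ∈ wtSpace V n) :
    oMap Y a = Y ((n : ℚ) - 1) a := byWeight_apply _ ha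

variable {Y : ℚ → V →ₗ[ℂ] Module.End ℂ M}

theorem oMap_mem (h : g.IsWeakTwisted Y) (a : V) {x : M} (hx : x ∈ Omega Y) :
    oMap Y a x ∈ Omega Y := by
  induction a using wt_induction with
  | zero => simp
  | add a b iha ihb => rw [map_add]; exact Submodule.add_mem _ iha ihb
  | hom n a ha =>
    rw [oMap_apply Y ha]
    intro w b hb q hq
    rw [← g.sum_proj b]
    rw [map_sum, LinearMap.sum_apply]
    refine Finset.sum_eq_zero fun r hr => ?_
    have hc := g.proj_mem_wtSpace hb (r / g.T)
    have hc' := g.proj_mem (r / g.T) b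
    generalize g.proj (r / g.T) b = c at hc hc'
    by_cases hj : ∃ j : ℤ, q = r / g.T + j
    · have J := h.jacobi r (Finset.mem_range.mp hr) c hc' a x q 0 (n - 1) hj
      rw [finsum_range _ 0, finsum_range _ 1] at J
      · simpa [hx w c hc q hq] using J.symm
      · intro i hi
        rw [Int.cast_zero, Ring.choose_zero_pos _ (by omega)]
        simp
      · intro i _
        rw [hx _ _ (mode_mem_wtSpace hc ha (0 + i)) _ (by push_cast; linarith), smul_zero]
    · rw [h.support r (Finset.mem_range.mp hr) c hc' q hj]
      rfl

theorem oMap_res {n w : ℤ} {a b : V} (ha : a ∈ wtSpace V n) (hb : b ∈ wtSpace V w)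
    (y : ℂ) (k : ℤ) (x : M) : oMap Y (res y k a b) x =
      ∑ᶠ i : ℕ, Ring.choose y i • Y ((n : ℚ) + w - k - 2 - i) (mode (k + i) a b) x := by
  rw [res, modeSum_apply]
  have := (((LinearMap.applyₗ x : Module.End ℂ M →ₗ[ℂ] M) ∘ₗ oMap Y : V →ₗ[ℂ] M).toAddMonoidHom).map_finsum
    (finite_support_mode a b k fun i => Ring.choose y i • LinearMap.id)
  simp only [LinearMap.toAddMonoidHom_coe, LinearMap.comp_apply, LinearMap.applyₗ_apply_apply] at this
  refine this.trans (finsum_congr fun i => ?_)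
  simp only [LinearMap.smul_apply, LinearMap.id_apply, map_smul]
  rw [oMap_apply Y (mode_mem_wtSpace ha hb _)]
  congr 4
  push_cast
  ring

theorem oMap_circ (h : g.IsWeakTwisted Y) {n : ℤ} {r : ℕ} {a : V} (b : V) (hr : r < g.T)
    (ha : a ∈ wtSpace V n) (ha' : a ∈ g.eig (r / g.T)) {x : M} (hx : x ∈ Omega Y) :
    oMap Y (g.circ n r a b) x = 0 := by
  unfold circ
  induction b using wt_induction with
  | zero => simp
  | add b c hb hc => rw [map_add, map_add, LinearMap.add_apply, hb, hc, add_zero]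
  | hom w b hb =>
    rw [oMap_res ha hb]
    have hT : (0 : ℚ) < g.T := by exact_mod_cast g.T_pos
    have hrT : (r / g.T : ℚ) < 1 := by rw [div_lt_one hT]; exact_mod_cast hr
    have hr0 : (0 : ℚ) ≤ r / g.T := by positivity
    have hd : (0 : ℚ) < (r / g.T : ℚ) + delta r := by
      unfold delta
      split_ifs with h0
      · simp [h0]
      · have : (0 : ℚ) < r := by exact_mod_cast Nat.pos_of_ne_zero h0
        simp only [Nat.cast_zero, add_zero]
        positivity
    have hd1 : (delta r : ℚ) ≤ 1 := by unfold delta; split_ifs <;> simp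
    have hd2 : (r / g.T : ℚ) < delta r + 1 := by
      have : (0 : ℚ) ≤ delta r := by positivity
      linarith
    have J := h.jacobi r hr a ha' b x ((n : ℚ) - 1 + delta r + r / g.T) (-1 - delta r)
      ((w : ℚ) - r / g.T) ⟨n - 1 + delta r, by push_cast; ring⟩
    rw [finsum_range (fun i : ℕ => ((-1) ^ i * _) • (_ : M)) 0] at J
    · rw [Finset.sum_range_zero] at J
      rw [← J]
      refine finsum_congr fun i => ?_
      congr 4
      · push_cast; ring
      · push_cast; ring
    · intro i _
      have hi : (0 : ℚ) ≤ i := by positivity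
      rw [hx w b hb _ (by linarith), hx n a ha _ (by linarith)]
      simp

theorem oMap_Og (h : g.IsWeakTwisted Y) {a : V} (ha : a ∈ g.Og) {x : M} (hx : x ∈ Omega Y) :
    oMap Y a x = 0 := by
  induction ha using Submodule.span_induction with
  | mem a ha =>
    obtain ⟨n, r, a, b, hr, h1, h2, rfl⟩ := ha
    exact oMap_circ h b hr h1 h2 hx
  | zero => simp
  | add a b _ _ iha ihb => rw [map_add, LinearMap.add_apply, iha, ihb, add_zero]
  | smul c a _ iha => rw [map_smul, LinearMap.smul_apply, iha, smul_zero]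

theorem oMap_proj (h : g.IsWeakTwisted Y) (a : V) : oMap Y (g.proj 0 a) = oMap Y a := by
  induction a using wt_induction with
  | zero => simp
  | add a b iha ihb => rw [map_add, map_add, map_add, iha, ihb]
  | hom n a ha =>
    conv_rhs => rw [← g.sum_proj a, map_sum, ← Finset.sum_erase_add _ _
      (Finset.mem_range.mpr g.T_pos)]
    rw [Finset.sum_eq_zero]
    · simp
    · intro r hr
      rw [Finset.mem_erase, Finset.mem_range] at hr
      rw [oMap_apply Y (g.proj_mem_wtSpace ha _)]
      refine h.support r hr.2 _ (g.proj_mem _ a) _ ?_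
      rintro ⟨j, hj⟩
      have hT : (0 : ℚ) < g.T := by exact_mod_cast g.T_pos
      have e : (r : ℚ) = (n - 1 - j) * g.T := by
        have : (r / g.T : ℚ) = n - 1 - j := by linarith
        rw [← this]
        field_simp
      have e' : (r : ℤ) = (n - 1 - j) * g.T := by exact_mod_cast e
      have h1 : (g.T : ℤ) ∣ r := ⟨n - 1 - j, by rw [e']; ring⟩
      exact hr.1 (Nat.eq_zero_of_dvd_of_lt (by exact_mod_cast h1) hr.2)

theorem oMap_star (h : g.IsWeakTwisted Y) (a b : V) {x : M} (hx : x ∈ Omega Y) :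
    oMap Y (g.star a b) x = oMap Y a (oMap Y b x) := by
  induction a using wt_induction with
  | zero => simp
  | add a c iha ihc => simp only [map_add, LinearMap.add_apply, iha, ihc]
  | hom n a ha =>
    rw [← oMap_proj h a]
    have hc := g.proj_mem_wtSpace ha 0
    have hc' := g.proj_mem 0 a
    rw [star, LinearMap.comp_apply, byWeight_apply _ hc]
    generalize g.proj 0 a = c at hc hc'
    induction b using wt_induction with
    | zero => simp
    | add b d ihb ihd => simp only [map_add, LinearMap.add_apply, ihb, ihd]
    | hom w b hb =>
      rw [oMap_res hc hb, oMap_apply Y hc, oMap_apply Y hb]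
      have J := h.jacobi 0 g.T_pos c (by simpa using hc') b x n (-1) ((w : ℚ) - 1)
        ⟨n, by simp⟩
      rw [finsum_range (fun i : ℕ => ((-1) ^ i * _) • (_ : M)) 1] at J
      · rw [Finset.sum_range_one, hx n c hc _ (by simp)] at J
        simp only [ map_zero, smul_zero, sub_zero, Nat.cast_zero, add_zero,
          pow_zero, Ring.choose_zero_right, one_mul, one_smul] at J
        rw [show ((n : ℚ) + ((-1 : ℤ) : ℚ)) = n - 1 by push_cast; ring] at J
        rw [← J]
        refine finsum_congr fun i => ?_
        congr 4
        · push_cast; ring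
      · intro i hi
        have hi : (1 : ℚ) ≤ i := by exact_mod_cast hi
        rw [hx w b hb _ (by linarith), hx n c hc _ (by linarith)]
        simp

theorem vac_mem_wtSpace : (vac : V) ∈ wtSpace V 0 := by
  rw [mem_wtSpace, mode_vac _ _ (by norm_num)]
  simp

variable (Y) in
/-- The action `a ↦ o(a)` of `A_g(V)` on the space of lowest weight vectors. -/
def omegaRho (h : g.IsWeakTwisted Y) : g.Ag →ₗ[ℂ] Module.End ℂ (Omega Y) :=
  g.Og.liftQ
    { toFun := fun a => (oMap Y a).restrict fun _ hx => oMap_mem h a hx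
      map_add' := fun a b => by ext x; simp [LinearMap.restrict_apply]
      map_smul' := fun c a => by ext x; simp [LinearMap.restrict_apply] }
    fun a ha => by
      rw [LinearMap.mem_ker]
      ext x
      exact oMap_Og h ha x.2

end Omega

/-- The `A_g(V)`-module `Ω(M)`. -/
def OmegaObj (M : AdmMod.{u, v} g) : AgMod.{u, v} g where
  carrier := Omega M.Y
  rho := omegaRho M.Y M.isAdmissible.weak
  rho_one := by
    ext x
    change oMap M.Y vac x = (x : M.carrier)
    rw [oMap_apply _ vac_mem_wtSpace, M.isAdmissible.weak.vacuum]
    simp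
  rho_mul a b := by
    ext x
    exact oMap_star M.isAdmissible.weak a b x.2

variable (g) in
/-- The functor `Ω` from admissible `g`-twisted `V`-modules to `A_g(V)`-modules; on morphisms it is
restriction. -/
def OmegaFunctor : AdmMod.{u, v} g ⥤ AgMod.{u, v} g where
  obj := OmegaObj
  map {M N} f :=
    { toLin := f.toLin.restrict (p := Omega M.Y) (q := Omega N.Y) fun x hx n a ha q hq => by
        rw [← f.comm, hx n a ha q hq, map_zero]
      comm := fun a (x : Omega M.Y) => by
        induction a using Submodule.Quotient.induction_on with
        | H a =>
          apply Subtype.ext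
          change f.toLin (oMap M.Y a x) = oMap N.Y a (f.toLin x)
          induction a using wt_induction with
          | zero => simp
          | add a b iha ihb => simp only [map_add, LinearMap.add_apply, iha, ihb]
          | hom n a ha => rw [oMap_apply _ ha, oMap_apply _ ha, f.comm] }

end

end FiniteOrderAut

/-! ### The Lie algebra `V[g]` -/

namespace VertexOperatorAlgebra

noncomputable section

variable {V : Type u} [AddCommGroup V] [Module ℂ V] [VertexOperatorAlgebra V]

variable (V) in
/-- Finite sums of terms `t^q ⊗ a` with `q ∈ ℚ` and `a ∈ V`; `t^q ⊗ a` is `Finsupp.single q a`. -/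
abbrev Loop : Type u := ℚ →₀ V

/-- The product `(x, y) ↦ x_0 y` of the tensor product vertex algebra:
`(t^p ⊗ a, t^q ⊗ b) ↦ ∑_{i ≥ 0} (p choose i) t^{p+q-i} ⊗ a_i b`. -/
def loopBracket : Loop V →ₗ[ℂ] Loop V →ₗ[ℂ] Loop V :=
  Finsupp.lsum ℂ fun p => LinearMap.flip (Finsupp.lsum ℂ fun q => LinearMap.flip
    (modeSum 0 fun i => Ring.choose (p : ℂ) i • Finsupp.lsingle (p + q - i)))

/-- `D = d/dt ⊗ 1 + 1 ⊗ L(-1)`. -/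
def loopD : Loop V →ₗ[ℂ] Loop V :=
  Finsupp.lsum ℂ fun p => (p : ℂ) • Finsupp.lsingle (p - 1) + Finsupp.lsingle p ∘ₗ mode 0 conf

theorem loopD_single (p : ℚ) (a : V) : loopD (Finsupp.single p a) =
    (p : ℂ) • Finsupp.single (p - 1) a + Finsupp.single p (mode 0 conf a) := by
  simp [loopD]

theorem loopBracket_single' (p q : ℚ) (a b : V) :
    loopBracket (Finsupp.single p a) (Finsupp.single q b) =
      ∑ᶠ i : ℕ, Ring.choose (p : ℂ) i • Finsupp.single (p + q - i) (mode (i : ℤ) a b) := by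
  simp [loopBracket, modeSum_apply]

theorem loopBracket_single (p q : ℚ) (a b : V) (N : ℕ) (h : ∀ i : ℕ, N ≤ i → mode (i : ℤ) a b = 0) :
    loopBracket (Finsupp.single p a) (Finsupp.single q b) =
      ∑ i ∈ Finset.range N,
        Ring.choose (p : ℂ) i • Finsupp.single (p + q - i) (mode (i : ℤ) a b) := by
  rw [loopBracket_single', finsum_range _ N]
  intro i hi
  rw [h i hi]
  simp

theorem trunc_nat (a b : V) : ∃ N : ℕ, ∀ i : ℕ, N ≤ i → mode (i : ℤ) a b = 0 := by
  obtain ⟨N, hN⟩ := trunc a b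
  exact ⟨N.toNat, fun i hi => hN _ (by omega)⟩

theorem choose_succ_mul (x : ℂ) (i : ℕ) :
    ((i : ℂ) + 1) * Ring.choose x (i + 1) = x * Ring.choose (x - 1) i := by
  have := Ring.choose_smul_choose x (n := i + 1) (k := 1) (by omega)
  simpa using this

theorem choose_succ_mul' (x : ℂ) (i : ℕ) :
    ((i : ℂ) + 1) * Ring.choose x (i + 1) = Ring.choose x i * (x - i) := by
  have := Ring.choose_smul_choose x (n := i + 1) (k := i) (by omega)
  simpa using this

theorem loopBracket_D (x y : Loop V) : loopBracket (loopD x) y = 0 := by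
  induction x using Finsupp.induction_linear with
  | zero => simp
  | add x x' h h' => simp [h, h']
  | single p a =>
    induction y using Finsupp.induction_linear with
    | zero => simp
    | add y y' h h' => simp [h, h']
    | single q b =>
      obtain ⟨N, hN⟩ := trunc_nat a b
      rw [loopD_single, map_add, map_smul, LinearMap.add_apply, LinearMap.smul_apply,
        loopBracket_single _ _ _ _ N hN, loopBracket_single _ _ _ _ (N + 1), Finset.sum_range_succ']
      · simp only [deriv]
        simp only [Finset.smul_sum, smul_smul]
        rw [← add_assoc, ← Finset.sum_add_distrib, Finset.sum_eq_zero]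
        · simp
        · intro i _
          have e1 : p - 1 + q - i = p + q - (i + 1 : ℕ) := by push_cast; ring
          have e2 : ((i + 1 : ℕ) : ℤ) - 1 = i := by push_cast; ring
          rw [e1, e2, ← Finsupp.smul_single, smul_smul, ← add_smul]
          have := choose_succ_mul (p : ℂ) i
          push_cast
          rw [← this]
          convert zero_smul ℂ _ using 2
          ring
      · intro i hi
        rw [deriv]
        obtain ⟨j, rfl⟩ : ∃ j, i = j + 1 := ⟨i - 1, by omega⟩
        rw [show ((j + 1 : ℕ) : ℤ) - 1 = j by push_cast; ring, hN j (by omega), smul_zero]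

/-- Reorganising a double sum by antidiagonals. -/
theorem sum_antidiag {W : Type*} [AddCommGroup W] [Module ℂ W] (N : ℕ) (f : ℕ → ℕ → ℂ) (E : ℕ → W)
    (hE : ∀ l, N ≤ l → E l = 0) :
    ∑ j ∈ Finset.range N, ∑ i ∈ Finset.range N, f j i • E (j + i) =
      ∑ l ∈ Finset.range N, (∑ ji ∈ Finset.HasAntidiagonal.antidiagonal l, f ji.1 ji.2) • E l := by
  simp only [Finset.sum_smul]
  rw [← Finset.sum_product', Finset.sum_sigma']
  symm
  apply Finset.sum_of_injOn (fun x : (_ : ℕ) × ℕ × ℕ => x.2)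
  · rintro ⟨l, j, i⟩ hx ⟨l', j', i'⟩ hx' h
    simp only [Finset.coe_sigma, Set.mem_sigma_iff, Finset.mem_coe, Finset.HasAntidiagonal.mem_antidiagonal] at hx hx'
    obtain ⟨rfl, rfl⟩ := Prod.mk.inj h
    obtain rfl : l = l' := hx.2.symm.trans hx'.2
    rfl
  · rintro ⟨l, j, i⟩ hx
    simp only [Finset.coe_sigma, Set.mem_sigma_iff, Finset.mem_coe, Finset.HasAntidiagonal.mem_antidiagonal,
      Finset.mem_range] at hx
    simp only [Finset.coe_product, Set.mem_prod, Finset.mem_coe, Finset.mem_range]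
    omega
  · rintro ⟨j, i⟩ hx hn
    rw [hE, smul_zero]
    by_contra hlt
    simp only [not_le] at hlt
    apply hn
    refine ⟨⟨j + i, j, i⟩, ?_, rfl⟩
    simp only [Finset.coe_sigma, Set.mem_sigma_iff, Finset.mem_coe, Finset.HasAntidiagonal.mem_antidiagonal,
      Finset.mem_range]
    exact ⟨hlt, trivial⟩
  · rintro ⟨l, j, i⟩ hx
    simp only [Finset.mem_sigma, Finset.HasAntidiagonal.mem_antidiagonal] at hx
    simp [hx.2]

theorem choose_neg_pow (x : ℂ) (n : ℕ) :
    Ring.choose x n = (-1) ^ n * Ring.choose (-x + n - 1) n := by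
  have := Ring.choose_neg (-x) n
  rw [neg_neg] at this
  rw [this, Units.smul_def, Int.coe_negOnePow_natCast, zsmul_eq_mul]
  push_cast
  rfl

theorem choose_skew (p q : ℂ) (l : ℕ) :
    ∑ ji ∈ Finset.HasAntidiagonal.antidiagonal l,
      ((-1) ^ ji.1 * Ring.choose q ji.1 * Ring.choose (p + q - ji.1) ji.2) = Ring.choose p l := by
  rw [choose_neg_pow p l, show -p + (l : ℂ) - 1 = q + (l - 1 - p - q) by ring,
    Ring.add_choose_eq l (Commute.all _ _), Finset.mul_sum]
  refine Finset.sum_congr rfl fun ji h => ?_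
  rw [Finset.HasAntidiagonal.mem_antidiagonal] at h
  rw [choose_neg_pow (p + q - ji.1) ji.2, ← h, pow_add]
  rw [show -(p + q - (ji.1 : ℂ)) + ji.2 - 1 = ((ji.1 + ji.2 : ℕ) : ℂ) - 1 - p - q by push_cast; ring]
  ring

theorem choose_jacobi (p q : ℂ) (k l : ℕ) :
    ∑ ij ∈ Finset.HasAntidiagonal.antidiagonal l, (Ring.choose p (k + ij.1) * (k + ij.1).choose k *
      Ring.choose q ij.2) = Ring.choose p k * Ring.choose (p + q - k) l := by
  rw [show p + q - k = p - k + q by ring, Ring.add_choose_eq l (Commute.all _ _), Finset.mul_sum]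
  refine Finset.sum_congr rfl fun ij _ => ?_
  have := Ring.choose_smul_choose p (n := k + ij.1) (k := k) (by omega)
  rw [nsmul_eq_mul, Nat.add_sub_cancel_left] at this
  rw [← mul_assoc, ← this]
  ring

/-- Skew-symmetry of the modes. -/
theorem mode_skew (a b : V) (j : ℕ) (N : ℕ) (hN : ∀ i : ℕ, N ≤ i → mode (i : ℤ) a b = 0) :
    mode (j : ℤ) b a = ∑ i ∈ Finset.range N,
      (-(-1) ^ j * (-1) ^ i : ℂ) • mode (-1 - (i : ℤ)) (mode ((j + i : ℕ) : ℤ) a b) vac := by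
  have J := jacobi a b (vac : V) (-1) j 0
  rw [finsum_range _ N, finsum_range _ 1] at J
  · rw [Finset.sum_range_one] at J
    simp only [Nat.cast_zero, add_zero, pow_zero, Ring.choose_zero_right, one_mul, one_smul,
      mode_neg_one_vac, sub_zero, zpow_natCast] at J
    rw [mode_vac _ b (by omega), map_zero, zero_sub] at J
    have h2 : ((-1 : ℂ) ^ j) * (-1) ^ j = 1 := by rw [← mul_pow]; simp
    have : mode (j : ℤ) b a = (-(-1 : ℂ) ^ j) • -((-1 : ℂ) ^ j • mode (j : ℤ) b a) := by
      rw [smul_neg, neg_smul, neg_neg, smul_smul, h2, one_smul]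
    rw [this, ← J, Finset.smul_sum]
    refine Finset.sum_congr rfl fun i _ => ?_
    rw [smul_smul, choose_neg_pow]
    simp only [Int.cast_neg, Int.cast_one, neg_neg, add_sub_cancel_left]
    rw [← Nat.cast_one, show ((i : ℂ)) = ((i : ℕ) : ℂ) from rfl, Ring.choose_natCast]
    simp
  · intro i hi
    rw [mode_vac _ b (by omega), mode_vac _ a (by omega)]
    simp
  · intro i hi
    rw [show (j : ℤ) + i = ((j + i : ℕ) : ℤ) by push_cast; ring, hN _ (by omega)]
    simp

theorem loopBracket_leibniz (x y z : Loop V) : loopBracket x (loopBracket y z) =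
    loopBracket (loopBracket x y) z + loopBracket y (loopBracket x z) := by
  induction x using Finsupp.induction_linear with
  | zero => simp
  | add x x' h h' => simp only [map_add, LinearMap.add_apply, h, h']; abel
  | single p a =>
  induction y using Finsupp.induction_linear with
  | zero => simp
  | add x x' h h' => simp only [map_add, LinearMap.add_apply, h, h']; abel
  | single q b =>
  induction z using Finsupp.induction_linear with
  | zero => simp
  | add x x' h h' => simp only [map_add, h, h']; abel
  | single s c =>
  obtain ⟨N₁, h₁⟩ := trunc_nat a b
  obtain ⟨N₂, h₂⟩ := trunc_nat b c
  obtain ⟨N₃, h₃⟩ := trunc_nat a c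
  choose f₁ hf₁ using fun k : ℕ => trunc_nat (mode (k : ℤ) a b) c
  choose f₂ hf₂ using fun k : ℕ => trunc_nat a (mode (k : ℤ) b c)
  choose f₃ hf₃ using fun k : ℕ => trunc_nat b (mode (k : ℤ) a c)
  obtain ⟨M, hM⟩ : ∃ M, N₁ ≤ M ∧ N₂ ≤ M ∧ N₃ ≤ M ∧ (∀ k < N₁, f₁ k ≤ M) ∧ (∀ k < N₂, f₂ k ≤ M) ∧
      (∀ k < N₃, f₃ k ≤ M) := by
    refine ⟨N₁ + N₂ + N₃ + ∑ k ∈ Finset.range N₁, f₁ k + ∑ k ∈ Finset.range N₂, f₂ k +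
      ∑ k ∈ Finset.range N₃, f₃ k, by omega, by omega, by omega, ?_, ?_, ?_⟩
    · intro k hk
      have := Finset.single_le_sum (f := f₁) (fun _ _ => Nat.zero_le _) (Finset.mem_range.mpr hk)
      omega
    · intro k hk
      have := Finset.single_le_sum (f := f₂) (fun _ _ => Nat.zero_le _) (Finset.mem_range.mpr hk)
      omega
    · intro k hk
      have := Finset.single_le_sum (f := f₃) (fun _ _ => Nat.zero_le _) (Finset.mem_range.mpr hk)
      omega
  obtain ⟨m₁, m₂, m₃, m₄, m₅, m₆⟩ := hM
  have F1 : ∀ k l : ℕ, M + M ≤ k + l → mode (l : ℤ) (mode (k : ℤ) a b) c = 0 := by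
    intro k l h
    by_cases hk : k < N₁
    · have := m₄ k hk
      exact hf₁ k l (by omega)
    · rw [h₁ k (by omega)]; simp
  have F1' : ∀ k l : ℕ, M ≤ l → mode (l : ℤ) (mode (k : ℤ) a b) c = 0 := by
    intro k l h
    by_cases hk : k < N₁
    · have := m₄ k hk
      exact hf₁ k l (by omega)
    · rw [h₁ k (by omega)]; simp
  have F2 : ∀ k l : ℕ, M + M ≤ l → mode (l : ℤ) a (mode (k : ℤ) b c) = 0 := by
    intro k l h
    by_cases hk : k < N₂
    · have := m₅ k hk
      exact hf₂ k l (by omega)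
    · rw [h₂ k (by omega)]; simp
  have F3 : ∀ k l : ℕ, M + M ≤ l → mode (l : ℤ) b (mode (k : ℤ) a c) = 0 := by
    intro k l h
    by_cases hk : k < N₃
    · have := m₆ k hk
      exact hf₃ k l (by omega)
    · rw [h₃ k (by omega)]; simp
  set N := M + M with hN
  have A : loopBracket (Finsupp.single p a) (loopBracket (Finsupp.single q b)
      (Finsupp.single s c)) = ∑ i ∈ Finset.range N, ∑ j ∈ Finset.range N,
      (Ring.choose (p : ℂ) i * Ring.choose (q : ℂ) j) •
        Finsupp.single (p + q + s - (i + j : ℕ)) (mode (i : ℤ) a (mode (j : ℤ) b c)) := by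
    rw [loopBracket_single _ _ _ _ N (fun i hi => h₂ i (by omega)), map_sum, Finset.sum_comm]
    refine Finset.sum_congr rfl fun j _ => ?_
    rw [map_smul, loopBracket_single _ _ _ _ N (F2 j), Finset.smul_sum]
    refine Finset.sum_congr rfl fun i _ => ?_
    rw [smul_smul, mul_comm]
    congr 2
    push_cast; ring
  have B : loopBracket (Finsupp.single q b) (loopBracket (Finsupp.single p a)
      (Finsupp.single s c)) = ∑ i ∈ Finset.range N, ∑ j ∈ Finset.range N,
      (Ring.choose (p : ℂ) i * Ring.choose (q : ℂ) j) •
        Finsupp.single (p + q + s - (i + j : ℕ)) (mode (j : ℤ) b (mode (i : ℤ) a c)) := by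
    rw [loopBracket_single _ _ _ _ N (fun i hi => h₃ i (by omega)), map_sum]
    refine Finset.sum_congr rfl fun j _ => ?_
    rw [map_smul, loopBracket_single _ _ _ _ N (F3 j), Finset.smul_sum]
    refine Finset.sum_congr rfl fun i _ => ?_
    rw [smul_smul]
    congr 2
    push_cast; ring
  have C : loopBracket (loopBracket (Finsupp.single p a) (Finsupp.single q b))
      (Finsupp.single s c) = ∑ k ∈ Finset.range N, ∑ l ∈ Finset.range N,
      (Ring.choose (p : ℂ) k * Ring.choose ((p : ℂ) + q - k) l) •
        Finsupp.single (p + q + s - (k + l : ℕ)) (mode (l : ℤ) (mode (k : ℤ) a b) c) := by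
    rw [loopBracket_single _ _ _ _ N (fun i hi => h₁ i (by omega)), map_sum, LinearMap.sum_apply]
    refine Finset.sum_congr rfl fun k _ => ?_
    rw [map_smul, LinearMap.smul_apply,
      loopBracket_single _ _ _ _ N (fun i hi => F1' k i (by omega)), Finset.smul_sum]
    refine Finset.sum_congr rfl fun i _ => ?_
    rw [smul_smul]
    congr 2
    · push_cast; rfl
    · push_cast; ring
  rw [← sub_eq_iff_eq_add, A, B, C]
  simp only [← Finset.sum_sub_distrib, ← smul_sub, ← Finsupp.single_sub]
  have comm : ∀ i j : ℕ, mode (i : ℤ) a (mode (j : ℤ) b c) - mode (j : ℤ) b (mode (i : ℤ) a c) =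
      ∑ k ∈ Finset.range N, (i.choose k : ℂ) • mode ((i : ℤ) + j - k) (mode (k : ℤ) a b) c := by
    intro i j
    rw [commutator, finsum_range _ N]
    · simp only [Int.cast_natCast, Ring.choose_natCast]
    · intro k hk
      rw [h₁ k (by omega)]; simp
  simp only [comm, Finsupp.single_finsetSum, Finset.smul_sum]
  rw [Finset.sum_congr rfl fun i _ => Finset.sum_comm, Finset.sum_comm]
  refine Finset.sum_congr rfl fun k _ => ?_
  have key : ∀ i, N ≤ i → ∑ j ∈ Finset.range N, (Ring.choose (p : ℂ) i * Ring.choose (q : ℂ) j) •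
      Finsupp.single (p + q + s - (i + j : ℕ))
        ((i.choose k : ℂ) • mode ((i : ℤ) + j - k) (mode (k : ℤ) a b) c) = 0 := by
    intro i hi
    refine Finset.sum_eq_zero fun j _ => ?_
    by_cases hik : i < k
    · rw [Nat.choose_eq_zero_of_lt hik]; simp
    · rw [show (i : ℤ) + j - k = ((i + j - k : ℕ) : ℤ) by omega, F1 _ _ (by omega)]; simp
  rw [Finset.sum_subset (Finset.range_subset_range.mpr (Nat.le_add_left N k))
    (fun i _ hi => key i (by simpa using hi)), Finset.sum_range_add,
    Finset.sum_eq_zero (s := Finset.range k), zero_add]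
  · have S := sum_antidiag N (fun i j => Ring.choose (p : ℂ) (k + i) * (k + i).choose k *
      Ring.choose (q : ℂ) j) (fun l => Finsupp.single (p + q + s - (k + l : ℕ))
        (mode (l : ℤ) (mode (k : ℤ) a b) c)) (fun l hl => by
          rw [F1 k l (by omega), Finsupp.single_zero])
    simp only [choose_jacobi] at S
    rw [← S]
    refine Finset.sum_congr rfl fun i _ => Finset.sum_congr rfl fun j _ => ?_
    rw [← Finsupp.smul_single, smul_smul, add_assoc k i j,
      show ((k + i : ℕ) : ℤ) + j - k = ((i + j : ℕ) : ℤ) by push_cast; ring]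
    congr 1
    ring
  · intro i hi
    rw [Nat.choose_eq_zero_of_lt (Finset.mem_range.mp hi)]
    simp

end

end VertexOperatorAlgebra

namespace FiniteOrderAut

noncomputable section

open VertexOperatorAlgebra

variable {V : Type u} [AddCommGroup V] [Module ℂ V] [VertexOperatorAlgebra V]
variable (g : FiniteOrderAut V)

theorem eig_sub_int (q : ℚ) (i : ℤ) : g.eig (q - i) = g.eig q := by
  simp only [eig, exp_sub_int]

theorem eig_sub_nat (q : ℚ) (i : ℕ) : g.eig (q - i) = g.eig q := g.eig_sub_int q i

theorem L_mem_eig {q : ℚ} {a : V} (ha : a ∈ g.eig q) : mode 0 conf a ∈ g.eig q := by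
  have h : (conf : V) ∈ g.eig 0 := by simp [mem_eig, g.map_conf]
  simpa using g.mode_mem_eig h ha 0

/-- `ℒ(V, g)`, spanned by the `t^q ⊗ a` with `a ∈ V` and `g a = e^{2πiq} a`; for `a ≠ 0` such a `q`
lies in `(1/T)ℤ`. -/
def loopInv : Submodule ℂ (Loop V) where
  carrier := {f | ∀ q, f q ∈ g.eig q}
  zero_mem' := fun _ => Submodule.zero_mem _
  add_mem' := fun hf hh q => Submodule.add_mem _ (hf q) (hh q)
  smul_mem' := fun c _ hf q => Submodule.smul_mem _ c (hf q)

variable {g}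

theorem single_mem {q : ℚ} {a : V} (ha : a ∈ g.eig q) : Finsupp.single q a ∈ g.loopInv := by
  intro p
  by_cases h : q = p
  · subst h; simpa using ha
  · rw [Finsupp.single_eq_of_ne' h]; exact Submodule.zero_mem _

theorem loop_induction {p : Loop V → Prop} {x : Loop V} (hx : x ∈ g.loopInv) (zero : p 0)
    (add : ∀ x y, p x → p y → p (x + y))
    (single : ∀ q, ∀ a ∈ g.eig q, p (Finsupp.single q a)) : p x := by
  rw [← Finsupp.sum_single x]
  exact Finset.sum_induction _ p add zero fun q _ => single q _ (hx q)

theorem loopD_mem {x : Loop V} (hx : x ∈ g.loopInv) : loopD x ∈ g.loopInv := by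
  refine loop_induction (p := fun x => loopD x ∈ g.loopInv) hx (by simp) (fun x y hx hy => ?_)
    (fun q a ha => ?_)
  · rw [map_add]
    exact Submodule.add_mem _ hx hy
  · rw [loopD_single]
    refine Submodule.add_mem _ (Submodule.smul_mem _ _ (single_mem ?_)) (single_mem (g.L_mem_eig ha))
    have := g.eig_sub_nat q 1
    rw [Nat.cast_one] at this
    rwa [this]

theorem loopBracket_mem {x y : Loop V} (hx : x ∈ g.loopInv) (hy : y ∈ g.loopInv) :
    loopBracket x y ∈ g.loopInv := by
  refine loop_induction (p := fun x => loopBracket x y ∈ g.loopInv) hx (by simp)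
    (fun x x' h h' => ?_) (fun p a ha => ?_)
  · rw [map_add]
    exact Submodule.add_mem _ h h'
  · refine loop_induction (p := fun y => loopBracket _ y ∈ g.loopInv) hy (by simp)
      (fun x x' h h' => ?_) (fun q b hb => ?_)
    · rw [map_add]
      exact Submodule.add_mem _ h h'
    · obtain ⟨N, hN⟩ := trunc_nat a b
      rw [loopBracket_single _ _ _ _ N hN]
      refine Submodule.sum_mem _ fun i _ => Submodule.smul_mem _ _ (single_mem ?_)
      rw [g.eig_sub_nat]
      exact g.mode_mem_eig ha hb i

variable (g)

/-- `D ℒ(V, g)`. -/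
def loopDInv : Submodule ℂ (Loop V) := g.loopInv.map loopD

variable {g}

theorem mkQ_single_L (s : ℚ) {x : V} (hx : x ∈ g.eig s) :
    g.loopDInv.mkQ (Finsupp.single s (mode 0 conf x)) =
      -((s : ℂ) • g.loopDInv.mkQ (Finsupp.single (s - 1) x)) := by
  rw [eq_neg_iff_add_eq_zero, ← map_smul, ← map_add, Submodule.mkQ_apply,
    Submodule.Quotient.mk_eq_zero]
  exact ⟨_, single_mem hx, by rw [loopD_single, add_comm]⟩

theorem mkQ_single_exp (i : ℕ) (s : ℚ) {x : V} (hx : x ∈ g.eig s) :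
    g.loopDInv.mkQ (Finsupp.single s (mode (-1 - (i : ℤ)) x vac)) =
      ((-1) ^ i * Ring.choose (s : ℂ) i) • g.loopDInv.mkQ (Finsupp.single (s - i) x) := by
  induction i generalizing x with
  | zero => simp [mode_neg_one_vac]
  | succ i ih =>
    have hd := deriv (-1 - (i : ℤ)) x (vac : V)
    have h0 : (i : ℂ) + 1 ≠ 0 := by exact_mod_cast Nat.succ_ne_zero i
    have e : mode (-1 - ((i + 1 : ℕ) : ℤ)) x vac =
        ((i : ℂ) + 1)⁻¹ • mode (-1 - (i : ℤ)) (mode 0 conf x) vac := by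
      rw [hd, smul_smul, show -1 - (i : ℤ) - 1 = -1 - ((i + 1 : ℕ) : ℤ) by push_cast; ring]
      rw [show ((i : ℂ) + 1)⁻¹ * -(((-1 - (i : ℤ)) : ℤ) : ℂ) = 1 by push_cast; field_simp; ring,
        one_smul]
    rw [e, ← Finsupp.smul_single, map_smul, ih (g.L_mem_eig hx), mkQ_single_L (s - i)
      (by rwa [g.eig_sub_nat]), smul_neg, smul_neg, smul_smul, smul_smul, ← neg_smul,
      show s - i - 1 = s - ((i + 1 : ℕ) : ℚ) by push_cast; ring]
    congr 1
    have := choose_succ_mul' (s : ℂ) i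
    have h2 : Ring.choose (s : ℂ) (i + 1) = ((i : ℂ) + 1)⁻¹ * (Ring.choose (s : ℂ) i * (s - i)) := by
      rw [← this, inv_mul_cancel_left₀ h0]
    rw [h2]
    push_cast
    ring

theorem loopBracket_skew {x y : Loop V} (hx : x ∈ g.loopInv) (hy : y ∈ g.loopInv) :
    loopBracket x y + loopBracket y x ∈ g.loopDInv := by
  rw [← Submodule.Quotient.mk_eq_zero, ← Submodule.mkQ_apply]
  refine loop_induction (p := fun x => g.loopDInv.mkQ (loopBracket x y + loopBracket y x) = 0) hx
    (by simp) (fun x x' h h' => ?_) (fun p a ha => ?_)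
  · simp only [map_add, LinearMap.add_apply] at *
    rw [add_add_add_comm, h, h', add_zero]
  refine loop_induction (p := fun y => g.loopDInv.mkQ (loopBracket _ y + loopBracket y _) = 0) hy
    (by simp) (fun x x' h h' => ?_) (fun q b hb => ?_)
  · simp only [map_add, LinearMap.add_apply] at *
    rw [add_add_add_comm, h, h', add_zero]
  obtain ⟨N₁, h₁⟩ := trunc_nat a b
  obtain ⟨N₂, h₂⟩ := trunc_nat b a
  set N := max N₁ N₂
  have hN₁ : ∀ i : ℕ, N ≤ i → mode (i : ℤ) a b = 0 := fun i hi => h₁ i ((le_max_left _ _).trans hi)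
  have hN₂ : ∀ i : ℕ, N ≤ i → mode (i : ℤ) b a = 0 := fun i hi => h₂ i ((le_max_right _ _).trans hi)
  rw [loopBracket_single _ _ _ _ N hN₁, loopBracket_single _ _ _ _ N hN₂, map_add, map_sum, map_sum]
  have S := sum_antidiag N (fun j i => (-1) ^ j * Ring.choose (q : ℂ) j *
    Ring.choose ((p : ℂ) + q - j) i) (fun l => g.loopDInv.mkQ (Finsupp.single (p + q - (l : ℕ))
      (mode (l : ℤ) a b))) (fun l hl => by rw [hN₁ l hl]; simp)
  simp only [choose_skew] at S
  simp only [map_smul]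
  rw [← S, ← Finset.sum_add_distrib]
  refine Finset.sum_eq_zero fun j _ => ?_
  rw [mode_skew a b j N hN₁, Finsupp.single_finsetSum, map_sum, Finset.smul_sum,
    ← Finset.sum_add_distrib]
  refine Finset.sum_eq_zero fun i _ => ?_
  have hm : mode ((j + i : ℕ) : ℤ) a b ∈ g.eig (q + p - j) := by
    rw [g.eig_sub_nat, add_comm]
    exact g.mode_mem_eig ha hb _
  rw [← Finsupp.smul_single, map_smul, mkQ_single_exp i _ hm, smul_smul, smul_smul,
    show q + p - (j : ℚ) - i = p + q - (j + i : ℕ) by push_cast; ring, ← add_smul]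
  convert zero_smul ℂ _ using 2
  have h2 : ((-1 : ℂ) ^ i) * (-1) ^ i = 1 := by rw [← mul_pow]; simp
  rw [show (((q + p - (j : ℚ)) : ℚ) : ℂ) = (p : ℂ) + q - j by push_cast; ring]
  linear_combination (-(-1) ^ j * Ring.choose (q : ℂ) j * Ring.choose ((p : ℂ) + q - j) i) * h2

variable (g)

/-- The Lie algebra `V[g] = ℒ(V, g) / D ℒ(V, g)`. -/
def Vg : Type u := g.loopInv ⧸ g.loopDInv.comap g.loopInv.subtype

instance : AddCommGroup g.Vg :=
  inferInstanceAs (AddCommGroup (g.loopInv ⧸ g.loopDInv.comap g.loopInv.subtype))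

instance : Module ℂ g.Vg :=
  inferInstanceAs (Module ℂ (g.loopInv ⧸ g.loopDInv.comap g.loopInv.subtype))

/-- The quotient map from `ℒ(V, g)` onto `V[g]`. -/
def toVg : g.loopInv →ₗ[ℂ] g.Vg := (g.loopDInv.comap g.loopInv.subtype).mkQ

theorem toVg_surjective : Function.Surjective g.toVg := Submodule.mkQ_surjective _

theorem toVg_eq_zero {x : g.loopInv} : g.toVg x = 0 ↔ (x : Loop V) ∈ g.loopDInv :=
  Submodule.Quotient.mk_eq_zero _

/-- The product `(x, y) ↦ x_0 y` on `ℒ(V, g)`. -/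
def invBracket : g.loopInv →ₗ[ℂ] g.loopInv →ₗ[ℂ] g.loopInv :=
  LinearMap.mk₂ ℂ (fun x y => ⟨loopBracket x y, loopBracket_mem x.2 y.2⟩)
    (fun _ _ _ => by ext1; simp) (fun _ _ _ => by ext1; simp)
    (fun _ _ _ => by ext1; simp) (fun _ _ _ => by ext1; simp)

/-- The bracket of `V[g]`, induced by `(x, y) ↦ x_0 y`. -/
def vgBracket : g.Vg →ₗ[ℂ] g.Vg →ₗ[ℂ] g.Vg :=
  (g.loopDInv.comap g.loopInv.subtype).liftQ
    { toFun := fun x => (g.loopDInv.comap g.loopInv.subtype).liftQ (g.toVg ∘ₗ g.invBracket x) (by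
        rintro y ⟨z, hz, hy⟩
        rw [LinearMap.mem_ker, LinearMap.comp_apply, toVg_eq_zero]
        have := loopBracket_skew (g := g) x.2 y.2
        rw [Submodule.subtype_apply] at hy
        rw [← hy, loopBracket_D, add_zero] at this
        change loopBracket (x : Loop V) (y : Loop V) ∈ _
        rwa [← hy])
      map_add' := fun x y => by
        apply LinearMap.ext
        intro z
        obtain ⟨z, rfl⟩ := g.toVg_surjective z
        change g.toVg (g.invBracket (x + y) z) =
          g.toVg (g.invBracket x z) + g.toVg (g.invBracket y z)
        rw [map_add, LinearMap.add_apply, map_add]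
      map_smul' := fun c x => by
        apply LinearMap.ext
        intro z
        obtain ⟨z, rfl⟩ := g.toVg_surjective z
        change g.toVg (g.invBracket (c • x) z) = c • g.toVg (g.invBracket x z)
        rw [map_smul, LinearMap.smul_apply, map_smul] }
    (by
      rintro x ⟨z, hz, hx⟩
      rw [LinearMap.mem_ker]
      apply LinearMap.ext
      intro y
      obtain ⟨y, rfl⟩ := g.toVg_surjective y
      change g.toVg (g.invBracket x y) = 0
      rw [toVg_eq_zero]
      change loopBracket (x : Loop V) (y : Loop V) ∈ _
      rw [Submodule.subtype_apply] at hx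
      rw [← hx, loopBracket_D]
      exact Submodule.zero_mem _)

theorem vgBracket_toVg (x y : g.loopInv) :
    g.vgBracket (g.toVg x) (g.toVg y) = g.toVg (g.invBracket x y) := rfl

instance : LieRing g.Vg where
  bracket x y := g.vgBracket x y
  add_lie x y z := by
    change g.vgBracket (x + y) z = g.vgBracket x z + g.vgBracket y z
    rw [map_add, LinearMap.add_apply]
  lie_add x y z := map_add (g.vgBracket x) y z
  lie_self x := by
    obtain ⟨x, rfl⟩ := g.toVg_surjective x
    change g.toVg (g.invBracket x x) = 0
    have h := loopBracket_skew (g := g) x.2 x.2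
    have h2 : g.toVg (g.invBracket x x + g.invBracket x x) = 0 := by
      rw [toVg_eq_zero]; exact h
    rw [map_add, ← two_smul ℂ] at h2
    exact (smul_eq_zero.mp h2).resolve_left two_ne_zero
  leibniz_lie x y z := by
    obtain ⟨x, rfl⟩ := g.toVg_surjective x
    obtain ⟨y, rfl⟩ := g.toVg_surjective y
    obtain ⟨z, rfl⟩ := g.toVg_surjective z
    change g.toVg (g.invBracket x (g.invBracket y z)) =
      g.toVg (g.invBracket (g.invBracket x y) z) + g.toVg (g.invBracket y (g.invBracket x z))
    rw [← map_add]
    congr 1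
    ext1
    exact loopBracket_leibniz _ _ _

instance : LieAlgebra ℂ g.Vg where
  lie_smul c x y := map_smul (g.vgBracket x) c y

/-- The element `a(q)` of `V[g]`: the image of `t^q ⊗ a` for `a ∈ V` with `g a = e^{2πiq} a`, and
`0` for `a` in the other eigenspaces of `g`. -/
def elem (q : ℚ) : V →ₗ[ℂ] g.Vg :=
  g.toVg ∘ₗ (Finsupp.lsingle q ∘ₗ g.proj q).codRestrict g.loopInv fun a =>
    single_mem (g.proj_mem q a)

/-- The subspace `V[g]_n` of degree `n`, where `deg a(q) = wt a - q - 1`. -/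
def VgDeg (n : ℚ) : Submodule ℂ g.Vg :=
  Submodule.span ℂ {x | ∃ (w : ℤ) (q : ℚ) (a : V), a ∈ wtSpace V w ∧ (w : ℚ) - q - 1 = n ∧
    x = g.elem q a}

/-- The universal enveloping algebra of `V[g]`. -/
abbrev UEg : Type u := UniversalEnvelopingAlgebra ℂ g.Vg

attribute [local instance] LieRing.ofAssociativeRing LieAlgebra.ofAssociativeAlgebra in
/-- The canonical map from `V[g]` to its universal enveloping algebra. -/
def iota : g.Vg →ₗ[ℂ] g.UEg := (UniversalEnvelopingAlgebra.ι ℂ (L := g.Vg)).toLinearMap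

/-! ### The induced module `M(U)`, its maximal submodule, and `L(U)` -/

variable {g}

open TensorProduct

/-- The relations `x p ⊗ u = x ⊗ p u` for `p ∈ P = V[g]_- ⊕ V[g]_0`: the spaces of negative degree
act on `U` as `0`, and `o(a) = a(wt a - 1)` acts as `a + O_g(V)` for homogeneous `a ∈ V^0`. -/
def indRel (U : AgMod.{u, v} g) : Submodule g.UEg (g.UEg ⊗[ℂ] U.carrier) :=
  Submodule.span g.UEg
    ({x | ∃ n < (0 : ℚ), ∃ y ∈ g.VgDeg n, ∃ z : U.carrier, x = g.iota y ⊗ₜ[ℂ] z} ∪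
     {x | ∃ (w : ℤ), ∃ a ∈ wtSpace V w, a ∈ g.eig 0 ∧ ∃ z : U.carrier,
       x = g.iota (g.elem ((w : ℚ) - 1) a) ⊗ₜ[ℂ] z -
         (1 : g.UEg) ⊗ₜ[ℂ] (U.rho (g.Og.mkQ a) z)})

/-- The induced module `M(U) = U(V[g]) ⊗_{U(P)} U`. -/
abbrev Ind (U : AgMod.{u, v} g) : Type (max u v) := (g.UEg ⊗[ℂ] U.carrier) ⧸ indRel U

/-- The canonical map from `U` to `M(U)`. -/
def indIncl (U : AgMod.{u, v} g) : U.carrier →ₗ[ℂ] Ind U :=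
  (indRel U).mkQ.restrictScalars ℂ ∘ₗ TensorProduct.mk ℂ g.UEg U.carrier 1

/-- The subspace `M(U)(n)`, spanned by all `x₁ ⋯ x_k u` with `u ∈ U` and with `x_i ∈ V[g]`
homogeneous of degrees adding up to `n`. -/
def indGr (U : AgMod.{u, v} g) (n : ℚ) : Submodule ℂ (Ind U) :=
  Submodule.span ℂ {x | ∃ (l : List (ℚ × g.Vg)) (z : U.carrier), (∀ p ∈ l, p.2 ∈ g.VgDeg p.1) ∧
    (l.map Prod.fst).sum = n ∧ x = (l.map fun p => g.iota p.2).prod • indIncl U z}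

/-- The graded `V[g]`-submodules `J` of `M(U)` with `J ∩ U = 0`. A `V[g]`-submodule is the same as
a submodule over the universal enveloping algebra; it is graded if it is the sum of its
intersections with the `M(U)(n)`. -/
structure IsGradedAvoiding (U : AgMod.{u, v} g) (J : Submodule g.UEg (Ind U)) : Prop where
  graded : J.restrictScalars ℂ ≤ ⨆ n : ℚ, J.restrictScalars ℂ ⊓ indGr U n
  inter_eq : J.restrictScalars ℂ ⊓ LinearMap.range (indIncl U) = ⊥

/-- The submodule `J` of `M(U)` generated by all graded `V[g]`-submodules that meet `U` in `0`. -/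
def maxJ (U : AgMod.{u, v} g) : Submodule g.UEg (Ind U) := sSup {J | IsGradedAvoiding U J}

/-- The underlying space of `L(U) = M(U) / J`. -/
abbrev LCar (U : AgMod.{u, v} g) : Type (max u v) := Ind U ⧸ maxJ U

/-- The quotient map `M(U) → L(U)`. -/
def LMk (U : AgMod.{u, v} g) : Ind U →ₗ[ℂ] LCar U := (maxJ U).mkQ.restrictScalars ℂ

/-- The vertex operators on `L(U)`: the mode `a_q` acts as `a(q) ∈ V[g]`. -/
def LY (U : AgMod.{u, v} g) (q : ℚ) : V →ₗ[ℂ] Module.End ℂ (LCar U) :=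
  (Algebra.lsmul ℂ ℂ (LCar U)).toLinearMap ∘ₗ g.iota ∘ₗ g.elem q

/-- The grading of `L(U)` induced by that of `M(U)`. -/
def LGr (U : AgMod.{u, v} g) (n : ℚ) : Submodule ℂ (LCar U) := (indGr U n).map (LMk U)

/-- `L(U)` as an admissible `g`-twisted `V`-module, given that it satisfies the axioms. -/
def LObj (U : AgMod.{u, v} g) (h : g.IsAdmissible (LY U) (LGr U)) : AdmMod.{u, max u v} g where
  carrier := LCar U
  Y := LY U
  gr := LGr U
  isAdmissible := h

end

end FiniteOrderAut

/-!
Everything is controlled by the projection `π : M(U) → U` along the positive degrees. It comes from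
the projection `U(V[g]) → U(P)` attached to the decomposition of `V[g]` into the subalgebras `P` and
`V[g]_+`, which is constructed as the orbit map of `1` under a right action of `V[g]` on `U(P)`, so
that the Poincaré-Birkhoff-Witt theorem is not needed. The submodule `J` is the largest one
contained in the kernel of `π`; thus `w = 0` in `L(U)` as soon as `π(t w) = 0` for all
`t ∈ U(V[g])`, and it suffices that `w` lies in a subspace of the kernel of `π` that is stable
under `P`.

On `L(U)` the commutator formula holds by construction. It implies that the defects of the twisted
Jacobi identity on vectors of `U` span a subspace stable under `P`, and `π` kills this subspace:
only the defects of degree zero matter, and a recursion in the exponents reduces these to the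
relations that define `O_g(V)` and `*_g`. So the defects vanish on `U`, and then on all of `L(U)`,
which is generated by `U`. Similarly, the vectors of `Ω(L(U))` of a fixed degree `n ≠ 0` form a
subspace of the kernel of `π` that is stable under `P`, hence vanish.
-/

theorem apply_eq_zero_of_iSupIndep {R M M' ι : Type*} [Ring R] [AddCommGroup M] [Module R M]
    [AddCommGroup M'] [Module R M'] {φ : M →ₗ[R] M'} {B : ι → Submodule R M'}
    (indep : iSupIndep B) {f : ι →₀ M} (hf : ∀ i, φ (f i) ∈ B i)
    (hsum : φ (f.sum fun _ x => x) = 0) (i : ι) : φ (f i) = 0 := by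
  rw [Finsupp.sum, map_sum] at hsum
  by_cases hi : i ∈ f.support
  · exact (iSupIndep_iff_finsetSum_eq_zero_imp_eq_zero _).mp indep f.support (fun i => φ (f i))
      (fun i _ => hf i) hsum i hi
  · rw [Finsupp.notMem_support_iff.mp hi, map_zero]

theorem ker_le_iSup_ker_inf {R M M' ι : Type*} [Ring R] [AddCommGroup M] [Module R M]
    [AddCommGroup M'] [Module R M'] {φ : M →ₗ[R] M'} {A : ι → Submodule R M}
    (iSup_eq : ⨆ i, A i = ⊤) (indep : iSupIndep fun i => (A i).map φ) :
    LinearMap.ker φ ≤ ⨆ i, LinearMap.ker φ ⊓ A i := by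
  intro x hx
  obtain ⟨f, hf, rfl⟩ := (Submodule.mem_iSup_iff_exists_finsupp A x).mp (iSup_eq ▸ trivial)
  exact Submodule.sum_mem _ fun i _ => Submodule.mem_iSup_of_mem i
    ⟨apply_eq_zero_of_iSupIndep indep (fun i => Submodule.mem_map_of_mem (hf i)) hx i, hf i⟩

namespace EnvelopingAlgebra

noncomputable section

open UniversalEnvelopingAlgebra

attribute [local instance 100] LieRing.ofAssociativeRing

variable {R L : Type*} [CommRing R] [LieRing L] [LieAlgebra R L]

theorem ι_lie (x y : L) : ι R ⁅x, y⁆ = ι R x * ι R y - ι R y * ι R x := by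
  rw [LieHom.map_lie, LieRing.of_associative_ring_bracket]

theorem adjoin_range_ι : Algebra.adjoin R (Set.range (ι R : L → _)) = ⊤ := by
  have range_eq : Set.range (ι R : L → _) = mkAlgHom R L '' Set.range (TensorAlgebra.ι R) := by
    rw [← Set.range_comp]
    rfl
  rw [range_eq, ← AlgHom.map_adjoin, TensorAlgebra.adjoin_range_ι, Algebra.map_top,
    AlgHom.range_eq_top]
  exact RingCon.mkₐ_surjective _

theorem mem_span_closure_range_ι (t : UniversalEnvelopingAlgebra R L) :
    t ∈ Submodule.span R (Submonoid.closure (Set.range (ι R : L → _)) : Set _) := by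
  rw [← Algebra.adjoin_eq_span, adjoin_range_ι]
  trivial

@[elab_as_elim]
theorem induction_left {p : UniversalEnvelopingAlgebra R L → Prop}
    (t : UniversalEnvelopingAlgebra R L) (one : p 1) (add : ∀ s t, p s → p t → p (s + t))
    (smul : ∀ (c : R) t, p t → p (c • t)) (mul : ∀ x t, p t → p (ι R x * t)) : p t := by
  induction mem_span_closure_range_ι t using Submodule.span_induction with
  | mem x hx =>
    induction hx using Submonoid.closure_induction_left with
    | one => exact one
    | mul_left x hx y _ ih => obtain ⟨x, rfl⟩ := hx; exact mul x y ih
  | zero => simpa using smul 0 1 one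
  | add x y _ _ hx hy => exact add x y hx hy
  | smul c x _ hx => exact smul c x hx

@[elab_as_elim]
theorem induction_right {p : UniversalEnvelopingAlgebra R L → Prop}
    (t : UniversalEnvelopingAlgebra R L) (one : p 1) (add : ∀ s t, p s → p t → p (s + t))
    (smul : ∀ (c : R) t, p t → p (c • t)) (mul : ∀ x t, p t → p (t * ι R x)) : p t := by
  induction mem_span_closure_range_ι t using Submodule.span_induction with
  | mem x hx =>
    induction hx using Submonoid.closure_induction_right with
    | one => exact one
    | mul_right x _ y hy ih => obtain ⟨y, rfl⟩ := hy; exact mul y x ih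
  | zero => simpa using smul 0 1 one
  | add x y _ _ hx hy => exact add x y hx hy
  | smul c x _ hx => exact smul c x hx

section Modules

variable {M : Type*} [AddCommGroup M] [Module (UniversalEnvelopingAlgebra R L) M]

theorem ι_smul_ι_smul (x y : L) (m : M) :
    ι R x • ι R y • m = ι R ⁅x, y⁆ • m + ι R y • ι R x • m := by
  rw [ι_lie, sub_smul, mul_smul, mul_smul, sub_add_cancel]

variable [Module R M] [IsScalarTower R (UniversalEnvelopingAlgebra R L) M]

theorem smul_mem_of_ι_smul_mem {S : Submodule R M} (hS : ∀ y : L, ∀ s ∈ S, ι R y • s ∈ S)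
    (t : UniversalEnvelopingAlgebra R L) {s : M} (hs : s ∈ S) : t • s ∈ S := by
  induction t using induction_left with
  | one => rwa [one_smul]
  | add x y hx hy => rw [add_smul]; exact S.add_mem hx hy
  | smul c x hx => rw [smul_assoc]; exact S.smul_mem c hx
  | mul y x hx => rw [mul_smul]; exact hS y _ hx

theorem smul_mem_of_codisjoint {P N : Submodule R L} (h : Codisjoint P N) {W S : Submodule R M}
    (hW : ∀ y ∈ P, ∀ w ∈ W, ι R y • w ∈ W) (hWS : W ≤ S) (hS : ∀ y ∈ N, ∀ s ∈ S, ι R y • s ∈ S)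
    (t : UniversalEnvelopingAlgebra R L) {w : M} (hw : w ∈ W) : t • w ∈ S := by
  -- The smallest `N`-stable subspace containing `W` is stable under `L`.
  let S₀ : Submodule R M := sInf {S | W ≤ S ∧ ∀ y ∈ N, ∀ s ∈ S, ι R y • s ∈ S}
  have S₀_le {S : Submodule R M} (hWS : W ≤ S) (hS : ∀ y ∈ N, ∀ s ∈ S, ι R y • s ∈ S) : S₀ ≤ S :=
    sInf_le ⟨hWS, hS⟩
  have W_le : W ≤ S₀ := le_sInf fun _ hS => hS.1
  have smul_mem {y : L} (hy : y ∈ N) {s : M} (hs : s ∈ S₀) : ι R y • s ∈ S₀ :=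
    Submodule.mem_sInf.mpr fun S hS => hS.2 y hy s (S₀_le hS.1 hS.2 hs)
  let S₁ : Submodule R M := S₀ ⊓ ⨅ y : L, S₀.comap (Algebra.lsmul R R M (ι R y))
  have mem_S₁ {s : M} : s ∈ S₁ ↔ s ∈ S₀ ∧ ∀ y : L, ι R y • s ∈ S₀ := by
    simp [S₁, Submodule.mem_iInf, -ι_apply]
  have S₀_le_S₁ : S₀ ≤ S₁ := by
    refine S₀_le (fun w hw => mem_S₁.mpr ⟨W_le hw, fun y => ?_⟩) fun y hy s hs => ?_
    · obtain ⟨p, hp, n, hn, rfl⟩ := Submodule.mem_sup.mp (h.eq_top ▸ Submodule.mem_top (x := y))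
      rw [map_add, add_smul]
      exact S₀.add_mem (W_le (hW p hp w hw)) (smul_mem hn (W_le hw))
    · rw [mem_S₁] at hs ⊢
      refine ⟨smul_mem hy hs.1, fun x => ?_⟩
      rw [ι_smul_ι_smul]
      exact S₀.add_mem (hs.2 _) (smul_mem hy (hs.2 x))
  exact S₀_le hWS hS (smul_mem_of_ι_smul_mem (fun y s hs => (mem_S₁.mp (S₀_le_S₁ hs)).2 y) t
    (W_le hw))

end Modules

section HarishChandra

variable {P N : LieSubalgebra R L}

/-- The right action of `U(P)` on linear maps `L → U(P)` determined by
`(θ · x)(y) = θ(y) x + θ([x, y])` for `x ∈ P`. If `θ` is `y ↦ s · y` for a right action of `L` on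
`U(P)` extending right multiplication by `P`, then `θ · x` has to be `y ↦ (s x) · y`. -/
def homRightAction : UniversalEnvelopingAlgebra R P →ₐ[R]
    (Module.End R (L →ₗ[R] UniversalEnvelopingAlgebra R P))ᵐᵒᵖ :=
  lift R
    { toFun := fun x => .op
        { toFun := fun θ =>
            LinearMap.mulRight R (ι R x) ∘ₗ θ + θ ∘ₗ (LieAlgebra.ad R L (x : L) : L →ₗ[R] L)
          map_add' := fun θ θ' => by ext y; simp [-ι_apply, add_mul]; abel
          map_smul' := fun c θ => by ext y; simp [-ι_apply] }
      map_add' := fun x y =>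
        MulOpposite.unop_injective (by ext θ z; simp [-ι_apply, mul_add]; abel)
      map_smul' := fun c x => MulOpposite.unop_injective (by ext θ z; simp [-ι_apply])
      map_lie' := fun {x y} => MulOpposite.unop_injective (by
        ext θ z
        simp only [LieRing.of_associative_ring_bracket, ι_lie, lie_lie, LieSubalgebra.coe_bracket,
          MulOpposite.unop_op, MulOpposite.unop_sub, MulOpposite.unop_mul, LinearMap.coe_mk,
          AddHom.coe_mk, LinearMap.add_apply, LinearMap.sub_apply, LinearMap.comp_apply,
          LinearMap.mulRight_apply, LieAlgebra.ad_apply, Module.End.mul_apply,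
          map_sub]
        noncomm_ring) }

theorem homRightAction_ι (x : P) (θ : L →ₗ[R] UniversalEnvelopingAlgebra R P) (y : L) :
    (homRightAction (ι R x)).unop θ y = θ y * ι R x + θ ⁅(x : L), y⁆ := by
  rw [homRightAction, lift_ι_apply]
  rfl

variable (h : IsCompl P.toSubmodule N.toSubmodule)

/-- The projection of `L = P ⊕ N` onto `P`. -/
def projection : L →ₗ[R] P := P.toSubmodule.projectionOnto N.toSubmodule h

theorem projection_coe (x : P) : projection h x = x :=
  Submodule.projectionOnto_apply_left h x

theorem projection_eq_zero_iff {y : L} : projection h y = 0 ↔ y ∈ N :=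
  Submodule.projectionOnto_apply_eq_zero_iff h

theorem sub_projection_mem (y : L) : y - projection h y ∈ N := by
  rw [← projection_eq_zero_iff h, map_sub, projection_coe, sub_self]

theorem projection_lie (y z : L) :
    projection h ⁅y, z⁆ =
      projection h ⁅y, (projection h z : L)⁆ + projection h ⁅(projection h y : L), z⁆ -
        ⁅projection h y, projection h z⁆ := by
  have lie_eq_zero := (projection_eq_zero_iff h).2
    (N.lie_mem (sub_projection_mem h y) (sub_projection_mem h z))
  simp only [sub_lie, lie_sub, map_sub] at lie_eq_zero
  rw [← LieSubalgebra.coe_bracket, projection_coe] at lie_eq_zero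
  rw [← sub_eq_zero, ← lie_eq_zero]
  abel

/-- The product `t · y` for the right action of `L = P ⊕ N` on `U(P)` that extends right
multiplication by `P` and satisfies `1 · N = 0`; it makes `U(P)` the quotient of `U(L)` by the right
ideal generated by `N`. -/
def complRightMul (t : UniversalEnvelopingAlgebra R P) : L →ₗ[R] UniversalEnvelopingAlgebra R P :=
  (homRightAction t).unop ((ι R : P →ₗ⁅R⁆ _).toLinearMap ∘ₗ projection h)

theorem complRightMul_one (y : L) : complRightMul h 1 y = ι R (projection h y) := by
  simp only [complRightMul, map_one]
  rfl

theorem complRightMul_mul_ι (t : UniversalEnvelopingAlgebra R P) (x : P) (y : L) :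
    complRightMul h (t * ι R x) y =
      complRightMul h t y * ι R x + complRightMul h t ⁅(x : L), y⁆ := by
  simp only [complRightMul, map_mul]
  exact homRightAction_ι x _ y

theorem complRightMul_add (s t : UniversalEnvelopingAlgebra R P) :
    complRightMul h (s + t) = complRightMul h s + complRightMul h t := by
  simp [complRightMul]

theorem complRightMul_smul (c : R) (t : UniversalEnvelopingAlgebra R P) :
    complRightMul h (c • t) = c • complRightMul h t := by
  simp [complRightMul]

theorem complRightMul_coe (t : UniversalEnvelopingAlgebra R P) (x : P) :
    complRightMul h t x = t * ι R x := by
  induction t using induction_right generalizing x with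
  | one => rw [complRightMul_one, one_mul, projection_coe]
  | add s t hs ht => rw [complRightMul_add, LinearMap.add_apply, hs, ht, add_mul]
  | smul c t ht => rw [complRightMul_smul, LinearMap.smul_apply, ht, smul_mul_assoc]
  | mul y t ht =>
    rw [complRightMul_mul_ι, ht, ← LieSubalgebra.coe_bracket, ht, ι_lie]
    noncomm_ring

theorem complRightMul_lie (t : UniversalEnvelopingAlgebra R P) (y z : L) :
    complRightMul h t ⁅y, z⁆ =
      complRightMul h (complRightMul h t y) z - complRightMul h (complRightMul h t z) y := by
  induction t using induction_right generalizing y z with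
  | one =>
    have complRightMul_ι (s : P) (z : L) : complRightMul h (ι R s) z =
        ι R (projection h z) * ι R s + ι R (projection h ⁅(s : L), z⁆) := by
      rw [← one_mul (ι R s), complRightMul_mul_ι, complRightMul_one, complRightMul_one, one_mul]
    rw [complRightMul_one, complRightMul_one, complRightMul_one, complRightMul_ι, complRightMul_ι,
      projection_lie, map_sub, map_add, ι_lie, ← lie_skew y, map_neg, map_neg]
    abel
  | add s t hs ht =>
    simp only [complRightMul_add, LinearMap.add_apply, hs, ht]
    abel
  | smul c t ht => simp only [complRightMul_smul, LinearMap.smul_apply, ht, smul_sub]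
  | mul x t ht =>
    simp only [complRightMul_mul_ι, complRightMul_add, LinearMap.add_apply]
    rw [leibniz_lie, map_add, ht y z, ht ⁅(x : L), y⁆ z, ht y ⁅(x : L), z⁆]
    noncomm_ring

/-- The right action of `U(L)` on `U(P)` given by `complRightMul`. -/
def complRightAction : UniversalEnvelopingAlgebra R L →ₐ[R]
    (Module.End R (UniversalEnvelopingAlgebra R P))ᵐᵒᵖ :=
  lift R
    { toFun := fun y => .op
        { toFun := fun t => complRightMul h t y
          map_add' := fun s t => by rw [complRightMul_add, LinearMap.add_apply]
          map_smul' := fun c t => by rw [complRightMul_smul]; rfl }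
      map_add' := fun y z =>
        MulOpposite.unop_injective (LinearMap.ext fun t => map_add (complRightMul h t) y z)
      map_smul' := fun c y =>
        MulOpposite.unop_injective (LinearMap.ext fun t => map_smul (complRightMul h t) c y)
      map_lie' := fun {y z} =>
        MulOpposite.unop_injective (LinearMap.ext fun t => complRightMul_lie h t y z) }

theorem complRightAction_ι (y : L) (t : UniversalEnvelopingAlgebra R P) :
    (complRightAction h (ι R y)).unop t = complRightMul h t y := by
  rw [complRightAction, lift_ι_apply]
  rfl

/-- The Harish-Chandra projection `U(L) → U(P)` of a decomposition `L = P ⊕ N` into subalgebras: it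
kills the right ideal `N U(L)` and is the identity on `U(P)`. -/
def harishChandra : UniversalEnvelopingAlgebra R L →ₗ[R] UniversalEnvelopingAlgebra R P where
  toFun x := (complRightAction h x).unop 1
  map_add' x y := by rw [map_add]; rfl
  map_smul' c x := by rw [map_smul]; rfl

theorem harishChandra_one : harishChandra h 1 = 1 := by
  change (complRightAction h 1).unop 1 = 1
  rw [map_one (complRightAction h)]
  rfl

theorem harishChandra_mul_ι (t : UniversalEnvelopingAlgebra R L) (x : P) :
    harishChandra h (t * ι R (x : L)) = harishChandra h t * ι R x := by
  change (complRightAction h (t * _)).unop 1 = _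
  rw [map_mul, MulOpposite.unop_mul, Module.End.mul_apply, complRightAction_ι, complRightMul_coe]
  rfl

theorem harishChandra_ι_mul {y : L} (hy : y ∈ N) (t : UniversalEnvelopingAlgebra R L) :
    harishChandra h (ι R y * t) = 0 := by
  change (complRightAction h (_ * t)).unop 1 = 0
  rw [map_mul, MulOpposite.unop_mul, Module.End.mul_apply, complRightAction_ι, complRightMul_one,
    (projection_eq_zero_iff h).2 hy, map_zero, map_zero]

end HarishChandra

end

end EnvelopingAlgebra

namespace VertexOperatorAlgebra

noncomputable section

variable {V : Type u} [AddCommGroup V] [Module ℂ V] [VertexOperatorAlgebra V]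

theorem trunc_add (a b : V) (k : ℤ) : ∃ N : ℕ, ∀ i : ℕ, N ≤ i → mode (k + i) a b = 0 := by
  obtain ⟨N, hN⟩ := trunc a b
  exact ⟨(N - k).toNat, fun i hi => hN _ (by omega)⟩

theorem res_eq_sum (x : ℂ) {k : ℤ} {a b : V} {N : ℕ} (h : ∀ i : ℕ, N ≤ i → mode (k + i) a b = 0) :
    res x k a b = ∑ i ∈ Finset.range N, Ring.choose x i • mode (k + i) a b := by
  rw [res, modeSum_apply, finsum_range _ N fun i hi => by rw [h i hi, map_zero]]
  rfl

theorem res_add_one (x : ℂ) (k : ℤ) (a b : V) :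
    res (x + 1) k a b = res x k a b + res x (k + 1) a b := by
  obtain ⟨N, hN⟩ := trunc_add a b k
  have trunc_succ (i : ℕ) (hi : N + 1 ≤ i) : mode (k + i) a b = 0 := hN i (by omega)
  have trunc_shift (i : ℕ) (hi : N ≤ i) : mode (k + 1 + i) a b = 0 := by
    simpa [add_assoc, add_comm (1 : ℤ)] using hN (i + 1) (by omega)
  rw [res_eq_sum _ trunc_succ, res_eq_sum _ trunc_succ, res_eq_sum _ trunc_shift,
    Finset.sum_range_succ', Finset.sum_range_succ' _ N]
  simp only [Ring.choose_succ_succ, add_smul, Finset.sum_add_distrib]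
  push_cast
  simp only [Ring.choose_zero_right, add_comm (1 : ℤ), add_assoc]
  abel

/-- `Res_z` of the derivative of `(1 + z)^(x + 1) z^k Y(a, z) b` is zero. -/
theorem res_deriv (x : ℂ) (k : ℤ) (a b : V) : res (x + 1) k (mode 0 conf a) b =
    -((x + 1) • res x k a b + (k : ℂ) • res (x + 1) (k - 1) a b) := by
  obtain ⟨N, hN⟩ := trunc_add a b (k - 1)
  have trunc_shift (i : ℕ) (hi : N ≤ i) : mode (k + i) a b = 0 := by
    rw [show k + i = k - 1 + ((i + 1 : ℕ) : ℤ) by push_cast; ring]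
    exact hN (i + 1) (by omega)
  have trunc_deriv (i : ℕ) (hi : N + 1 ≤ i) : mode (k + i) (mode 0 conf a) b = 0 := by
    rw [deriv, show k + (i : ℤ) - 1 = k - 1 + i by ring, hN i (by omega), smul_zero]
  have coeff_eq_zero (i : ℕ) : Ring.choose (x + 1) (i + 1) * -(k + (i + 1)) +
      ((x + 1) * Ring.choose x i + k * Ring.choose (x + 1) (i + 1)) = 0 := by
    have := choose_succ_mul (x + 1) i
    rw [add_sub_cancel_right] at this
    linear_combination -this
  rw [res_eq_sum _ trunc_deriv, res_eq_sum x trunc_shift,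
    res_eq_sum _ (k := k - 1) (N := N + 1) fun i hi => hN i (by omega),
    ← sub_eq_zero, sub_neg_eq_add, Finset.smul_sum, Finset.smul_sum, Finset.sum_range_succ',
    Finset.sum_range_succ' _ N]
  simp only [deriv]
  rw [← add_assoc (∑ i ∈ Finset.range N, _), add_add_add_comm, ← Finset.sum_add_distrib,
    ← Finset.sum_add_distrib, Finset.sum_eq_zero fun i _ => ?_]
  · simp
  · rw [show k - 1 + ((i + 1 : ℕ) : ℤ) = k + i by push_cast; ring,
      show k + ((i + 1 : ℕ) : ℤ) - 1 = k + i by push_cast; ring, smul_smul, smul_smul, smul_smul,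
      ← add_smul, ← add_smul]
    convert zero_smul ℂ (mode (k + i) a b) using 2
    push_cast
    linear_combination coeff_eq_zero i

theorem conf_mem_wtSpace : (conf : V) ∈ wtSpace V 2 := by
  have L_comm := virasoro (V := V) 0 (-2) vac
  rw [mem_wtSpace]
  norm_num [mode_neg_one_vac, mode_vac] at L_comm ⊢
  exact L_comm

theorem deriv_mem_wtSpace {n : ℤ} {a : V} (ha : a ∈ wtSpace V n) :
    mode 0 conf a ∈ wtSpace V (n + 1) := by
  have := mode_mem_wtSpace conf_mem_wtSpace ha 0
  rwa [show 2 + n - 0 - 1 = n + 1 by ring] at this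

theorem mode_neg_two_vac (a : V) : mode (-2) a vac = mode 0 conf a := by
  have := deriv (-1) a (vac : V)
  rw [mode_neg_one_vac] at this
  rw [this]
  norm_num

theorem mode_skew_int (a b : V) (j : ℤ) {N : ℕ} (hN : ∀ i : ℕ, N ≤ i → mode (j + i) a b = 0) :
    mode j b a = ∑ i ∈ Finset.range N,
      (-(-1) ^ j * (-1) ^ i : ℂ) • mode (-1 - (i : ℤ)) (mode (j + i) a b) vac := by
  have neg_one_zpow_mul_self : ((-1 : ℂ) ^ j) * (-1) ^ j = 1 := by rw [← mul_zpow]; simp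
  have jacobi_vac := jacobi a b (vac : V) (-1) j 0
  rw [finsum_range _ N fun i hi => by rw [hN i hi, map_zero, LinearMap.zero_apply, smul_zero],
    finsum_range _ 1 fun i hi => by
      rw [mode_vac _ b (by omega), mode_vac _ a (by omega)]
      simp only [map_zero, smul_zero, sub_zero],
    Finset.sum_range_one] at jacobi_vac
  simp only [Nat.cast_zero, add_zero, pow_zero, Ring.choose_zero_right, one_mul, one_smul,
    mode_neg_one_vac, sub_zero] at jacobi_vac
  rw [mode_vac 0 b le_rfl, map_zero, zero_sub] at jacobi_vac
  have mode_eq : mode j b a = (-(-1 : ℂ) ^ j) • -((-1 : ℂ) ^ j • mode j b a) := by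
    rw [smul_neg, neg_smul, neg_neg, smul_smul, neg_one_zpow_mul_self, one_smul]
  rw [mode_eq, ← jacobi_vac, Finset.smul_sum]
  refine Finset.sum_congr rfl fun i _ => ?_
  rw [smul_smul, choose_neg_pow]
  simp only [Int.cast_neg, Int.cast_one, neg_neg, add_sub_cancel_left]
  rw [Ring.choose_natCast]
  simp

end

end VertexOperatorAlgebra

namespace FiniteOrderAut

noncomputable section

open VertexOperatorAlgebra TensorProduct EnvelopingAlgebra Filter

variable {V : Type u} [AddCommGroup V] [Module ℂ V] [VertexOperatorAlgebra V]
variable {g : FiniteOrderAut V}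

theorem mem_eig_add_int {q : ℚ} {a : V} (ha : a ∈ g.eig q) (j : ℤ) : a ∈ g.eig (q + j) := by
  rwa [← g.eig_sub_int (q + j) j, add_sub_cancel_right]

theorem toEquiv_pow_mem_eig {p : ℚ} {a : V} (ha : a ∈ g.eig p) (k : ℕ) :
    (g.toEquiv ^ k) a ∈ g.eig p := by
  induction k with
  | zero => simpa using ha
  | succ k ih =>
    rw [pow_succ', LinearEquiv.mul_apply, g.mem_eig.mp ih]
    exact Submodule.smul_mem _ _ ih

theorem proj_mem_eig {p : ℚ} (q : ℚ) {a : V} (ha : a ∈ g.eig p) : g.proj q a ∈ g.eig p := by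
  unfold proj
  split_ifs
  · rw [avg_apply]
    exact Submodule.smul_mem _ _ (Submodule.sum_mem _ fun k _ =>
      Submodule.smul_mem _ _ (toEquiv_pow_mem_eig ha k))
  · exact Submodule.zero_mem _

theorem exists_eq_add_int_of_mem_eig {p q : ℚ} {a : V} (hp : a ∈ g.eig p) (hq : a ∈ g.eig q)
    (ha : a ≠ 0) : ∃ j : ℤ, q = p + j := by
  rw [g.mem_eig] at hp hq
  rw [hp, ← sub_eq_zero, ← sub_smul, smul_eq_zero_iff_left ha, sub_eq_zero] at hq
  obtain ⟨j, hj⟩ := Complex.exp_eq_exp_iff_exists_int.mp hq.symm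
  refine ⟨j, ?_⟩
  have cast_eq : (q : ℂ) = p + j := by
    apply mul_left_cancel₀ Complex.two_pi_I_ne_zero
    linear_combination hj
  exact_mod_cast cast_eq

theorem proj_eq_zero {p q : ℚ} {a : V} (ha : a ∈ g.eig p) (hpq : ¬ ∃ j : ℤ, q = p + j) :
    g.proj q a = 0 := by
  by_contra proj_ne_zero
  exact hpq (exists_eq_add_int_of_mem_eig (proj_mem_eig q ha) (g.proj_mem q a) proj_ne_zero)

theorem proj_mode {p : ℚ} (q : ℚ) {a : V} (ha : a ∈ g.eig p) (i : ℤ) (b : V) :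
    g.proj (p + q) (mode i a b) = mode i a (g.proj q b) := by
  induction b using g.eig_induction with
  | zero => simp
  | add b c hb hc => simp only [map_add, hb, hc]
  | hom r _ b hb =>
    by_cases h : ∃ j : ℤ, q = r / g.T + j
    · obtain ⟨j, rfl⟩ := h
      have hb' := mem_eig_add_int hb j
      rw [g.proj_apply hb', g.proj_apply (g.mode_mem_eig ha hb' i)]
    · rw [proj_eq_zero hb h, map_zero]
      refine proj_eq_zero (g.mode_mem_eig ha hb i) ?_
      rintro ⟨j, hj⟩
      exact h ⟨j, by linarith⟩

theorem vac_mem_eig : (vac : V) ∈ g.eig 0 := by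
  simp [mem_eig, g.map_vac]

theorem conf_mem_eig : (conf : V) ∈ g.eig 0 := by
  simp [mem_eig, g.map_conf]

theorem res_mem_Og {n : ℤ} {r : ℕ} {a : V} (b : V) (hr : r < g.T) (ha : a ∈ wtSpace V n)
    (ha' : a ∈ g.eig (r / g.T)) (j : ℕ) :
    res ((n : ℂ) - 1 + delta r + r / g.T) (-1 - delta r - j) a b ∈ g.Og := by
  induction j generalizing n a with
  | zero =>
    refine Submodule.subset_span ⟨n, r, a, b, hr, ha, ha', ?_⟩
    simp [circ]
  | succ j ih =>
    set x : ℂ := (n : ℂ) - 1 + delta r + r / g.T with hx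
    set k : ℤ := -1 - (delta r : ℤ) - j with hk
    have res_mem : res x k a b ∈ g.Og := ih ha ha'
    have res_deriv_mem := ih (deriv_mem_wtSpace ha) (g.L_mem_eig ha')
    rw [show ((n + 1 : ℤ) : ℂ) - 1 + delta r + r / g.T = x + 1 by rw [hx]; push_cast; ring,
      res_deriv, res_add_one, sub_add_cancel, neg_mem_iff,
      add_mem_cancel_left (g.Og.smul_mem _ res_mem), smul_add,
      add_mem_cancel_right (g.Og.smul_mem _ res_mem)] at res_deriv_mem
    have k_ne_zero : (k : ℂ) ≠ 0 := by
      rw [Int.cast_ne_zero]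
      omega
    rw [show -1 - (delta r : ℤ) - ((j + 1 : ℕ) : ℤ) = k - 1 by rw [hk]; push_cast; ring]
    exact (g.Og.smul_mem_iff k_ne_zero).mp res_deriv_mem

theorem mkQ_deriv {w : ℤ} {a : V} (ha : a ∈ wtSpace V w) (ha' : a ∈ g.eig 0) :
    g.Og.mkQ (mode 0 conf a) = -(w : ℂ) • g.Og.mkQ a := by
  have circ_mem := res_mem_Og (g := g) (r := 0) (vac : V) g.T_pos ha (by simpa using ha') 0
  rw [res_eq_sum _ (N := 2) fun i hi => mode_vac _ _ (by simp [delta]; omega)] at circ_mem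
  simp only [Finset.sum_range_succ, delta, Finset.sum_range_zero] at circ_mem
  norm_num [mode_neg_one_vac, mode_neg_two_vac] at circ_mem
  rw [← Submodule.Quotient.mk_eq_zero, ← Submodule.mkQ_apply, map_add, map_smul] at circ_mem
  rw [neg_smul, eq_neg_iff_add_eq_zero, circ_mem]

theorem mkQ_mode_vac {w : ℤ} {a : V} (ha : a ∈ wtSpace V w) (ha' : a ∈ g.eig 0) (i : ℕ) :
    g.Og.mkQ (mode (-1 - (i : ℤ)) a vac) = Ring.choose (-(w : ℂ)) i • g.Og.mkQ a := by
  induction i generalizing w a with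
  | zero => simp [mode_neg_one_vac]
  | succ i ih =>
    have succ_ne_zero : (i : ℂ) + 1 ≠ 0 := by exact_mod_cast Nat.succ_ne_zero i
    have mode_eq : mode (-1 - ((i + 1 : ℕ) : ℤ)) a vac =
        ((i : ℂ) + 1)⁻¹ • mode (-1 - (i : ℤ)) (mode 0 conf a) vac := by
      rw [VertexOperatorAlgebra.deriv, smul_smul,
        show -1 - (i : ℤ) - 1 = -1 - ((i + 1 : ℕ) : ℤ) by push_cast; ring,
        show ((i : ℂ) + 1)⁻¹ * -(((-1 - (i : ℤ)) : ℤ) : ℂ) = 1 by push_cast; field_simp; ring,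
        one_smul]
    rw [mode_eq, map_smul, ih (deriv_mem_wtSpace ha) (g.L_mem_eig ha'), mkQ_deriv ha ha',
      smul_smul, smul_smul]
    congr 1
    rw [mul_assoc, inv_mul_eq_iff_eq_mul₀ succ_ne_zero, choose_succ_mul, Int.cast_add,
      Int.cast_one, neg_add', mul_comm]

theorem mkQ_eq_zero {n : ℤ} {r : ℕ} {a : V} (hr : r < g.T) (h0 : r ≠ 0) (ha : a ∈ wtSpace V n)
    (ha' : a ∈ g.eig (r / g.T)) : g.Og.mkQ a = 0 := by
  have circ_mem := res_mem_Og (vac : V) hr ha ha' 0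
  rw [res_eq_sum _ (N := 1) fun i hi => mode_vac _ _ (by simp [delta, h0]; omega)] at circ_mem
  simp only [Finset.sum_range_one, delta, h0] at circ_mem
  norm_num [mode_neg_one_vac] at circ_mem
  rwa [Submodule.mkQ_apply, Submodule.Quotient.mk_eq_zero]

theorem mkQ_proj (a : V) : g.Og.mkQ (g.proj 0 a) = g.Og.mkQ a := by
  induction a using wt_induction with
  | zero => simp
  | add a b ha hb => simp only [map_add, ha, hb]
  | hom n a ha =>
    conv_rhs => rw [← g.sum_proj a, map_sum]
    rw [Finset.sum_eq_single_of_mem 0 (Finset.mem_range.mpr g.T_pos) fun r hr hr0 =>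
      mkQ_eq_zero (Finset.mem_range.mp hr) hr0 (g.proj_mem_wtSpace ha _) (g.proj_mem _ a)]
    simp

theorem star_apply {n : ℤ} {a : V} (b : V) (ha : a ∈ wtSpace V n) (ha' : a ∈ g.eig 0) :
    g.star a b = res (n : ℂ) (-1) a b := by
  rw [star, LinearMap.comp_apply, g.proj_apply ha', byWeight_apply _ ha]

theorem mkQ_mode_swap {n w : ℤ} {a b : V} (ha : a ∈ wtSpace V n) (ha' : a ∈ g.eig 0)
    (hb : b ∈ wtSpace V w) (hb' : b ∈ g.eig 0) (j : ℤ) {N : ℕ}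
    (hN : ∀ i : ℕ, N ≤ i → mode (j + i) a b = 0) :
    g.Og.mkQ (mode j b a) = ∑ i ∈ Finset.range N,
      (-(-1) ^ j * (-1) ^ i * Ring.choose (j + i + 1 - (n : ℂ) - w) i) •
        g.Og.mkQ (mode (j + i) a b) := by
  rw [mode_skew_int a b j hN, map_sum]
  refine Finset.sum_congr rfl fun i _ => ?_
  have mode_eig := g.mode_mem_eig ha' hb' (j + i)
  rw [add_zero] at mode_eig
  rw [map_smul, mkQ_mode_vac (mode_mem_wtSpace ha hb (j + i)) mode_eig, smul_smul]
  congr 3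
  push_cast
  ring

theorem sum_antidiagonal_choose_mul_choose (n w : ℂ) (l : ℕ) :
    ∑ ji ∈ Finset.HasAntidiagonal.antidiagonal l,
      (-1) ^ (ji.1 + ji.2) * (Ring.choose w ji.1 * Ring.choose ((ji.1 + ji.2 : ℕ) - n - w) ji.2) =
      Ring.choose (n - 1) l := by
  rw [choose_neg_pow (n - 1) l, show -(n - 1) + l - 1 = w + (l - n - w) by ring,
    Ring.add_choose_eq l (Commute.all _ _), Finset.mul_sum]
  refine Finset.sum_congr rfl fun ji hji => ?_
  rw [Finset.HasAntidiagonal.mem_antidiagonal] at hji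
  rw [hji]

theorem mkQ_star_swap {n w : ℤ} {a b : V} (ha : a ∈ wtSpace V n) (ha' : a ∈ g.eig 0)
    (hb : b ∈ wtSpace V w) (hb' : b ∈ g.eig 0) :
    g.Og.mkQ (g.star b a) = g.Og.mkQ (res ((n : ℂ) - 1) (-1) a b) := by
  obtain ⟨N₁, hN₁⟩ := trunc_add a b (-1)
  obtain ⟨N₂, hN₂⟩ := trunc_add b a (-1)
  set N := max N₁ N₂
  have trunc_ab (i : ℕ) (hi : N ≤ i) : mode (-1 + i) a b = 0 := hN₁ i ((le_max_left _ _).trans hi)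
  have trunc_ba (i : ℕ) (hi : N ≤ i) : mode (-1 + i) b a = 0 := hN₂ i ((le_max_right _ _).trans hi)
  have trunc_add_ab (j i : ℕ) (hi : N ≤ i) : mode (-1 + (j : ℤ) + i) a b = 0 := by
    rw [add_assoc, ← Nat.cast_add]
    exact trunc_ab (j + i) (by omega)
  rw [star_apply a hb hb', res_eq_sum _ trunc_ab, res_eq_sum _ trunc_ba, map_sum, map_sum]
  simp only [map_smul, ← sum_antidiagonal_choose_mul_choose n w]
  rw [← sum_antidiag N (fun j i => (-1) ^ (j + i) *
      (Ring.choose (w : ℂ) j * Ring.choose ((j + i : ℕ) - (n : ℂ) - w) i))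
    (fun l => g.Og.mkQ (mode (-1 + (l : ℤ)) a b))
    fun l hl => by rw [trunc_ab l hl, map_zero]]
  refine Finset.sum_congr rfl fun j _ => ?_
  rw [mkQ_mode_swap ha ha' hb hb' _ (trunc_add_ab j), Finset.smul_sum]
  refine Finset.sum_congr rfl fun i _ => ?_
  rw [smul_smul, zpow_add₀ (by norm_num), zpow_natCast, pow_add]
  push_cast
  rw [← add_assoc]
  congr 1
  rw [show (-1 + (j : ℂ) + i + 1 - n - w) = j + i - n - w by ring, zpow_neg_one]
  ring

/-- Zhu's commutator formula `[a, b] = Res_z (1 + z)^(wt a - 1) Y(a, z) b` in `A_g(V)`. -/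
theorem rho_res_zero (U : AgMod.{u, v} g) {n w : ℤ} {a b : V} (ha : a ∈ wtSpace V n)
    (ha' : a ∈ g.eig 0) (hb : b ∈ wtSpace V w) (hb' : b ∈ g.eig 0) :
    U.rho (g.Og.mkQ (res ((n : ℂ) - 1) 0 a b)) =
      U.rho (g.Og.mkQ a) * U.rho (g.Og.mkQ b) - U.rho (g.Og.mkQ b) * U.rho (g.Og.mkQ a) := by
  have res_eq := res_add_one ((n : ℂ) - 1) (-1) a b
  rw [sub_add_cancel, neg_add_cancel] at res_eq
  rw [← U.rho_mul, ← U.rho_mul, mkQ_star_swap ha ha' hb hb', star_apply b ha ha', ← map_sub,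
    ← map_sub, res_eq, add_sub_cancel_left]

/-! ### The grading of `V[g]` -/

theorem proj_sub_int (q : ℚ) (j : ℤ) (a : V) : g.proj (q - j) a = g.proj q a := by
  have vac_mem : (vac : V) ∈ g.eig (-j : ℤ) := by
    simpa only [zero_add] using mem_eig_add_int (g := g) vac_mem_eig (-j)
  have := proj_mode q vac_mem (-1) a
  rwa [vac_mode, vac_mode, if_pos rfl, if_pos rfl, Int.cast_neg, neg_add_eq_sub] at this

theorem elem_eq {q : ℚ} {a : V} (ha : a ∈ g.eig q) :
    g.elem q a = g.toVg ⟨Finsupp.single q a, single_mem ha⟩ := by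
  unfold elem
  rw [LinearMap.comp_apply]
  congr 1
  ext1
  exact congrArg (Finsupp.single q) (g.proj_apply ha)

theorem elem_proj (q : ℚ) (a : V) : g.elem q (g.proj q a) = g.elem q a := by
  rw [elem_eq (g.proj_mem q a)]
  rfl

theorem elem_eq_zero {p q : ℚ} {a : V} (ha : a ∈ g.eig p) (hpq : ¬ ∃ j : ℤ, q = p + j) :
    g.elem q a = 0 := by
  rw [← elem_proj, proj_eq_zero ha hpq, map_zero]

theorem elem_deriv_of_mem_eig {q : ℚ} {a : V} (ha : a ∈ g.eig q) :
    g.elem q (mode 0 conf a) = -(q : ℂ) • g.elem (q - 1) a := by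
  have ha' : a ∈ g.eig (q - 1) := by
    rwa [← Int.cast_one, g.eig_sub_int]
  rw [elem_eq (g.L_mem_eig ha), elem_eq ha', neg_smul, eq_neg_iff_add_eq_zero, ← map_smul,
    ← map_add, toVg_eq_zero]
  refine ⟨_, single_mem ha, ?_⟩
  rw [loopD_single, add_comm]
  rfl

theorem elem_deriv (q : ℚ) (a : V) : g.elem q (mode 0 conf a) = -(q : ℂ) • g.elem (q - 1) a := by
  have proj_conf := proj_mode (g := g) q conf_mem_eig 0 a
  rw [zero_add] at proj_conf
  rw [← elem_proj q, proj_conf, elem_deriv_of_mem_eig (g.proj_mem q a), ← elem_proj (q - 1) a,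
    ← Int.cast_one, proj_sub_int]

theorem lie_elem_of_mem_eig {p q : ℚ} {a b : V} (ha : a ∈ g.eig p) (hb : b ∈ g.eig q) {N : ℕ}
    (hN : ∀ i : ℕ, N ≤ i → mode (i : ℤ) a b = 0) :
    ⁅g.elem p a, g.elem q b⁆ =
      ∑ i ∈ Finset.range N, Ring.choose (p : ℂ) i • g.elem (p + q - i) (mode (i : ℤ) a b) := by
  have mode_mem (i : ℕ) : mode (i : ℤ) a b ∈ g.eig (p + q - i) := by
    rw [g.eig_sub_nat]
    exact g.mode_mem_eig ha hb i
  simp only [elem_eq ha, elem_eq hb, elem_eq (mode_mem _), ← map_smul, ← map_sum]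
  change g.vgBracket _ _ = _
  rw [vgBracket_toVg]
  congr 1
  ext1
  rw [invBracket, LinearMap.mk₂_apply]
  simp only [loopBracket_single _ _ _ _ N hN]
  rw [AddSubmonoidClass.coe_finsetSum]
  rfl

theorem lie_elem {p : ℚ} (q : ℚ) {a : V} (ha : a ∈ g.eig p) (b : V) {N : ℕ}
    (hN : ∀ i : ℕ, N ≤ i → mode (i : ℤ) a b = 0) :
    ⁅g.elem p a, g.elem q b⁆ =
      ∑ i ∈ Finset.range N, Ring.choose (p : ℂ) i • g.elem (p + q - i) (mode (i : ℤ) a b) := by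
  have trunc_proj (i : ℕ) (hi : N ≤ i) : mode (i : ℤ) a (g.proj q b) = 0 := by
    rw [← proj_mode q ha, hN i hi, map_zero]
  rw [← elem_proj q b, lie_elem_of_mem_eig ha (g.proj_mem q b) trunc_proj]
  refine Finset.sum_congr rfl fun i _ => ?_
  rw [← proj_mode q ha, ← elem_proj _ (mode (i : ℤ) a b), ← Int.cast_natCast, proj_sub_int]

theorem elem_mem_VgDeg {w : ℤ} {a : V} (ha : a ∈ wtSpace V w) (q : ℚ) :
    g.elem q a ∈ g.VgDeg ((w : ℚ) - q - 1) :=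
  Submodule.subset_span ⟨w, q, a, ha, rfl, rfl⟩

theorem VgDeg_induction {n : ℚ} {p : g.Vg → Prop} {x : g.Vg} (hx : x ∈ g.VgDeg n) (zero : p 0)
    (add : ∀ x y, p x → p y → p (x + y))
    (elem : ∀ (w : ℤ) (q : ℚ) (a : V), a ∈ wtSpace V w → a ∈ g.eig q → (w : ℚ) - q - 1 = n →
      p (g.elem q a)) : p x := by
  induction hx using Submodule.closure_induction with
  | zero => exact zero
  | add x y _ _ hx hy => exact add x y hx hy
  | smul_mem c x hx =>
    obtain ⟨w, q, a, ha, hn, rfl⟩ := hx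
    rw [← elem_proj, ← map_smul]
    exact elem w q _ (Submodule.smul_mem _ _ (g.proj_mem_wtSpace ha q))
      (Submodule.smul_mem _ _ (g.proj_mem q a)) hn

theorem VgDeg_induction₂ {m n : ℚ} {p : g.Vg → g.Vg → Prop} {x y : g.Vg} (hx : x ∈ g.VgDeg m)
    (hy : y ∈ g.VgDeg n) (zero_left : ∀ y, p 0 y) (zero_right : ∀ x, p x 0)
    (add_left : ∀ x x' y, p x y → p x' y → p (x + x') y)
    (add_right : ∀ x y y', p x y → p x y' → p x (y + y'))
    (elem : ∀ (w w' : ℤ) (q q' : ℚ) (a b : V), a ∈ wtSpace V w → a ∈ g.eig q →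
      (w : ℚ) - q - 1 = m → b ∈ wtSpace V w' → b ∈ g.eig q' → (w' : ℚ) - q' - 1 = n →
      p (g.elem q a) (g.elem q' b)) : p x y := by
  refine VgDeg_induction (p := (p · y)) hx (zero_left y) (fun _ _ => add_left _ _ y)
    fun w q a ha ha' hm => ?_
  exact VgDeg_induction (p := p _) hy (zero_right _) (fun _ _ => add_right _ _ _)
    fun w' q' b hb hb' hn => elem w w' q q' a b ha ha' hm hb hb' hn

theorem toVg_mem_of_elem_mem {S : Submodule ℂ g.Vg} (hS : ∀ q, ∀ a ∈ g.eig q, g.elem q a ∈ S)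
    (x : g.loopInv) : g.toVg x ∈ S := by
  suffices ∃ hx : (x : Loop V) ∈ g.loopInv, g.toVg ⟨x, hx⟩ ∈ S from this.2
  refine loop_induction (p := fun x => ∃ hx : x ∈ g.loopInv, g.toVg ⟨x, hx⟩ ∈ S) x.2
    ⟨Submodule.zero_mem _, ?_⟩ ?_ ?_
  · exact (congrArg (· ∈ S) (map_zero g.toVg)).mpr S.zero_mem
  · rintro x y ⟨hx, hx'⟩ ⟨hy, hy'⟩
    exact ⟨Submodule.add_mem _ hx hy,
      (congrArg (· ∈ S) (map_add g.toVg ⟨x, hx⟩ ⟨y, hy⟩)).mpr (S.add_mem hx' hy')⟩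
  · intro q a ha
    exact ⟨single_mem ha, elem_eq ha ▸ hS q a ha⟩

theorem iSup_VgDeg : ⨆ n, g.VgDeg n = ⊤ := by
  rw [eq_top_iff]
  rintro x -
  obtain ⟨x, rfl⟩ := g.toVg_surjective x
  refine toVg_mem_of_elem_mem (fun q a ha => ?_) x
  clear ha
  induction a using wt_induction with
  | zero => simp
  | add a b ha hb => rw [map_add]; exact Submodule.add_mem _ ha hb
  | hom n a ha => exact Submodule.mem_iSup_of_mem _ (elem_mem_VgDeg ha q)

theorem lie_mem_VgDeg {m n : ℚ} {x y : g.Vg} (hx : x ∈ g.VgDeg m) (hy : y ∈ g.VgDeg n) :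
    ⁅x, y⁆ ∈ g.VgDeg (m + n) := by
  refine VgDeg_induction₂ (p := fun x y => ⁅x, y⁆ ∈ g.VgDeg (m + n)) hx hy (by simp) (by simp)
    (fun x x' y h h' => by rw [add_lie]; exact Submodule.add_mem _ h h')
    (fun x y y' h h' => by rw [lie_add]; exact Submodule.add_mem _ h h')
    fun w w' p q a b ha ha' hm hb _ hn => ?_
  obtain ⟨N, hN⟩ := trunc_nat a b
  rw [lie_elem q ha' b hN]
  refine Submodule.sum_mem _ fun i _ => Submodule.smul_mem _ _ ?_
  convert elem_mem_VgDeg (g := g) (mode_mem_wtSpace ha hb i) (p + q - i) using 2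
  push_cast
  linarith

/-- `ω(1) = L(0)` acts on `V[g]` as the degree. -/
theorem lie_conf {n : ℚ} {x : g.Vg} (hx : x ∈ g.VgDeg n) :
    ⁅g.elem 1 conf, x⁆ = (n : ℂ) • x := by
  refine VgDeg_induction (p := fun x => ⁅g.elem 1 conf, x⁆ = (n : ℂ) • x) hx (by simp)
    (fun x x' h h' => by rw [lie_add, h, h', smul_add]) (fun w q a ha _ hn => ?_)
  obtain ⟨N, hN⟩ := trunc_nat conf a
  rw [lie_elem q (by simpa using mem_eig_add_int (g := g) conf_mem_eig 1) a (N := N + 2)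
    (fun i hi => hN i (by omega)), Finset.sum_range_succ', Finset.sum_range_succ',
    Finset.sum_eq_zero]
  · simp only [zero_add, Nat.cast_one, Nat.cast_zero, mem_wtSpace.mp ha, elem_deriv, map_smul,
      Rat.cast_one, Ring.choose_one_right, Ring.choose_zero_right, one_smul, sub_zero,
      add_sub_cancel_left, ← add_smul, ← hn]
    congr 1
    push_cast
    ring
  · intro i _
    rw [Rat.cast_one, ← Nat.cast_one, Ring.choose_natCast, Nat.choose_eq_zero_of_lt (by omega),
      Nat.cast_zero, zero_smul]

theorem iSupIndep_VgDeg : iSupIndep g.VgDeg := by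
  have eigenspaces_indep := Module.End.eigenspaces_iSupIndep
    (LieAlgebra.ad ℂ g.Vg (g.elem 1 conf) : Module.End ℂ g.Vg)
  exact (eigenspaces_indep.comp (f := fun n : ℚ => (n : ℂ)) Rat.cast_injective).mono
    fun n x hx => Module.End.mem_eigenspace_iff.mpr (lie_conf hx)

theorem VgDeg_eq_bot {n : ℚ} (hn : ¬ ∃ k : ℤ, n = k / g.T) : g.VgDeg n = ⊥ := by
  have T_ne_zero : (g.T : ℚ) ≠ 0 := by exact_mod_cast g.T_pos.ne'
  rw [eq_bot_iff]
  refine Submodule.span_le.mpr ?_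
  rintro x ⟨w, q, a, -, hq, rfl⟩
  have proj_eq : g.proj q = 0 := by
    refine if_neg ?_
    rintro ⟨k, rfl⟩
    refine hn ⟨(w - 1) * g.T - k, ?_⟩
    rw [← hq]
    push_cast
    field_simp
    ring
  rw [← elem_proj, proj_eq, LinearMap.zero_apply, map_zero]
  exact Submodule.zero_mem _

theorem elem_vac_eq_zero {q : ℚ} (hq : q ≠ -1) : g.elem q vac = 0 := by
  have deriv_vac := elem_deriv (g := g) (q + 1) vac
  rw [mode_vac _ _ le_rfl, map_zero, add_sub_cancel_right, eq_comm, smul_eq_zero, neg_eq_zero]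
    at deriv_vac
  refine deriv_vac.resolve_left fun q_add_one => hq ?_
  exact eq_neg_of_add_eq_zero_left (by exact_mod_cast q_add_one)

theorem lie_vac (x : g.Vg) : ⁅g.elem (-1) vac, x⁆ = 0 := by
  obtain ⟨x, rfl⟩ := g.toVg_surjective x
  refine toVg_mem_of_elem_mem (S := LinearMap.ker
    (LieAlgebra.ad ℂ g.Vg (g.elem (-1) vac) : Module.End ℂ g.Vg)) (fun q a _ => ?_) x
  have vac_mem : (vac : V) ∈ g.eig (-1) := by
    simpa using mem_eig_add_int (g := g) vac_mem_eig (-1)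
  refine (lie_elem q vac_mem a (N := 0) fun i _ => ?_).trans (Finset.sum_range_zero _)
  rw [vac_mode, if_neg (by omega)]

theorem iSup_VgDeg_induction {s : Set ℚ} {p : g.Vg → Prop} {x : g.Vg}
    (hx : x ∈ ⨆ n ∈ s, g.VgDeg n) (zero : p 0) (add : ∀ x y, p x → p y → p (x + y))
    (mem : ∀ n ∈ s, ∀ x ∈ g.VgDeg n, p x) : p x := by
  rw [iSup_subtype'] at hx
  exact Submodule.iSup_induction _ (motive := p) hx (fun n => mem n n.2) zero add

variable (g) in
/-- The Lie subalgebra of `V[g]` spanned by the elements with degree in `s`. -/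
def VgDegIn (s : AddSubsemigroup ℚ) : LieSubalgebra ℂ g.Vg where
  toSubmodule := ⨆ n ∈ (s : Set ℚ), g.VgDeg n
  lie_mem' {x y} hx hy := by
    refine iSup_VgDeg_induction (p := fun x => ⁅x, y⁆ ∈ ⨆ n ∈ (s : Set ℚ), g.VgDeg n) hx
      (by simp) (fun x x' h h' => add_lie x x' y ▸ Submodule.add_mem _ h h') fun m hm x hx => ?_
    refine iSup_VgDeg_induction (p := fun y => ⁅x, y⁆ ∈ ⨆ n ∈ (s : Set ℚ), g.VgDeg n) hy
      (by simp) (fun y y' h h' => lie_add x y y' ▸ Submodule.add_mem _ h h') fun n hn y hy => ?_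
    exact Submodule.mem_iSup_of_mem _ (Submodule.mem_iSup_of_mem (s.add_mem hm hn)
      (lie_mem_VgDeg hx hy))

theorem VgDeg_le_VgDegIn {s : AddSubsemigroup ℚ} {n : ℚ} (hn : n ∈ s) :
    g.VgDeg n ≤ (g.VgDegIn s).toSubmodule :=
  le_iSup₂_of_le n hn le_rfl

variable (g) in
/-- The subalgebra `P = V[g]_- ⊕ V[g]_0`, from which `M(U)` is induced. -/
abbrev nonposPart : LieSubalgebra ℂ g.Vg :=
  g.VgDegIn ⟨Set.Iic 0, fun hm hn => add_nonpos (Set.mem_Iic.mp hm) (Set.mem_Iic.mp hn)⟩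

variable (g) in
/-- The subalgebra `V[g]_+`, a complement of `P` in `V[g]`. -/
abbrev posPart : LieSubalgebra ℂ g.Vg :=
  g.VgDegIn ⟨Set.Ioi 0, fun hm hn => add_pos (Set.mem_Ioi.mp hm) (Set.mem_Ioi.mp hn)⟩

theorem isCompl_nonposPart_posPart :
    IsCompl g.nonposPart.toSubmodule g.posPart.toSubmodule := by
  constructor
  · refine iSupIndep_VgDeg.disjoint_biSup_biSup (Set.disjoint_left.mpr fun n hn hn' => ?_)
    exact not_lt.mpr (Set.mem_Iic.mp hn) (Set.mem_Ioi.mp hn')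
  · rw [codisjoint_iff, eq_top_iff, ← iSup_VgDeg]
    refine iSup_le fun n => ?_
    rcases le_or_gt n 0 with hn | hn
    · exact le_sup_of_le_left (VgDeg_le_VgDegIn hn)
    · exact le_sup_of_le_right (VgDeg_le_VgDegIn hn)

/-! ### The action of `P` on `U` and the projection `M(U) → U` -/

section

attribute [local instance 100] LieRing.ofAssociativeRing

theorem eig_intCast_sub_one (w : ℤ) : g.eig ((w : ℚ) - 1) = g.eig 0 := by
  simpa using g.eig_sub_int 0 (1 - w)

theorem elem_sub_one_mem_VgDeg {w : ℤ} {a : V} (ha : a ∈ wtSpace V w) :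
    g.elem ((w : ℚ) - 1) a ∈ g.VgDeg 0 := by
  simpa using elem_mem_VgDeg (g := g) ha ((w : ℚ) - 1)

/-- The linear map on finite sums of terms `t^q ⊗ a` that takes `t^q ⊗ a` to the action of
`a + O_g(V)` if `q = wt a - 1`, and to `0` for the other `q`. -/
def loopAct (U : AgMod.{u, v} g) : Loop V →ₗ[ℂ] Module.End ℂ U.carrier :=
  Finsupp.lsum ℂ fun q => byWeight fun n => if (n : ℚ) - 1 = q then U.rho ∘ₗ g.Og.mkQ else 0

theorem loopAct_single (U : AgMod.{u, v} g) (q : ℚ) {w : ℤ} {a : V} (ha : a ∈ wtSpace V w) :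
    loopAct U (Finsupp.single q a) = if (w : ℚ) - 1 = q then U.rho (g.Og.mkQ a) else 0 := by
  rw [loopAct, Finsupp.lsum_single, byWeight_apply _ ha]
  split_ifs <;> rfl

theorem loopAct_loopD (U : AgMod.{u, v} g) {q : ℚ} {a : V} (ha : a ∈ g.eig q) :
    loopAct U (loopD (Finsupp.single q a)) = 0 := by
  rw [← g.proj_apply ha]
  clear ha
  induction a using wt_induction with
  | zero => simp
  | add a b ha hb => simp only [map_add, Finsupp.single_add, ha, hb, add_zero]
  | hom w a ha =>
    have ha' := g.proj_mem_wtSpace ha q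
    rw [loopD_single, map_add, map_smul, loopAct_single U _ ha',
      loopAct_single U _ (deriv_mem_wtSpace ha')]
    by_cases hq : (w : ℚ) = q
    · have mem_eig_zero : g.proj q a ∈ g.eig 0 := by
        simpa [← hq] using mem_eig_add_int (g.proj_mem q a) (-w)
      rw [if_pos (by rw [hq]), if_pos (by push_cast; linarith), mkQ_deriv ha' mem_eig_zero,
        map_smul, ← add_smul, ← hq, Rat.cast_intCast, add_neg_cancel, zero_smul]
    · rw [if_neg fun h => hq (by linarith), if_neg fun h => hq (by push_cast at h; linarith),
        smul_zero, add_zero]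

/-- The linear map on `V[g]` that takes `a(wt a - 1)` to the action of `a + O_g(V)` on `U` for
homogeneous `a ∈ V^0`, and that vanishes on the spaces of degree other than `0`. -/
def zeroAct (U : AgMod.{u, v} g) : g.Vg →ₗ[ℂ] Module.End ℂ U.carrier :=
  (g.loopDInv.comap g.loopInv.subtype).liftQ (loopAct U ∘ₗ g.loopInv.subtype) (by
    rintro x ⟨z, hz, hx⟩
    rw [LinearMap.mem_ker, LinearMap.comp_apply, ← hx]
    exact loop_induction (p := fun z => loopAct U (loopD z) = 0) hz (by simp)
      (fun x y hx hy => by rw [map_add, map_add, hx, hy, add_zero])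
      fun q a ha => loopAct_loopD U ha)

theorem zeroAct_elem (U : AgMod.{u, v} g) {q : ℚ} {w : ℤ} {a : V} (ha : a ∈ wtSpace V w)
    (ha' : a ∈ g.eig q) :
    zeroAct U (g.elem q a) = if (w : ℚ) - 1 = q then U.rho (g.Og.mkQ a) else 0 := by
  rw [elem_eq ha', ← loopAct_single U q ha]
  rfl

theorem zeroAct_elem_sub_one (U : AgMod.{u, v} g) {w : ℤ} {a : V} (ha : a ∈ wtSpace V w)
    (ha' : a ∈ g.eig 0) : zeroAct U (g.elem ((w : ℚ) - 1) a) = U.rho (g.Og.mkQ a) := by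
  rw [zeroAct_elem U ha (by rwa [eig_intCast_sub_one]), if_pos rfl]

theorem zeroAct_eq_zero (U : AgMod.{u, v} g) {n : ℚ} (hn : n ≠ 0) {x : g.Vg}
    (hx : x ∈ g.VgDeg n) : zeroAct U x = 0 := by
  refine VgDeg_induction (p := fun x => zeroAct U x = 0) hx (by simp)
    (fun x y hx hy => by rw [map_add, hx, hy, add_zero]) fun w q a ha ha' hwq => ?_
  rw [zeroAct_elem U ha ha', if_neg fun h => hn (by linarith)]

theorem zeroAct_lie_of_mem_VgDeg_zero (U : AgMod.{u, v} g) {x y : g.Vg} (hx : x ∈ g.VgDeg 0)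
    (hy : y ∈ g.VgDeg 0) : zeroAct U ⁅x, y⁆ = ⁅zeroAct U x, zeroAct U y⁆ := by
  refine VgDeg_induction₂ (p := fun x y => zeroAct U ⁅x, y⁆ = ⁅zeroAct U x, zeroAct U y⁆) hx hy
    (by simp) (by simp) (fun x x' y h h' => by simp only [add_lie, map_add, h, h'])
    (fun x y y' h h' => by simp only [lie_add, map_add, h, h'])
    fun w w' p q a b ha ha' hp hb hb' hq => ?_
  obtain rfl : p = (w : ℚ) - 1 := by linarith
  obtain rfl : q = (w' : ℚ) - 1 := by linarith
  obtain ⟨N, hN⟩ := trunc_nat a b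
  rw [lie_elem _ ha' b hN]
  rw [eig_intCast_sub_one] at ha' hb'
  rw [zeroAct_elem_sub_one U ha ha', zeroAct_elem_sub_one U hb hb',
    LieRing.of_associative_ring_bracket, ← rho_res_zero U ha ha' hb hb',
    res_eq_sum _ (N := N) (by simpa using hN)]
  simp only [map_sum, map_smul]
  refine Finset.sum_congr rfl fun i _ => ?_
  have mode_mem_eig : mode (i : ℤ) a b ∈ g.eig 0 := by
    simpa using g.mode_mem_eig ha' hb' i
  have index_eq : (w : ℚ) - 1 + (w' - 1) - i = ((w + w' - i - 1 : ℤ) : ℚ) - 1 := by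
    push_cast
    ring
  rw [index_eq, zeroAct_elem_sub_one U (mode_mem_wtSpace ha hb i) mode_mem_eig, zero_add]
  push_cast
  rfl

theorem zeroAct_lie (U : AgMod.{u, v} g) (x y : g.nonposPart) :
    zeroAct U ⁅x, y⁆ = ⁅zeroAct U x, zeroAct U y⁆ := by
  refine iSup_VgDeg_induction (p := fun x => zeroAct U ⁅x, (y : g.Vg)⁆ =
    ⁅zeroAct U x, zeroAct U y⁆) x.2 (by simp)
    (fun x x' h h' => by simp only [add_lie, map_add, h, h']) fun m hm x hx => ?_
  refine iSup_VgDeg_induction (p := fun y => zeroAct U ⁅x, y⁆ = ⁅zeroAct U x, zeroAct U y⁆) y.2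
    (by simp) (fun y y' h h' => by simp only [lie_add, map_add, h, h']) fun n hn y hy => ?_
  have hm : m ≤ 0 := hm
  have hn : n ≤ 0 := hn
  rcases hm.lt_or_eq with hm | rfl
  · rw [zeroAct_eq_zero U (add_neg_of_neg_of_nonpos hm hn).ne (lie_mem_VgDeg hx hy),
      zeroAct_eq_zero U hm.ne hx, zero_lie]
  rcases hn.lt_or_eq with hn | rfl
  · rw [zeroAct_eq_zero U (add_neg_of_nonpos_of_neg le_rfl hn).ne (lie_mem_VgDeg hx hy),
      zeroAct_eq_zero U hn.ne hy, lie_zero]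
  exact zeroAct_lie_of_mem_VgDeg_zero U hx hy

/-- The representation of `P` on `U`. -/
def nonposRep (U : AgMod.{u, v} g) : g.nonposPart →ₗ⁅ℂ⁆ Module.End ℂ U.carrier where
  toLinearMap := zeroAct U ∘ₗ g.nonposPart.toSubmodule.subtype
  map_lie' {x y} := zeroAct_lie U x y

/-- The Harish-Chandra projection `U(V[g]) → U(P)` followed by the action of `U(P)` on `U`. -/
def envAct (U : AgMod.{u, v} g) : g.UEg →ₗ[ℂ] Module.End ℂ U.carrier :=
  (UniversalEnvelopingAlgebra.lift ℂ (nonposRep U)).toLinearMap ∘ₗ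
    harishChandra (isCompl_nonposPart_posPart (g := g))

theorem envAct_one (U : AgMod.{u, v} g) : envAct U 1 = 1 := by
  rw [envAct, LinearMap.comp_apply, harishChandra_one, AlgHom.toLinearMap_apply, map_one]

theorem envAct_mul_iota (U : AgMod.{u, v} g) (t : g.UEg) {n : ℚ} (hn : n ≤ 0) {y : g.Vg}
    (hy : y ∈ g.VgDeg n) : envAct U (t * g.iota y) = envAct U t * zeroAct U y := by
  refine (congrArg (UniversalEnvelopingAlgebra.lift ℂ (nonposRep U)) (harishChandra_mul_ι _ t
    ⟨y, VgDeg_le_VgDegIn hn hy⟩)).trans ?_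
  rw [map_mul, UniversalEnvelopingAlgebra.lift_ι_apply]
  rfl

theorem envAct_iota_mul (U : AgMod.{u, v} g) {n : ℚ} (hn : 0 < n) {y : g.Vg}
    (hy : y ∈ g.VgDeg n) (t : g.UEg) : envAct U (g.iota y * t) = 0 := by
  refine (congrArg (UniversalEnvelopingAlgebra.lift ℂ (nonposRep U)) (harishChandra_ι_mul _
    (VgDeg_le_VgDegIn hn hy) t)).trans ?_
  rw [map_zero]

theorem indRel_le_ker (U : AgMod.{u, v} g) :
    (indRel U).restrictScalars ℂ ≤ LinearMap.ker (TensorProduct.lift (envAct U)) := by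
  intro x hx
  rw [Submodule.restrictScalars_mem] at hx
  rw [LinearMap.mem_ker]
  induction hx using Submodule.closure_induction with
  | zero => rw [map_zero]
  | add x y _ _ hx hy => rw [map_add, hx, hy, add_zero]
  | smul_mem t x hx =>
    rcases hx with ⟨n, hn, y, hy, z, rfl⟩ | ⟨w, a, ha, ha', z, rfl⟩
    · rw [TensorProduct.smul_tmul', TensorProduct.lift.tmul, smul_eq_mul,
        envAct_mul_iota U t hn.le hy, zeroAct_eq_zero U hn.ne hy, mul_zero, LinearMap.zero_apply]
    · rw [smul_sub, TensorProduct.smul_tmul', TensorProduct.smul_tmul', map_sub,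
        TensorProduct.lift.tmul, TensorProduct.lift.tmul, smul_eq_mul, smul_eq_mul, mul_one,
        envAct_mul_iota U t le_rfl (elem_sub_one_mem_VgDeg ha), zeroAct_elem_sub_one U ha ha',
        Module.End.mul_apply, sub_self]

/-- The projection of `M(U)` onto `U` that vanishes in positive degree. -/
def indProj (U : AgMod.{u, v} g) : Ind U →ₗ[ℂ] U.carrier :=
  ((indRel U).restrictScalars ℂ).liftQ (TensorProduct.lift (envAct U)) (indRel_le_ker U) ∘ₗ
    (Submodule.Quotient.restrictScalarsEquiv ℂ (indRel U)).symm.toLinearMap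

theorem indProj_mkQ_tmul (U : AgMod.{u, v} g) (t : g.UEg) (z : U.carrier) :
    indProj U ((indRel U).mkQ (t ⊗ₜ z)) = envAct U t z :=
  TensorProduct.lift.tmul t z

theorem indProj_indIncl (U : AgMod.{u, v} g) (z : U.carrier) : indProj U (indIncl U z) = z :=
  (indProj_mkQ_tmul U 1 z).trans (LinearMap.congr_fun (envAct_one U) z)

theorem indProj_iota_smul (U : AgMod.{u, v} g) {n : ℚ} (hn : 0 < n) {y : g.Vg}
    (hy : y ∈ g.VgDeg n) (w : Ind U) : indProj U (g.iota y • w) = 0 := by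
  obtain ⟨w, rfl⟩ := Submodule.mkQ_surjective _ w
  induction w with
  | zero => simp
  | add s t hs ht => rw [map_add, smul_add, map_add, hs, ht, add_zero]
  | tmul t z =>
    rw [← map_smul, TensorProduct.smul_tmul', smul_eq_mul, indProj_mkQ_tmul,
      envAct_iota_mul U hn hy, LinearMap.zero_apply]

end

/-! ### The structure of `M(U)` -/

section Modules

variable {N : Type*} [AddCommGroup N] [Module ℂ N] [Module g.UEg N] [IsScalarTower ℂ g.UEg N]

theorem smul_mem_of_triangular {W S : Submodule ℂ N}
    (hW : ∀ n ≤ (0 : ℚ), ∀ y ∈ g.VgDeg n, ∀ w ∈ W, g.iota y • w ∈ W) (hWS : W ≤ S)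
    (hS : ∀ n > (0 : ℚ), ∀ y ∈ g.VgDeg n, ∀ s ∈ S, g.iota y • s ∈ S) (t : g.UEg) {w : N}
    (hw : w ∈ W) : t • w ∈ S := by
  refine smul_mem_of_codisjoint isCompl_nonposPart_posPart.codisjoint (fun y hy w hw => ?_) hWS
    (fun y hy s hs => ?_) t hw
  · refine iSup_VgDeg_induction (p := fun y => g.iota y • w ∈ W) hy (by simp)
      (fun x y hx hy => ?_) fun n hn y hy => hW n hn y hy w hw
    rw [map_add, add_smul]
    exact Submodule.add_mem _ hx hy
  · refine iSup_VgDeg_induction (p := fun y => g.iota y • s ∈ S) hy (by simp)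
      (fun x y hx hy => ?_) fun n hn y hy => hS n hn y hy s hs
    rw [map_add, add_smul]
    exact Submodule.add_mem _ hx hy

end Modules

theorem mkQ_tmul (U : AgMod.{u, v} g) (t : g.UEg) (z : U.carrier) :
    (indRel U).mkQ (t ⊗ₜ z) = t • indIncl U z := by
  rw [indIncl, LinearMap.comp_apply, LinearMap.restrictScalars_apply, ← map_smul,
    TensorProduct.mk_apply, TensorProduct.smul_tmul', smul_eq_mul, mul_one]

theorem Ind_induction (U : AgMod.{u, v} g) {p : Ind U → Prop} (w : Ind U)
    (add : ∀ w w', p w → p w' → p (w + w')) (smul : ∀ (t : g.UEg) z, p (t • indIncl U z)) :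
    p w := by
  obtain ⟨s, rfl⟩ := Submodule.mkQ_surjective _ w
  induction s with
  | zero => simpa using smul 0 0
  | add s t hs ht => exact map_add (indRel U).mkQ s t ▸ add _ _ hs ht
  | tmul t z => exact mkQ_tmul U t z ▸ smul t z

theorem iota_smul_indIncl (U : AgMod.{u, v} g) {n : ℚ} (hn : n ≤ 0) {y : g.Vg}
    (hy : y ∈ g.VgDeg n) (z : U.carrier) :
    g.iota y • indIncl U z = indIncl U (zeroAct U y z) := by
  rcases hn.lt_or_eq with hn | rfl
  · rw [zeroAct_eq_zero U hn.ne hy, LinearMap.zero_apply, map_zero, ← mkQ_tmul,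
      Submodule.mkQ_apply, Submodule.Quotient.mk_eq_zero]
    exact Submodule.subset_span (Or.inl ⟨n, hn, y, hy, z, rfl⟩)
  refine VgDeg_induction (p := fun y => g.iota y • indIncl U z = indIncl U (zeroAct U y z)) hy
    (by simp) (fun x y hx hy => ?_) fun w q a ha ha' hwq => ?_
  · rw [map_add, add_smul, hx, hy, map_add, LinearMap.add_apply, map_add]
  obtain rfl : q = (w : ℚ) - 1 := by linarith
  rw [eig_intCast_sub_one] at ha'
  rw [zeroAct_elem_sub_one U ha ha', ← sub_eq_zero, ← one_smul g.UEg (indIncl U (U.rho _ z)),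
    ← mkQ_tmul, ← mkQ_tmul, ← map_sub, Submodule.mkQ_apply, Submodule.Quotient.mk_eq_zero]
  exact Submodule.subset_span (Or.inr ⟨w, a, ha, ha', z, rfl⟩)

theorem mem_of_posPart_smul_mem (U : AgMod.{u, v} g) {S : Submodule ℂ (Ind U)}
    (hU : ∀ z, indIncl U z ∈ S)
    (hS : ∀ n > (0 : ℚ), ∀ y ∈ g.VgDeg n, ∀ s ∈ S, g.iota y • s ∈ S) (w : Ind U) : w ∈ S := by
  refine Ind_induction U w (fun _ _ => Submodule.add_mem S) fun t z => ?_
  refine smul_mem_of_triangular (W := LinearMap.range (indIncl U)) ?_ ?_ hS t ⟨z, rfl⟩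
  · rintro n hn y hy _ ⟨z, rfl⟩
    exact ⟨_, (iota_smul_indIncl U hn hy z).symm⟩
  · rintro _ ⟨z, rfl⟩
    exact hU z

/-- The functor `M` on morphisms. -/
def indMap {U W : AgMod.{u, v} g} (f : U ⟶ W) : Ind U →ₗ[g.UEg] Ind W :=
  Submodule.mapQ (indRel U) (indRel W) (AlgebraTensorModule.map LinearMap.id f.toLin) (by
    refine Submodule.span_le.mpr ?_
    rintro _ (⟨n, hn, y, hy, z, rfl⟩ | ⟨w, a, ha, ha', z, rfl⟩)
    · exact Submodule.subset_span (Or.inl ⟨n, hn, y, hy, f.toLin z, rfl⟩)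
    · refine Submodule.subset_span (Or.inr ⟨w, a, ha, ha', f.toLin z, ?_⟩)
      rw [map_sub, AlgebraTensorModule.map_tmul, AlgebraTensorModule.map_tmul, f.comm]
      rfl)

theorem indMap_indIncl {U W : AgMod.{u, v} g} (f : U ⟶ W) (z : U.carrier) :
    indMap f (indIncl U z) = indIncl W (f.toLin z) := rfl

theorem indProj_indMap {U W : AgMod.{u, v} g} (f : U ⟶ W) (w : Ind U) :
    indProj W (indMap f w) = f.toLin (indProj U w) := by
  refine mem_of_posPart_smul_mem U (S := LinearMap.eqLocus
    (indProj W ∘ₗ (indMap f).restrictScalars ℂ) (f.toLin ∘ₗ indProj U)) (fun z => ?_)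
    (fun n hn y hy s _ => ?_) w
  · change indProj W (indMap f (indIncl U z)) = f.toLin (indProj U (indIncl U z))
    rw [indMap_indIncl, indProj_indIncl, indProj_indIncl]
  · change indProj W (indMap f (g.iota y • s)) = f.toLin (indProj U (g.iota y • s))
    rw [map_smul, indProj_iota_smul W hn hy, indProj_iota_smul U hn hy, map_zero]

theorem iota_smul_mem_indGr (U : AgMod.{u, v} g) {m n : ℚ} {y : g.Vg} (hy : y ∈ g.VgDeg m)
    {w : Ind U} (hw : w ∈ indGr U n) : g.iota y • w ∈ indGr U (m + n) := by
  induction hw using Submodule.span_induction with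
  | zero => simp
  | add s t _ _ hs ht => exact smul_add (g.iota y) s t ▸ Submodule.add_mem _ hs ht
  | smul c s _ hs =>
    rw [smul_algebra_smul_comm]
    exact Submodule.smul_mem _ _ hs
  | mem s hs =>
    obtain ⟨l, z, hl, rfl, rfl⟩ := hs
    refine Submodule.subset_span ⟨(m, y) :: l, z, List.forall_mem_cons.mpr ⟨hy, hl⟩, rfl, ?_⟩
    rw [List.map_cons, List.prod_cons, mul_smul]

theorem indIncl_mem_indGr (U : AgMod.{u, v} g) (z : U.carrier) : indIncl U z ∈ indGr U 0 :=
  Submodule.subset_span ⟨[], z, by simp, rfl, (one_smul g.UEg _).symm⟩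

theorem indGr_induction (U : AgMod.{u, v} g) {p : ℚ → Ind U → Prop} {n : ℚ} {w : Ind U}
    (hw : w ∈ indGr U n) (zero : p n 0) (add : ∀ w w', p n w → p n w' → p n (w + w'))
    (incl : ∀ z, p 0 (indIncl U z))
    (iota_smul : ∀ m k, ∀ y ∈ g.VgDeg m, ∀ w ∈ indGr U k, p k w → p (m + k) (g.iota y • w)) :
    p n w := by
  induction hw using Submodule.closure_induction with
  | zero => exact zero
  | add x y _ _ hx hy => exact add _ _ hx hy
  | smul_mem c x hx =>
    obtain ⟨l, z, hl, rfl, rfl⟩ := hx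
    rw [smul_comm, ← map_smul]
    generalize c • z = z
    clear zero add
    induction l with
    | nil => simpa using incl z
    | cons q l ih =>
      obtain ⟨hq, hl⟩ := List.forall_mem_cons.mp hl
      rw [List.map_cons, List.map_cons, List.sum_cons, List.prod_cons, mul_smul]
      exact iota_smul q.1 _ q.2 hq _ (Submodule.subset_span ⟨l, z, hl, rfl, rfl⟩) (ih hl)

theorem indMap_mem_indGr {U W : AgMod.{u, v} g} (f : U ⟶ W) {n : ℚ} {w : Ind U}
    (hw : w ∈ indGr U n) : indMap f w ∈ indGr W n := by
  refine indGr_induction U (p := fun n w => indMap f w ∈ indGr W n) hw (by simp)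
    (fun w w' h h' => map_add (indMap f) w w' ▸ Submodule.add_mem _ h h')
    (fun z => indIncl_mem_indGr W (f.toLin z)) fun m k y hy w _ h => ?_
  rw [map_smul]
  exact iota_smul_mem_indGr W hy h

theorem conf_mem_VgDeg : g.elem 1 conf ∈ g.VgDeg 0 := by
  convert elem_mem_VgDeg (g := g) conf_mem_wtSpace 1 using 2
  norm_num

/-- The action of the conformal vector, as an endomorphism of the `A_g(V)`-module `U`. -/
def confHom (U : AgMod.{u, v} g) : U ⟶ U :=
  AgMod.Hom.mk (zeroAct U (g.elem 1 conf)) fun a x => by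
    obtain ⟨a, rfl⟩ := g.Og.mkQ_surjective a
    rw [← mkQ_proj]
    induction a using wt_induction with
    | zero => simp
    | add a b ha hb => simp only [map_add, LinearMap.add_apply, ha, hb]
    | hom w a ha =>
      have ha' := g.proj_mem_wtSpace ha 0
      have mem_VgDeg := elem_sub_one_mem_VgDeg (g := g) ha'
      have lie_eq_zero := zeroAct_lie_of_mem_VgDeg_zero U conf_mem_VgDeg mem_VgDeg
      rw [lie_conf mem_VgDeg, Rat.cast_zero, zero_smul, map_zero,
        zeroAct_elem_sub_one U ha' (g.proj_mem 0 a), eq_comm, LieRing.of_associative_ring_bracket,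
        sub_eq_zero] at lie_eq_zero
      exact LinearMap.congr_fun lie_eq_zero x

/-- The operator on `M(U)` which is `n` on `M(U)(n)`: the action of `L(0)` on `M(U)`, corrected by
the endomorphism of `M(U)` induced by the action of `L(0)` on `U`. -/
def indDegOp (U : AgMod.{u, v} g) : Module.End ℂ (Ind U) :=
  Algebra.lsmul ℂ ℂ (Ind U) (g.iota (g.elem 1 conf)) - (indMap (confHom U)).restrictScalars ℂ

theorem indDegOp_apply (U : AgMod.{u, v} g) (w : Ind U) :
    indDegOp U w = g.iota (g.elem 1 conf) • w - indMap (confHom U) w := rfl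

theorem indDegOp_indIncl (U : AgMod.{u, v} g) (z : U.carrier) : indDegOp U (indIncl U z) = 0 := by
  rw [indDegOp_apply, indMap_indIncl, iota_smul_indIncl U le_rfl conf_mem_VgDeg]
  exact sub_self _

theorem indDegOp_iota_smul (U : AgMod.{u, v} g) {n : ℚ} {y : g.Vg} (hy : y ∈ g.VgDeg n)
    (w : Ind U) : indDegOp U (g.iota y • w) = (n : ℂ) • g.iota y • w + g.iota y • indDegOp U w := by
  have smul_smul_eq : g.iota (g.elem 1 conf) • g.iota y • w =
      g.iota ⁅g.elem 1 conf, y⁆ • w + g.iota y • g.iota (g.elem 1 conf) • w :=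
    ι_smul_ι_smul _ y w
  rw [indDegOp_apply, indDegOp_apply, smul_smul_eq, lie_conf hy, map_smul, map_smul, smul_assoc,
    smul_sub, add_sub_assoc]

theorem indGr_le_eigenspace (U : AgMod.{u, v} g) (n : ℚ) :
    indGr U n ≤ Module.End.eigenspace (indDegOp U) (n : ℂ) := by
  intro w hw
  rw [Module.End.mem_eigenspace_iff]
  refine indGr_induction U (p := fun n w => indDegOp U w = (n : ℂ) • w) hw (by simp)
    (fun w w' h h' => by rw [map_add, h, h', smul_add]) (fun z => ?_) fun m k y hy w _ h => ?_
  · rw [indDegOp_indIncl, Rat.cast_zero, zero_smul]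
  · rw [indDegOp_iota_smul U hy, h, smul_algebra_smul_comm, Rat.cast_add, add_smul]

theorem iSupIndep_map_indGr (U : AgMod.{u, v} g) {J : Submodule g.UEg (Ind U)}
    (hJ : J ≤ J.comap (indMap (confHom U))) :
    iSupIndep fun n => (indGr U n).map (J.mkQ.restrictScalars ℂ) := by
  let degOp : Module.End ℂ (Ind U ⧸ J) := Algebra.lsmul ℂ ℂ _ (g.iota (g.elem 1 conf)) -
    (J.mapQ J (indMap (confHom U)) hJ).restrictScalars ℂ
  refine ((Module.End.eigenspaces_iSupIndep degOp).comp (f := fun n : ℚ => (n : ℂ))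
    Rat.cast_injective).mono ?_
  rintro n _ ⟨w, hw, rfl⟩
  have degOp_eq := congrArg (J.mkQ.restrictScalars ℂ)
    (Module.End.mem_eigenspace_iff.mp (indGr_le_eigenspace U n hw))
  rw [map_smul] at degOp_eq
  exact Module.End.mem_eigenspace_iff.mpr degOp_eq

theorem iSupIndep_indGr (U : AgMod.{u, v} g) : iSupIndep (indGr U) :=
  ((Module.End.eigenspaces_iSupIndep (indDegOp U)).comp (f := fun n : ℚ => (n : ℂ))
    Rat.cast_injective).mono (indGr_le_eigenspace U)

theorem range_indIncl_sup_iSup_indGr (U : AgMod.{u, v} g) :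
    LinearMap.range (indIncl U) ⊔ ⨆ n ∈ Set.Ioi (0 : ℚ), indGr U n = ⊤ := by
  refine eq_top_iff.mpr fun w _ => mem_of_posPart_smul_mem U
    (fun z => Submodule.mem_sup_left (LinearMap.mem_range_self _ z)) (fun n hn y hy s hs => ?_) w
  have sup_le : LinearMap.range (indIncl U) ⊔ ⨆ n ∈ Set.Ioi (0 : ℚ), indGr U n ≤
      ⨆ n : Set.Ici (0 : ℚ), indGr U n := by
    refine sup_le ?_ (iSup₂_le fun n hn =>
      le_iSup (fun n : Set.Ici (0 : ℚ) => indGr U n) ⟨n, (Set.mem_Ioi.mp hn).le⟩)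
    rintro _ ⟨z, rfl⟩
    exact Submodule.mem_iSup_of_mem ⟨0, Set.self_mem_Ici⟩ (indIncl_mem_indGr U z)
  refine Submodule.iSup_induction _ (motive := fun s => g.iota y • s ∈ _ ⊔ ⨆ n ∈ _, indGr U n)
    (sup_le hs) (fun m s hs => ?_) (by simp)
    fun s t hs ht => smul_add (g.iota y) s t ▸ Submodule.add_mem _ hs ht
  exact Submodule.mem_sup_right (Submodule.mem_iSup_of_mem _ (Submodule.mem_iSup_of_mem
    (add_pos_of_pos_of_nonneg hn m.2) (iota_smul_mem_indGr U hy hs)))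

theorem indGr_zero (U : AgMod.{u, v} g) : indGr U 0 = LinearMap.range (indIncl U) := by
  have range_le : LinearMap.range (indIncl U) ≤ indGr U 0 := by
    rintro _ ⟨z, rfl⟩
    exact indIncl_mem_indGr U z
  have disjoint : Disjoint (indGr U 0) (⨆ n ∈ Set.Ioi (0 : ℚ), indGr U n) :=
    (iSupIndep_indGr U).disjoint_biSup Set.self_notMem_Ioi
  refine (eq_of_le_of_inf_le_of_sup_le range_le (z := ⨆ n ∈ Set.Ioi (0 : ℚ), indGr U n) ?_ ?_).symm
  · exact disjoint.eq_bot.le.trans bot_le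
  · rw [range_indIncl_sup_iSup_indGr]
    exact le_top

theorem iSup_nonneg_indGr (U : AgMod.{u, v} g) : ⨆ n ∈ Set.Ici (0 : ℚ), indGr U n = ⊤ := by
  rw [eq_top_iff, ← range_indIncl_sup_iSup_indGr, ← indGr_zero]
  exact sup_le (le_iSup₂_of_le 0 Set.self_mem_Ici le_rfl)
    (biSup_mono Set.Ioi_subset_Ici_self)

theorem iSup_indGr (U : AgMod.{u, v} g) : ⨆ n, indGr U n = ⊤ :=
  eq_top_iff.mpr ((iSup_nonneg_indGr U).ge.trans (iSup₂_le fun n _ => le_iSup (indGr U) n))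

theorem indGr_eq_bot_of_neg (U : AgMod.{u, v} g) {n : ℚ} (hn : n < 0) : indGr U n = ⊥ := by
  have disjoint : Disjoint (indGr U n) (⨆ n ∈ Set.Ici (0 : ℚ), indGr U n) :=
    (iSupIndep_indGr U).disjoint_biSup hn.not_ge
  rwa [iSup_nonneg_indGr, disjoint_top] at disjoint

theorem exists_int_of_mem_indGr (U : AgMod.{u, v} g) {n : ℚ} {w : Ind U} (hw : w ∈ indGr U n)
    (hw0 : w ≠ 0) : ∃ k : ℤ, n = k / g.T := by
  refine (indGr_induction U (p := fun n w => w = 0 ∨ ∃ k : ℤ, n = k / g.T) hw (Or.inl rfl)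
    (fun w w' h h' => ?_) (fun z => Or.inr ⟨0, by simp⟩) fun m n y hy w _ h => ?_).resolve_left hw0
  · rcases h with rfl | h
    · rwa [zero_add]
    · exact Or.inr h
  · rcases h with rfl | ⟨k, rfl⟩
    · exact Or.inl (smul_zero _)
    by_cases hm : ∃ j : ℤ, m = j / g.T
    · obtain ⟨j, rfl⟩ := hm
      exact Or.inr ⟨j + k, by push_cast; ring⟩
    · rw [VgDeg_eq_bot hm, Submodule.mem_bot] at hy
      exact Or.inl (by rw [hy, map_zero, zero_smul])

theorem indGr_eq_bot (U : AgMod.{u, v} g) {n : ℚ} (hn : ¬ ∃ k : ℕ, n = k / g.T) :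
    indGr U n = ⊥ := by
  rcases lt_or_ge n 0 with h0 | h0
  · exact indGr_eq_bot_of_neg U h0
  refine eq_bot_iff.mpr fun w hw => of_not_not fun hw0 => hn ?_
  obtain ⟨k, rfl⟩ := exists_int_of_mem_indGr U hw hw0
  have hT : (0 : ℚ) < g.T := by exact_mod_cast g.T_pos
  have hk : 0 ≤ k := by
    rw [le_div_iff₀ hT, zero_mul] at h0
    exact_mod_cast h0
  lift k to ℕ using hk
  exact ⟨k, by rw [Int.cast_natCast]⟩

theorem indProj_eq_zero (U : AgMod.{u, v} g) {n : ℚ} (hn : n ≠ 0) {w : Ind U}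
    (hw : w ∈ indGr U n) : indProj U w = 0 := by
  have indProj_indDegOp : indProj U (indDegOp U w) = 0 := by
    refine mem_of_posPart_smul_mem U (S := LinearMap.ker (indProj U ∘ₗ indDegOp U)) (fun z => ?_)
      (fun m hm y hy s _ => ?_) w
    · rw [LinearMap.mem_ker, LinearMap.comp_apply, indDegOp_indIncl, map_zero]
    · rw [LinearMap.mem_ker, LinearMap.comp_apply, indDegOp_iota_smul U hy, map_add, map_smul,
        indProj_iota_smul U hm hy, indProj_iota_smul U hm hy, smul_zero, add_zero]
  rw [Module.End.mem_eigenspace_iff.mp (indGr_le_eigenspace U n hw), map_smul] at indProj_indDegOp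
  exact (smul_eq_zero.mp indProj_indDegOp).resolve_left (Rat.cast_ne_zero.mpr hn)

/-- The radical of `M(U)`: the largest submodule contained in the kernel of the projection to
`U`. -/
def indRad (U : AgMod.{u, v} g) : Submodule g.UEg (Ind U) where
  carrier := {w | ∀ t : g.UEg, indProj U (t • w) = 0}
  zero_mem' := fun t => by simp
  add_mem' := fun hw hw' t => by rw [smul_add, map_add, hw, hw', add_zero]
  smul_mem' := fun s w hw t => by rw [← mul_smul]; exact hw _

theorem indRad_le_comap {U W : AgMod.{u, v} g} (f : U ⟶ W) :
    indRad U ≤ (indRad W).comap (indMap f) :=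
  fun w hw t => by rw [← map_smul, indProj_indMap, hw t, map_zero]

theorem isGradedAvoiding_indRad (U : AgMod.{u, v} g) : IsGradedAvoiding U (indRad U) where
  graded := by
    have h := ker_le_iSup_ker_inf (iSup_indGr U)
      (iSupIndep_map_indGr U (indRad_le_comap (confHom U)))
    rwa [LinearMap.ker_restrictScalars, Submodule.ker_mkQ] at h
  inter_eq := by
    rw [eq_bot_iff]
    rintro _ ⟨hw, z, rfl⟩
    have hz : z = 0 := by simpa [indProj_indIncl] using hw 1
    rw [hz, map_zero]
    exact Submodule.zero_mem _

theorem le_indRad (U : AgMod.{u, v} g) {J : Submodule g.UEg (Ind U)} (hJ : IsGradedAvoiding U J) :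
    J ≤ indRad U := by
  have le_ker : J.restrictScalars ℂ ≤ LinearMap.ker (indProj U) := by
    refine hJ.graded.trans (iSup_le fun n => ?_)
    by_cases hn : n = 0
    · rw [hn, indGr_zero, hJ.inter_eq]
      exact bot_le
    · exact fun w hw => indProj_eq_zero U hn hw.2
  exact fun w hw t => le_ker (J.smul_mem t hw)

theorem maxJ_eq_indRad (U : AgMod.{u, v} g) : maxJ U = indRad U :=
  le_antisymm (sSup_le fun _ hJ => le_indRad U hJ) (le_sSup (isGradedAvoiding_indRad U))

theorem isGreatest_maxJ (U : AgMod.{u, v} g) :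
    IsGreatest {J | IsGradedAvoiding U J} (maxJ U) := by
  rw [maxJ_eq_indRad]
  exact ⟨isGradedAvoiding_indRad U, fun _ hJ => le_indRad U hJ⟩

theorem maxJ_le_comap {U W : AgMod.{u, v} g} (f : U ⟶ W) :
    maxJ U ≤ (maxJ W).comap (indMap f) := by
  rw [maxJ_eq_indRad, maxJ_eq_indRad]
  exact indRad_le_comap f

/-! ### The structure of `L(U)` -/

theorem LMk_surjective (U : AgMod.{u, v} g) : Function.Surjective (LMk U) :=
  Submodule.mkQ_surjective (maxJ U)

theorem iSupIndep_LGr (U : AgMod.{u, v} g) : iSupIndep (LGr U) :=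
  iSupIndep_map_indGr U (maxJ_le_comap (confHom U))

theorem iSup_LGr (U : AgMod.{u, v} g) : ⨆ n, LGr U n = ⊤ := by
  simp only [LGr, ← Submodule.map_iSup, iSup_indGr, Submodule.map_top]
  exact LinearMap.range_eq_top.mpr (LMk_surjective U)

theorem LGr_eq_bot (U : AgMod.{u, v} g) {n : ℚ} (hn : ¬ ∃ k : ℕ, n = k / g.T) : LGr U n = ⊥ := by
  rw [LGr, indGr_eq_bot U hn, Submodule.map_bot]

theorem LGr_eq_bot_of_neg (U : AgMod.{u, v} g) {n : ℚ} (hn : n < 0) : LGr U n = ⊥ := by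
  rw [LGr, indGr_eq_bot_of_neg U hn, Submodule.map_bot]

theorem iota_smul_mem_LGr (U : AgMod.{u, v} g) {m n : ℚ} {y : g.Vg} (hy : y ∈ g.VgDeg m)
    {w : LCar U} (hw : w ∈ LGr U n) : g.iota y • w ∈ LGr U (m + n) := by
  obtain ⟨w, hw, rfl⟩ := hw
  exact ⟨_, iota_smul_mem_indGr U hy hw, rfl⟩

/-- The natural map from `U` to `L(U)`. -/
def LIncl (U : AgMod.{u, v} g) : U.carrier →ₗ[ℂ] LCar U := LMk U ∘ₗ indIncl U

theorem LGr_zero (U : AgMod.{u, v} g) : LGr U 0 = LinearMap.range (LIncl U) := by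
  rw [LGr, indGr_zero, LIncl, LinearMap.range_comp]

theorem iota_smul_LIncl (U : AgMod.{u, v} g) {n : ℚ} (hn : n ≤ 0) {y : g.Vg}
    (hy : y ∈ g.VgDeg n) (z : U.carrier) :
    g.iota y • LIncl U z = LIncl U (zeroAct U y z) :=
  congrArg (LMk U) (iota_smul_indIncl U hn hy z)

theorem LCar_induction (U : AgMod.{u, v} g) {p : LCar U → Prop} (w : LCar U)
    (add : ∀ w w', p w → p w' → p (w + w')) (smul : ∀ (t : g.UEg) z, p (t • LIncl U z)) :
    p w := by
  obtain ⟨w, rfl⟩ := LMk_surjective U w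
  exact Ind_induction U (p := fun w => p (LMk U w)) w
    (fun w w' h h' => map_add (LMk U) w w' ▸ add _ _ h h') smul

theorem mem_of_iota_smul_mem (U : AgMod.{u, v} g) {S : Submodule ℂ (LCar U)}
    (hU : ∀ z, LIncl U z ∈ S) (hS : ∀ n, ∀ y ∈ g.VgDeg n, ∀ s ∈ S, g.iota y • s ∈ S)
    (w : LCar U) : w ∈ S :=
  LCar_induction U w (fun _ _ => Submodule.add_mem S) fun t z =>
    smul_mem_of_triangular (fun n _ => hS n) le_rfl (fun n _ => hS n) t (hU z)

/-- The projection of `L(U)` onto `U` that vanishes in positive degree. -/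
def LProj (U : AgMod.{u, v} g) : LCar U →ₗ[ℂ] U.carrier :=
  ((maxJ U).restrictScalars ℂ).liftQ (indProj U) (fun w hw => by
    rw [Submodule.restrictScalars_mem, maxJ_eq_indRad] at hw
    simpa using hw 1) ∘ₗ (Submodule.Quotient.restrictScalarsEquiv ℂ (maxJ U)).symm.toLinearMap

theorem LProj_LIncl (U : AgMod.{u, v} g) (z : U.carrier) : LProj U (LIncl U z) = z :=
  indProj_indIncl U z

theorem LProj_eq_zero (U : AgMod.{u, v} g) {n : ℚ} (hn : n ≠ 0) {w : LCar U}
    (hw : w ∈ LGr U n) : LProj U w = 0 := by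
  obtain ⟨w, hw, rfl⟩ := hw
  exact indProj_eq_zero U hn hw

theorem LProj_iota_smul (U : AgMod.{u, v} g) {n : ℚ} (hn : 0 < n) {y : g.Vg}
    (hy : y ∈ g.VgDeg n) (w : LCar U) : LProj U (g.iota y • w) = 0 := by
  obtain ⟨w, rfl⟩ := LMk_surjective U w
  exact indProj_iota_smul U hn hy w

theorem LCar_eq_zero (U : AgMod.{u, v} g) {w : LCar U}
    (h : ∀ t : g.UEg, LProj U (t • w) = 0) : w = 0 := by
  obtain ⟨w, rfl⟩ := LMk_surjective U w
  refine (Submodule.Quotient.mk_eq_zero _).mpr ?_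
  rw [maxJ_eq_indRad]
  exact h

/-- The functor `L` on morphisms. -/
def LMap {U W : AgMod.{u, v} g} (f : U ⟶ W) : LCar U →ₗ[g.UEg] LCar W :=
  Submodule.mapQ (maxJ U) (maxJ W) (indMap f) (maxJ_le_comap f)

theorem LMap_LIncl {U W : AgMod.{u, v} g} (f : U ⟶ W) (z : U.carrier) :
    LMap f (LIncl U z) = LIncl W (f.toLin z) := rfl

theorem LMap_mem_LGr {U W : AgMod.{u, v} g} (f : U ⟶ W) {n : ℚ} {w : LCar U}
    (hw : w ∈ LGr U n) : LMap f w ∈ LGr W n := by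
  obtain ⟨w, hw, rfl⟩ := hw
  exact ⟨_, indMap_mem_indGr f hw, rfl⟩

/-! ### The defect of the twisted Jacobi identity -/

section ModeProducts

variable {A N : Type*} [AddCommGroup A] [Module ℂ A] [AddCommGroup N] [Module ℂ N]
variable (Y : ℚ → A →ₗ[ℂ] Module.End ℂ N)

/-- The sum over the products of modes of `a` and `b` in the twisted Jacobi identity, cut off at
`K`. The products in the opposite order are obtained by exchanging `(a, m)` with `(b, k)`. -/
def prodSum (a b : A) (m : ℚ) (n : ℤ) (k : ℚ) (K : ℕ) (w : N) : N :=
  ∑ i ∈ Finset.range K, Ring.choose (n : ℂ) i • (-1 : ℂ) ^ i • Y (m + n - i) a (Y (k + i) b w)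

/-- The truncation property of twisted modules: the modes of each vector eventually annihilate each
vector of `N`. -/
def IsTruncated : Prop := ∀ (a : A) (w : N), ∃ K : ℚ, ∀ n ≥ K, Y n a w = 0

variable {Y}

theorem IsTruncated.eventually_eq_zero (htr : IsTruncated Y) (a : A) (w : N) (k : ℚ) :
    ∀ᶠ K : ℕ in atTop, ∀ i : ℕ, K ≤ i → Y (k + i) a w = 0 := by
  obtain ⟨K, hK⟩ := htr a w
  obtain ⟨K', hK'⟩ := exists_nat_ge (K - k)
  refine (eventually_ge_atTop K').mono fun K'' h i hi => hK _ ?_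
  have : (K' : ℚ) ≤ i := by exact_mod_cast h.trans hi
  linarith

theorem sum_choose_succ {W : Type*} [AddCommGroup W] [Module ℂ W] (x : ℂ) (K : ℕ) (f : ℕ → W) :
    ∑ i ∈ Finset.range (K + 1), Ring.choose (x + 1) i • f i =
      ∑ i ∈ Finset.range (K + 1), Ring.choose x i • f i +
        ∑ i ∈ Finset.range K, Ring.choose x i • f (i + 1) := by
  rw [Finset.sum_range_succ', Finset.sum_range_succ' _ K]
  simp only [Ring.choose_succ_succ, add_smul, Finset.sum_add_distrib, Ring.choose_zero_right]
  abel

theorem prodSum_succ (a b : A) (m : ℚ) (n : ℤ) (k : ℚ) {K : ℕ} {w : N}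
    (hK : Y (k + (K + 1 : ℕ)) b w = 0) :
    prodSum Y a b m (n + 1) k (K + 1) w =
      prodSum Y a b (m + 1) n k (K + 1) w - prodSum Y a b m n (k + 1) (K + 1) w := by
  have hlast : Y (k + 1 + K) b w = 0 := by
    rw [show k + 1 + (K : ℚ) = k + (K + 1 : ℕ) by push_cast; ring, hK]
  simp only [prodSum]
  rw [Int.cast_add, Int.cast_one, sum_choose_succ,
    Finset.sum_range_succ (fun i => _ • _ • Y (m + n - i) a (Y (k + 1 + i) b w)), hlast, map_zero,
    smul_zero, smul_zero, add_zero, sub_eq_add_neg, ← Finset.sum_neg_distrib]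
  congr 1 <;> refine Finset.sum_congr rfl fun i _ => ?_
  · rw [show m + ((n + 1 : ℤ) : ℚ) - i = m + 1 + n - i by push_cast; ring]
  · rw [show k + ((i + 1 : ℕ) : ℚ) = k + 1 + i by push_cast; ring,
      show m + ((n + 1 : ℤ) : ℚ) - ((i + 1 : ℕ) : ℚ) = m + n - i by push_cast; ring, pow_succ,
      mul_neg_one, neg_smul, smul_neg]

end ModeProducts

section Jacobiator

variable {N : Type*} [AddCommGroup N] [Module ℂ N] (Y : ℚ → V →ₗ[ℂ] Module.End ℂ N)

/-- The sum over the modes of `a_{n+i} b` in the twisted Jacobi identity, cut off at `K`. -/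
def iterSum (a b : V) (m : ℚ) (n : ℤ) (k : ℚ) (K : ℕ) (w : N) : N :=
  ∑ i ∈ Finset.range K, Ring.choose (m : ℂ) i • Y (m + k - i) (mode (n + i) a b) w

/-- The difference of the two sides of the twisted Jacobi identity for the operators `Y q a`. -/
def jacobiator (a b : V) (m : ℚ) (n : ℤ) (k : ℚ) (w : N) : N :=
  ∑ᶠ i : ℕ, Ring.choose (m : ℂ) i • Y (m + k - i) (mode (n + i) a b) w -
    ∑ᶠ i : ℕ, ((-1) ^ i * Ring.choose (n : ℂ) i) •
      (Y (m + n - i) a (Y (k + i) b w) - (-1 : ℂ) ^ n • Y (n + k - i) b (Y (m + i) a w))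

variable (g) in
/-- The commutator formula for the operators `Y q a`. -/
def HasCommutator : Prop := ∀ (p q : ℚ) (a b : V) (w : N), a ∈ g.eig p →
  Y p a (Y q b w) - Y q b (Y p a w) =
    ∑ᶠ i : ℕ, Ring.choose (p : ℂ) i • Y (p + q - i) (mode (i : ℤ) a b) w

variable {Y}

theorem eventually_mode_eq_zero (a b : V) (n : ℤ) :
    ∀ᶠ K : ℕ in atTop, ∀ i : ℕ, K ≤ i → mode (n + i) a b = 0 := by
  obtain ⟨K, hK⟩ := trunc_add a b n
  exact (eventually_ge_atTop K).mono fun K' h i hi => hK i (h.trans hi)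

theorem eventually_jacobiator_eq (htr : IsTruncated Y) (a b : V) (m : ℚ) (n : ℤ) (k : ℚ) (w : N) :
    ∀ᶠ K : ℕ in atTop, jacobiator Y a b m n k w = iterSum Y a b m n k K w -
      (prodSum Y a b m n k K w - (-1 : ℂ) ^ n • prodSum Y b a k n m K w) := by
  filter_upwards [eventually_mode_eq_zero a b n, htr.eventually_eq_zero b w k,
    htr.eventually_eq_zero a w m] with K hmode hb ha
  rw [jacobiator, finsum_range _ K, finsum_range _ K, iterSum, prodSum, prodSum, Finset.smul_sum]
  · simp only [← Finset.sum_sub_distrib]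
    refine Finset.sum_congr rfl fun i _ => ?_
    rw [add_comm k (n : ℚ)]
    module
  · exact fun i hi => by simp [hb i hi, ha i hi]
  · exact fun i hi => by simp [hmode i hi]

theorem jacobiator_add (htr : IsTruncated Y) (a b : V) (m : ℚ) (n : ℤ) (k : ℚ) (w w' : N) :
    jacobiator Y a b m n k (w + w') = jacobiator Y a b m n k w + jacobiator Y a b m n k w' := by
  obtain ⟨K, hadd, hw, hw'⟩ := ((eventually_jacobiator_eq htr a b m n k (w + w')).and
    ((eventually_jacobiator_eq htr a b m n k w).and
      (eventually_jacobiator_eq htr a b m n k w'))).exists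
  rw [hadd, hw, hw']
  simp only [iterSum, prodSum, map_add, smul_add, Finset.sum_add_distrib]
  abel

theorem jacobiator_smul (htr : IsTruncated Y) (a b : V) (m : ℚ) (n : ℤ) (k : ℚ) (c : ℂ) (w : N) :
    jacobiator Y a b m n k (c • w) = c • jacobiator Y a b m n k w := by
  obtain ⟨K, hsmul, hw⟩ := ((eventually_jacobiator_eq htr a b m n k (c • w)).and
    (eventually_jacobiator_eq htr a b m n k w)).exists
  rw [hsmul, hw]
  simp only [iterSum, prodSum, map_smul, smul_sub, Finset.smul_sum, smul_comm c]

theorem jacobiator_add_right (htr : IsTruncated Y) (a b b' : V) (m : ℚ) (n : ℤ) (k : ℚ) (w : N) :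
    jacobiator Y a (b + b') m n k w = jacobiator Y a b m n k w + jacobiator Y a b' m n k w := by
  obtain ⟨K, hadd, hb, hb'⟩ := ((eventually_jacobiator_eq htr a (b + b') m n k w).and
    ((eventually_jacobiator_eq htr a b m n k w).and
      (eventually_jacobiator_eq htr a b' m n k w))).exists
  rw [hadd, hb, hb']
  simp only [iterSum, prodSum, map_add, LinearMap.add_apply, smul_add, Finset.sum_add_distrib]
  abel

theorem jacobiator_add_left (htr : IsTruncated Y) (a a' b : V) (m : ℚ) (n : ℤ) (k : ℚ) (w : N) :
    jacobiator Y (a + a') b m n k w = jacobiator Y a b m n k w + jacobiator Y a' b m n k w := by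
  obtain ⟨K, hadd, ha, ha'⟩ := ((eventually_jacobiator_eq htr (a + a') b m n k w).and
    ((eventually_jacobiator_eq htr a b m n k w).and
      (eventually_jacobiator_eq htr a' b m n k w))).exists
  rw [hadd, ha, ha']
  simp only [iterSum, prodSum, map_add, LinearMap.add_apply, smul_add, Finset.sum_add_distrib]
  abel

theorem jacobiator_zero_left (b : V) (m : ℚ) (n : ℤ) (k : ℚ) (w : N) :
    jacobiator Y 0 b m n k w = 0 := by
  simp [jacobiator]

theorem jacobiator_zero_right (a : V) (m : ℚ) (n : ℤ) (k : ℚ) (w : N) :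
    jacobiator Y a 0 m n k w = 0 := by
  simp [jacobiator]

theorem iterSum_succ (a b : V) (m : ℚ) (n : ℤ) (k : ℚ) {K : ℕ}
    (hK : mode (n + (K + 1 : ℕ)) a b = 0) (w : N) :
    iterSum Y a b (m + 1) n k (K + 1) w =
      iterSum Y a b m (n + 1) k (K + 1) w + iterSum Y a b m n (k + 1) (K + 1) w := by
  have hlast : Y (m + k - K) (mode (n + 1 + K) a b) w = 0 := by
    rw [show n + 1 + (K : ℤ) = n + (K + 1 : ℕ) by push_cast; ring, hK, map_zero,
      LinearMap.zero_apply]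
  simp only [iterSum]
  rw [Rat.cast_add, Rat.cast_one, sum_choose_succ, add_comm,
    Finset.sum_range_succ (fun i => _ • Y (m + k - i) (mode (n + 1 + i) a b) w), hlast, smul_zero,
    add_zero]
  congr 1 <;> refine Finset.sum_congr rfl fun i _ => ?_
  · rw [show n + 1 + (i : ℤ) = n + (i + 1 : ℕ) by push_cast; ring,
      show m + 1 + k - ((i + 1 : ℕ) : ℚ) = m + k - i by push_cast; ring]
  · rw [show m + (k + 1) - (i : ℚ) = m + 1 + k - i by ring]

-- In generating functions this is multiplication of the Jacobi identity by `z₁ = z₀ + z₂`.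
theorem jacobiator_succ (htr : IsTruncated Y) (a b : V) (m : ℚ) (n : ℤ) (k : ℚ) (w : N) :
    jacobiator Y a b (m + 1) n k w =
      jacobiator Y a b m (n + 1) k w + jacobiator Y a b m n (k + 1) w := by
  obtain ⟨K, hmode, hb, ha, hjac⟩ := ((eventually_mode_eq_zero a b n).and
    ((htr.eventually_eq_zero b w k).and ((htr.eventually_eq_zero a w m).and
    (eventually_forall_ge_atTop.mpr ((eventually_jacobiator_eq htr a b (m + 1) n k w).and
      ((eventually_jacobiator_eq htr a b m (n + 1) k w).and
        (eventually_jacobiator_eq htr a b m n (k + 1) w))))))).exists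
  obtain ⟨hm, hn, hk⟩ := hjac (K + 1) K.le_succ
  rw [hm, hn, hk, iterSum_succ a b m n k (hmode _ K.le_succ),
    prodSum_succ a b m n k (hb _ K.le_succ), prodSum_succ b a k n m (ha _ K.le_succ),
    zpow_add_one₀ (by norm_num)]
  module

theorem HasCommutator.apply_eq_add_sum (hcomm : HasCommutator g Y) {p : ℚ} (q : ℚ) {a : V} (b : V)
    (w : N) (ha : a ∈ g.eig p) {L : ℕ} (hL : ∀ i : ℕ, L ≤ i → mode (i : ℤ) a b = 0) :
    Y p a (Y q b w) = Y q b (Y p a w) +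
      ∑ i ∈ Finset.range L, Ring.choose (p : ℂ) i • Y (p + q - i) (mode (i : ℤ) a b) w := by
  rw [← sub_eq_iff_eq_add', hcomm p q a b w ha, finsum_range _ L fun i hi => by simp [hL i hi]]

theorem jacobiator_zero (hcomm : HasCommutator g Y) (m k : ℚ) {a : V} (b : V) (w : N)
    (ha : a ∈ g.eig m) : jacobiator Y a b m 0 k w = 0 := by
  rw [jacobiator, finsum_range (fun i : ℕ => ((-1) ^ i * _) • (_ : N)) 1
    fun i hi => by simp [Ring.choose_zero_pos ℂ (Nat.pos_of_ne_zero (by omega : i ≠ 0))]]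
  simp only [zero_add, Finset.sum_range_one]
  rw [← hcomm m k a b w ha]
  simp

theorem jacobiator_natCast (htr : IsTruncated Y) (hcomm : HasCommutator g Y) (n : ℕ) (m k : ℚ)
    {a : V} (b : V) (w : N) (ha : a ∈ g.eig m) : jacobiator Y a b m n k w = 0 := by
  induction n generalizing m k with
  | zero => exact jacobiator_zero hcomm m k b w ha
  | succ n ih =>
    have h := jacobiator_succ htr a b m n k w
    rw [ih m _ ha, ih (m + 1) _ (by simpa using mem_eig_add_int ha 1), add_zero] at h
    exact_mod_cast h.symm

section Commutator

variable {p : ℚ} {c a b : V} {L : ℕ}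

theorem prodSum_commutator (hcomm : HasCommutator g Y) (hc : c ∈ g.eig p)
    (hca : ∀ j : ℕ, L ≤ j → mode (j : ℤ) c a = 0) (hcb : ∀ j : ℕ, L ≤ j → mode (j : ℤ) c b = 0)
    (m : ℚ) (n : ℤ) (k : ℚ) (K : ℕ) (w : N) :
    Y p c (prodSum Y a b m n k K w) = prodSum Y a b m n k K (Y p c w) +
      ∑ j ∈ Finset.range L, Ring.choose (p : ℂ) j •
        (prodSum Y (mode (j : ℤ) c a) b (m + p - j) n k K w +
          prodSum Y a (mode (j : ℤ) c b) m n (k + p - j) K w) := by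
  simp only [prodSum, map_sum, ← Finset.sum_add_distrib, Finset.smul_sum]
  rw [Finset.sum_comm (s := Finset.range L), ← Finset.sum_add_distrib]
  refine Finset.sum_congr rfl fun i _ => ?_
  have hterm : Y p c (Y (m + n - i) a (Y (k + i) b w)) = Y (m + n - i) a (Y (k + i) b (Y p c w)) +
      ∑ j ∈ Finset.range L, Ring.choose (p : ℂ) j •
        (Y (m + p - j + n - i) (mode (j : ℤ) c a) (Y (k + i) b w) +
          Y (m + n - i) a (Y (k + p - j + i) (mode (j : ℤ) c b) w)) := by
    rw [hcomm.apply_eq_add_sum _ a _ hc hca, hcomm.apply_eq_add_sum _ b _ hc hcb, map_add, map_sum,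
      add_assoc, ← Finset.sum_add_distrib]
    refine congrArg _ (Finset.sum_congr rfl fun j _ => ?_)
    rw [map_smul, smul_add, add_comm, show p + (m + n - i) - (j : ℚ) = m + p - j + n - i by ring,
      show p + (k + i) - (j : ℚ) = k + p - j + i by ring]
  rw [map_smul, map_smul, hterm, smul_add, smul_add, Finset.smul_sum, Finset.smul_sum]
  refine congrArg _ (Finset.sum_congr rfl fun j _ => ?_)
  module

theorem mode_natCast_mode (hca : ∀ j : ℕ, L ≤ j → mode (j : ℤ) c a = 0) (b : V) (l : ℕ) (n : ℤ) :
    mode (l : ℤ) c (mode n a b) = mode n a (mode (l : ℤ) c b) +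
      ∑ j ∈ Finset.range L, (l.choose j : ℂ) • mode (l + n - j) (mode (j : ℤ) c a) b := by
  rw [← sub_eq_iff_eq_add', VertexOperatorAlgebra.commutator,
    finsum_range _ L fun j hj => by simp [hca j hj]]
  simp only [Int.cast_natCast, Ring.choose_natCast]

theorem sum_range_eq_sum_range_add {M : Type*} [AddCommMonoid M] {f : ℕ → M} {j K R : ℕ}
    (hR : j + K ≤ R) (hlt : ∀ l < j, f l = 0) (hge : ∀ l, j + K ≤ l → f l = 0) :
    ∑ l ∈ Finset.range R, f l = ∑ l ∈ Finset.range K, f (j + l) := by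
  rw [← Finset.sum_subset (Finset.range_subset_range.mpr hR)
    (fun l _ hl => hge l (by simpa using hl)), Finset.sum_range_add,
    Finset.sum_eq_zero fun l hl => hlt l (Finset.mem_range.mp hl), zero_add]

theorem sum_sum_choose_smul_eq_iterSum (d b : V) (p m : ℚ) (n : ℤ) (k : ℚ) {j K R : ℕ}
    (hR : j + K ≤ R) (hK : ∀ e : ℕ, K ≤ e → mode (n + e) d b = 0) (w : N) :
    ∑ l ∈ Finset.range R, ∑ i ∈ Finset.range K,
      (Ring.choose (m : ℂ) i * Ring.choose (p : ℂ) l) • (l.choose j : ℂ) •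
        Y (p + (m + k - i) - l) (mode (l + (n + i) - j) d b) w =
      Ring.choose (p : ℂ) j • iterSum Y d b (m + p - j) n k K w := by
  let Z (e : ℕ) : N := Y (m + p + k - j - e) (mode (n + e) d b) w
  have hZ (e : ℕ) (he : K ≤ e) : Z e = 0 := by
    simp only [Z, hK e he, map_zero, LinearMap.zero_apply]
  rw [sum_range_eq_sum_range_add hR]
  · calc
      _ = ∑ l ∈ Finset.range K, ∑ i ∈ Finset.range K, (Ring.choose (p : ℂ) (j + l) *
            (j + l).choose j * Ring.choose (m : ℂ) i) • Z (l + i) := by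
        refine Finset.sum_congr rfl fun l _ => Finset.sum_congr rfl fun i _ => ?_
        simp only [Z]
        rw [smul_smul,
          show ((j + l : ℕ) : ℤ) + (n + i) - j = n + ((l + i : ℕ) : ℤ) by push_cast; ring,
          show p + (m + k - i) - ((j + l : ℕ) : ℚ) = m + p + k - j - ((l + i : ℕ) : ℚ) by
            push_cast; ring]
        congr 1
        ring
      _ = ∑ l ∈ Finset.range K,
            (Ring.choose (p : ℂ) j * Ring.choose ((p : ℂ) + m - j) l) • Z l := by
        rw [sum_antidiag K _ Z hZ]
        simp only [choose_jacobi]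
      _ = _ := by
        rw [iterSum, Finset.smul_sum]
        refine Finset.sum_congr rfl fun l _ => ?_
        rw [smul_smul, show m + p - j + k - (l : ℚ) = m + p + k - j - l by ring, Rat.cast_sub,
          Rat.cast_add, Rat.cast_natCast, add_comm (m : ℂ)]
  · exact fun l hl => Finset.sum_eq_zero fun i _ => by simp [Nat.choose_eq_zero_of_lt hl]
  · refine fun l hl => Finset.sum_eq_zero fun i _ => ?_
    rw [show (l : ℤ) + (n + i) - j = n + ((l + i - j : ℕ) : ℤ) by omega, hK _ (by omega)]
    simp

theorem iterSum_commutator_eq_sum (hcomm : HasCommutator g Y) (hc : c ∈ g.eig p) (m : ℚ) (n : ℤ)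
    (k : ℚ) {K R : ℕ} (hR : ∀ i < K, ∀ l : ℕ, R ≤ l → mode (l : ℤ) c (mode (n + i) a b) = 0)
    (w : N) :
    Y p c (iterSum Y a b m n k K w) = iterSum Y a b m n k K (Y p c w) +
      ∑ l ∈ Finset.range R, ∑ i ∈ Finset.range K, (Ring.choose (m : ℂ) i * Ring.choose (p : ℂ) l) •
        Y (p + (m + k - i) - l) (mode (l : ℤ) c (mode (n + i) a b)) w := by
  rw [Finset.sum_comm]
  simp only [iterSum, map_sum, map_smul]
  rw [← Finset.sum_add_distrib]
  refine Finset.sum_congr rfl fun i hi => ?_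
  rw [hcomm.apply_eq_add_sum _ _ _ hc (hR i (Finset.mem_range.mp hi)), smul_add, Finset.smul_sum]
  simp only [smul_smul]

theorem iterSum_commutator (hcomm : HasCommutator g Y) (hc : c ∈ g.eig p)
    (hca : ∀ j : ℕ, L ≤ j → mode (j : ℤ) c a = 0) (hcb : ∀ j : ℕ, L ≤ j → mode (j : ℤ) c b = 0)
    (m : ℚ) (n : ℤ) (k : ℚ) (K : ℕ)
    (hK : ∀ j < L, ∀ e : ℕ, K ≤ e → mode (n + e) (mode (j : ℤ) c a) b = 0) (w : N) :
    Y p c (iterSum Y a b m n k K w) = iterSum Y a b m n k K (Y p c w) +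
      ∑ j ∈ Finset.range L, Ring.choose (p : ℂ) j •
        (iterSum Y (mode (j : ℤ) c a) b (m + p - j) n k K w +
          iterSum Y a (mode (j : ℤ) c b) m n (k + p - j) K w) := by
  obtain ⟨R, hR, hLR⟩ : ∃ R, (∀ i ∈ Finset.range K, ∀ l : ℕ, R ≤ l →
      mode (l : ℤ) c (mode (n + i) a b) = 0) ∧ L + K ≤ R :=
    (((eventually_all_finset _).mpr fun i _ => by
      simpa using eventually_mode_eq_zero c (mode (n + i) a b) 0).and
        (eventually_ge_atTop (L + K))).exists
  rw [iterSum_commutator_eq_sum hcomm hc m n k fun i hi => hR i (Finset.mem_range.mpr hi)]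
  congr 1
  simp only [mode_natCast_mode hca, map_add, map_sum, map_smul, LinearMap.add_apply,
    LinearMap.sum_apply, LinearMap.smul_apply, smul_add, Finset.sum_add_distrib, Finset.smul_sum]
  rw [add_comm]
  congr 1
  · rw [Finset.sum_congr rfl fun l _ => Finset.sum_comm, Finset.sum_comm]
    refine Finset.sum_congr rfl fun j hj => ?_
    have hjL := Finset.mem_range.mp hj
    exact sum_sum_choose_smul_eq_iterSum _ b p m n k (by omega) (hK j hjL) w
  · rw [← Finset.sum_subset (Finset.range_subset_range.mpr (by omega : L ≤ R)) fun l _ hl =>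
      Finset.sum_eq_zero fun i _ => by simp [hcb l (by simpa using hl)]]
    refine Finset.sum_congr rfl fun l _ => ?_
    rw [iterSum, Finset.smul_sum]
    refine Finset.sum_congr rfl fun i _ => ?_
    rw [smul_smul, mul_comm, show p + (m + k - i) - (l : ℚ) = m + (k + p - l) - i by ring]

theorem jacobiator_commutator (htr : IsTruncated Y) (hcomm : HasCommutator g Y) (hc : c ∈ g.eig p)
    (hca : ∀ j : ℕ, L ≤ j → mode (j : ℤ) c a = 0) (hcb : ∀ j : ℕ, L ≤ j → mode (j : ℤ) c b = 0)
    (m : ℚ) (n : ℤ) (k : ℚ) (w : N) :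
    Y p c (jacobiator Y a b m n k w) = jacobiator Y a b m n k (Y p c w) +
      ∑ j ∈ Finset.range L, Ring.choose (p : ℂ) j •
        (jacobiator Y (mode (j : ℤ) c a) b (m + p - j) n k w +
          jacobiator Y a (mode (j : ℤ) c b) m n (k + p - j) w) := by
  have hmode := (eventually_all_finset (Finset.range L)).mpr fun j _ =>
    eventually_mode_eq_zero (mode (j : ℤ) c a) b n
  have hsummand := (eventually_all_finset (Finset.range L)).mpr fun j _ =>
    (eventually_jacobiator_eq htr (mode (j : ℤ) c a) b (m + p - j) n k w).and
      (eventually_jacobiator_eq htr a (mode (j : ℤ) c b) m n (k + p - j) w)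
  obtain ⟨K, hK, hsum, hw, hcw⟩ := (hmode.and (hsummand.and
    ((eventually_jacobiator_eq htr a b m n k w).and
      (eventually_jacobiator_eq htr a b m n k (Y p c w))))).exists
  rw [Finset.sum_congr rfl fun j hj => by rw [(hsum j hj).1, (hsum j hj).2], hw, hcw, map_sub,
    map_sub, map_smul, prodSum_commutator hcomm hc hca hcb, prodSum_commutator hcomm hc hcb hca,
    iterSum_commutator hcomm hc hca hcb m n k K fun j hj => hK j (Finset.mem_range.mpr hj)]
  simp only [smul_add, smul_sub, Finset.sum_add_distrib, Finset.sum_sub_distrib, Finset.smul_sum,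
    smul_comm ((-1 : ℂ) ^ n)]
  abel

theorem apply_jacobiator_sub_mem (htr : IsTruncated Y) (hcomm : HasCommutator g Y)
    {S : Submodule ℂ N} {w : N}
    (hS : ∀ (m : ℚ) (a b : V) (n : ℤ) (k : ℚ), a ∈ g.eig m → jacobiator Y a b m n k w ∈ S)
    (hc : c ∈ g.eig p) {m : ℚ} (ha : a ∈ g.eig m) (b : V) (n : ℤ) (k : ℚ) :
    Y p c (jacobiator Y a b m n k w) - jacobiator Y a b m n k (Y p c w) ∈ S := by
  obtain ⟨L, hca, hcb⟩ :=
    ((eventually_mode_eq_zero c a 0).and (eventually_mode_eq_zero c b 0)).exists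
  rw [jacobiator_commutator htr hcomm hc (by simpa using hca) (by simpa using hcb),
    add_sub_cancel_left]
  refine Submodule.sum_mem _ fun j _ => Submodule.smul_mem _ _ (Submodule.add_mem _ ?_ ?_)
  · refine hS _ _ _ _ _ ?_
    rw [g.eig_sub_nat, add_comm]
    exact g.mode_mem_eig hc ha j
  · exact hS _ _ _ _ _ ha

end Commutator

end Jacobiator

/-! ### The twisted Jacobi identity on `L(U)` -/

theorem LY_apply (U : AgMod.{u, v} g) (q : ℚ) (a : V) (w : LCar U) :
    LY U q a w = g.iota (g.elem q a) • w := rfl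

theorem iota_smul_mem_of_LY_mem (U : AgMod.{u, v} g) {S : Submodule ℂ (LCar U)} {d : ℚ}
    {w : LCar U}
    (hw : ∀ (t : ℤ) (p : ℚ), ∀ c ∈ wtSpace V t, c ∈ g.eig p → (t : ℚ) - p - 1 = d → LY U p c w ∈ S)
    {y : g.Vg} (hy : y ∈ g.VgDeg d) : g.iota y • w ∈ S := by
  refine VgDeg_induction (p := fun y => g.iota y • w ∈ S) hy (by simp) (fun x y hx hy => ?_) hw
  rw [map_add, add_smul]
  exact Submodule.add_mem _ hx hy

theorem LY_mem_LGr (U : AgMod.{u, v} g) {w : ℤ} {a : V} (ha : a ∈ wtSpace V w) (m : ℚ) {n : ℚ}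
    {x : LCar U} (hx : x ∈ LGr U n) : LY U m a x ∈ LGr U (n + w - m - 1) := by
  rw [LY_apply, show n + w - m - 1 = ((w : ℚ) - m - 1) + n by ring]
  exact iota_smul_mem_LGr U (elem_mem_VgDeg ha m) hx

theorem isTruncated_LY (U : AgMod.{u, v} g) : IsTruncated (LY U) := by
  intro a w
  induction a using wt_induction with
  | zero => exact ⟨0, by simp⟩
  | add a b ha hb =>
    obtain ⟨K, hK⟩ := ha
    obtain ⟨K', hK'⟩ := hb
    refine ⟨max K K', fun n hn => ?_⟩
    rw [map_add, LinearMap.add_apply, hK n ((le_max_left _ _).trans hn),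
      hK' n ((le_max_right _ _).trans hn), add_zero]
  | hom d a ha =>
    have hw : w ∈ ⨆ n, LGr U n := iSup_LGr U ▸ Submodule.mem_top
    induction hw using Submodule.iSup_induction' with
    | zero => exact ⟨0, by simp⟩
    | add x y _ _ hx hy =>
      obtain ⟨K, hK⟩ := hx
      obtain ⟨K', hK'⟩ := hy
      refine ⟨max K K', fun n hn => ?_⟩
      rw [map_add, hK n ((le_max_left _ _).trans hn), hK' n ((le_max_right _ _).trans hn), add_zero]
    | mem m x hx =>
      refine ⟨m + d, fun n hn => ?_⟩
      have := LY_mem_LGr U ha n hx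
      rwa [LGr_eq_bot_of_neg U (by linarith), Submodule.mem_bot] at this

theorem hasCommutator_LY (U : AgMod.{u, v} g) : HasCommutator g (LY U) := by
  intro p q a b w ha
  obtain ⟨N, hN⟩ := trunc_nat a b
  have swap : g.iota (g.elem p a) • g.iota (g.elem q b) • w =
      g.iota ⁅g.elem p a, g.elem q b⁆ • w + g.iota (g.elem q b) • g.iota (g.elem p a) • w :=
    ι_smul_ι_smul _ _ w
  rw [finsum_range _ N fun i hi => by simp [hN i hi]]
  simp only [LY_apply]
  rw [swap, add_sub_cancel_right, lie_elem q ha b hN, map_sum, Finset.sum_smul]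
  simp only [map_smul, smul_assoc]

theorem LY_LIncl (U : AgMod.{u, v} g) {w : ℤ} {a : V} (ha : a ∈ wtSpace V w) (z : U.carrier) :
    LY U ((w : ℚ) - 1) a (LIncl U z) = LIncl U (U.rho (g.Og.mkQ a) z) := by
  have elem_eq_elem_proj : g.elem ((w : ℚ) - 1) a = g.elem ((w : ℚ) - 1) (g.proj 0 a) := by
    rw [← elem_proj, ← proj_sub_int 0 (1 - w), zero_sub, Int.cast_sub, Int.cast_one, neg_sub]
  have ha₀ := g.proj_mem_wtSpace ha 0
  rw [LY_apply, elem_eq_elem_proj, iota_smul_LIncl U le_rfl (elem_sub_one_mem_VgDeg ha₀),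
    zeroAct_elem_sub_one U ha₀ (g.proj_mem 0 a), mkQ_proj]

theorem LY_LIncl_eq_zero (U : AgMod.{u, v} g) {w : ℤ} {a : V} (ha : a ∈ wtSpace V w) {q : ℚ}
    (hq : (w : ℚ) - q - 1 < 0) (z : U.carrier) : LY U q a (LIncl U z) = 0 := by
  rw [LY_apply, iota_smul_LIncl U hq.le (elem_mem_VgDeg ha q),
    zeroAct_eq_zero U hq.ne (elem_mem_VgDeg ha q), LinearMap.zero_apply, map_zero]

theorem jacobiator_mem_LGr (U : AgMod.{u, v} g) {p q : ℤ} {a b : V} (ha : a ∈ wtSpace V p)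
    (hb : b ∈ wtSpace V q) (m : ℚ) (n : ℤ) (k : ℚ) {d : ℚ} {w : LCar U} (hw : w ∈ LGr U d) :
    jacobiator (LY U) a b m n k w ∈ LGr U (d + p + q - n - m - k - 2) := by
  obtain ⟨K, hK⟩ := (eventually_jacobiator_eq (isTruncated_LY U) a b m n k w).exists
  rw [hK]
  refine Submodule.sub_mem _ (Submodule.sum_mem _ fun i _ => Submodule.smul_mem _ _ ?_)
    (Submodule.sub_mem _ (Submodule.sum_mem _ fun i _ =>
      Submodule.smul_mem _ _ (Submodule.smul_mem _ _ ?_)) (Submodule.smul_mem _ _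
        (Submodule.sum_mem _ fun i _ => Submodule.smul_mem _ _ (Submodule.smul_mem _ _ ?_))))
  · convert LY_mem_LGr U (mode_mem_wtSpace ha hb (n + i)) (m + k - i) hw using 2
    push_cast
    ring
  · convert LY_mem_LGr U ha (m + n - i) (LY_mem_LGr U hb (k + i) hw) using 2
    ring
  · convert LY_mem_LGr U hb (k + n - i) (LY_mem_LGr U ha (m + i) hw) using 2
    ring

theorem iterSum_LIncl (U : AgMod.{u, v} g) {p q : ℤ} {a b : V} (ha : a ∈ wtSpace V p)
    (hb : b ∈ wtSpace V q) (m : ℚ) (n : ℤ) (k : ℚ) (hdeg : (p : ℚ) + q - n - m - k - 2 = 0) {K : ℕ}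
    (hK : ∀ i : ℕ, K ≤ i → mode (n + i) a b = 0) (z : U.carrier) :
    iterSum (LY U) a b m n k K (LIncl U z) = LIncl U (U.rho (g.Og.mkQ (res (m : ℂ) n a b)) z) := by
  rw [res_eq_sum _ hK, iterSum]
  simp only [map_sum, map_smul, LinearMap.sum_apply, LinearMap.smul_apply]
  refine Finset.sum_congr rfl fun i _ => ?_
  rw [← LY_LIncl U (mode_mem_wtSpace ha hb (n + i))]
  congr 4
  push_cast
  linarith

theorem prodSum_LIncl_eq_zero (U : AgMod.{u, v} g) (a : V) {q : ℤ} {b : V} (hb : b ∈ wtSpace V q)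
    (m : ℚ) (n : ℤ) {k : ℚ} (hk : (q : ℚ) - k - 1 < 0) (K : ℕ) (z : U.carrier) :
    prodSum (LY U) a b m n k K (LIncl U z) = 0 := by
  refine Finset.sum_eq_zero fun i _ => ?_
  have : (0 : ℚ) ≤ i := by positivity
  rw [LY_LIncl_eq_zero U hb (by linarith), map_zero, smul_zero, smul_zero]

theorem prodSum_succ_LIncl (U : AgMod.{u, v} g) {p q : ℤ} {a b : V} (ha : a ∈ wtSpace V p)
    (hb : b ∈ wtSpace V q) (K : ℕ) (z : U.carrier) :
    prodSum (LY U) a b p (-1) ((q : ℚ) - 1) (K + 1) (LIncl U z) =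
      LIncl U (U.rho (g.Og.mkQ a) (U.rho (g.Og.mkQ b) z)) := by
  rw [prodSum, Finset.sum_range_succ', Finset.sum_eq_zero fun i _ => ?_]
  · simp only [Nat.cast_zero, add_zero, pow_zero, Ring.choose_zero_right, one_smul, sub_zero,
      zero_add]
    rw [LY_LIncl U hb, Int.cast_neg, Int.cast_one, ← sub_eq_add_neg, LY_LIncl U ha]
  · have : (0 : ℚ) ≤ i := by positivity
    rw [LY_LIncl_eq_zero U hb (by push_cast; linarith), map_zero, smul_zero, smul_zero]

theorem exists_jacobiator_LIncl_eq (U : AgMod.{u, v} g) {p q : ℤ} {a b : V} (ha : a ∈ wtSpace V p)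
    (hb : b ∈ wtSpace V q) {m : ℚ} {n : ℤ} {k : ℚ} (hm : (p : ℚ) - m - 1 < 0)
    (hdeg : (p : ℚ) + q - n - m - k - 2 = 0) (z : U.carrier) :
    ∃ K, jacobiator (LY U) a b m n k (LIncl U z) =
      LIncl U (U.rho (g.Og.mkQ (res (m : ℂ) n a b)) z) -
        prodSum (LY U) a b m n k (K + 1) (LIncl U z) := by
  obtain ⟨K, hjac, hmode⟩ := ((tendsto_add_atTop_nat 1).eventually
    ((eventually_jacobiator_eq (isTruncated_LY U) a b m n k (LIncl U z)).and
      (eventually_mode_eq_zero a b n))).exists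
  refine ⟨K, ?_⟩
  rw [hjac, iterSum_LIncl U ha hb m n k hdeg hmode, prodSum_LIncl_eq_zero U b ha k n hm, smul_zero,
    sub_zero]

theorem jacobiator_LIncl_of_le (U : AgMod.{u, v} g) {p q : ℤ} {a b : V} {r : ℕ} (hr : r < g.T)
    (ha : a ∈ wtSpace V p) (ha' : a ∈ g.eig (r / g.T)) (hb : b ∈ wtSpace V q) {m : ℚ} {n : ℤ}
    {k : ℚ} (hm : m = (p : ℚ) - 1 + delta r + r / g.T) (hm' : (p : ℚ) - m - 1 < 0)
    (hn : n + 1 + delta r ≤ 0) (hdeg : (p : ℚ) + q - n - m - k - 2 = 0) (z : U.carrier) :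
    jacobiator (LY U) a b m n k (LIncl U z) = 0 := by
  obtain ⟨K, hK⟩ := exists_jacobiator_LIncl_eq U ha hb hm' hdeg z
  have hrT : (r / g.T : ℚ) < 1 := by
    rw [div_lt_one (by exact_mod_cast g.T_pos)]
    exact_mod_cast hr
  have hk : (q : ℚ) - k - 1 < 0 := by
    have : (n : ℚ) + 1 + delta r ≤ 0 := by exact_mod_cast hn
    linarith
  obtain ⟨j, hj⟩ : ∃ j : ℕ, n = -1 - delta r - j := ⟨(-1 - delta r - n).toNat, by omega⟩
  have hres : g.Og.mkQ (res (m : ℂ) n a b) = 0 := by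
    rw [hj, hm]
    push_cast
    exact (Submodule.Quotient.mk_eq_zero _).mpr (res_mem_Og b hr ha ha' j)
  rw [hK, prodSum_LIncl_eq_zero U a hb m n hk, hres, map_zero, LinearMap.zero_apply, map_zero,
    sub_zero]

theorem jacobiator_LIncl_neg_one (U : AgMod.{u, v} g) {p q : ℤ} {a b : V} (ha : a ∈ wtSpace V p)
    (ha' : a ∈ g.eig 0) (hb : b ∈ wtSpace V q) (z : U.carrier) :
    jacobiator (LY U) a b p (-1) ((q : ℚ) - 1) (LIncl U z) = 0 := by
  obtain ⟨K, hK⟩ := exists_jacobiator_LIncl_eq U ha hb (m := p) (n := -1) (k := (q : ℚ) - 1)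
    (by linarith) (by push_cast; ring) z
  rw [hK, prodSum_succ_LIncl U ha hb, Rat.cast_intCast, ← star_apply b ha ha', U.rho_mul,
    Module.End.mul_apply, sub_self]

theorem LProj_jacobiator_of_neg (U : AgMod.{u, v} g) {p q : ℤ} {a b : V} {r : ℕ} (hr : r < g.T)
    (ha : a ∈ wtSpace V p) (ha' : a ∈ g.eig (r / g.T)) (hb : b ∈ wtSpace V q) {n : ℤ} (hn : n < 0)
    (k : ℚ) (z : U.carrier) :
    LProj U (jacobiator (LY U) a b ((p : ℚ) - 1 + delta r + r / g.T) n k (LIncl U z)) = 0 := by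
  set m : ℚ := (p : ℚ) - 1 + delta r + r / g.T with hm
  by_cases hdeg : (p : ℚ) + q - n - m - k - 2 = 0
  swap
  · exact LProj_eq_zero U (fun h => hdeg (by linarith))
      (jacobiator_mem_LGr U ha hb m n k (LGr_zero U ▸ LinearMap.mem_range_self _ z))
  have hT : (0 : ℚ) < g.T := by exact_mod_cast g.T_pos
  by_cases h : n + 1 + delta r ≤ 0
  · have hpos : (0 : ℚ) < delta r + r / g.T := by
      rcases r.eq_zero_or_pos with rfl | hr0
      · simp [delta]
      · have : (0 : ℚ) < r := by exact_mod_cast hr0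
        positivity
    rw [jacobiator_LIncl_of_le U hr ha ha' hb hm (by linarith) h hdeg, map_zero]
  obtain rfl : r = 0 := by
    by_contra hr0
    simp only [delta, if_neg hr0] at h
    omega
  obtain rfl : n = -1 := by
    simp only [delta, if_true] at h
    omega
  have hmp : m = p := by simp [hm, delta]
  obtain rfl : k = (q : ℚ) - 1 := by
    rw [hmp] at hdeg
    push_cast at hdeg
    linarith
  rw [hmp, jacobiator_LIncl_neg_one U ha (by simpa using ha') hb, map_zero]

theorem eq_zero_of_succ_eq_add {A M : Type*} [AddGroup A] [One A] [AddMonoid M]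
    {F : ℤ → ℤ → A → M} (hsucc : ∀ j n k, F (j + 1) n k = F j (n + 1) k + F j n (k + 1))
    (hzero : ∀ n < 0, ∀ k, F 0 n k = 0) (hnat : ∀ j (n : ℕ) k, F j n k = 0) (j n : ℤ) (k : A) :
    F j n k = 0 := by
  have hneg (t : ℕ) (j : ℤ) (k : A) : F j (-t) k = 0 := by
    induction t generalizing j k with
    | zero => simpa using hnat j 0 k
    | succ t ih =>
      have shift (j k) : F (j + 1) (-(t + 1 : ℕ)) k = F j (-(t + 1 : ℕ)) (k + 1) := by
        rw [hsucc, show -((t + 1 : ℕ) : ℤ) + 1 = -t by push_cast; ring, ih, zero_add]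
      induction j using Int.induction_on generalizing k with
      | zero => exact hzero _ (by push_cast; omega) k
      | succ j hj => rw [shift, hj]
      | pred j hj =>
        have h := shift (-j - 1) (k - 1)
        rw [sub_add_cancel, sub_add_cancel, hj] at h
        exact h.symm
  obtain ⟨t, rfl | rfl⟩ := Int.eq_nat_or_neg n
  · exact hnat j t k
  · exact hneg t j k

theorem LProj_jacobiator_of_mem_wtSpace (U : AgMod.{u, v} g) {p q : ℤ} {a b : V} {r : ℕ}
    (hr : r < g.T) (ha : a ∈ wtSpace V p) (ha' : a ∈ g.eig (r / g.T)) (hb : b ∈ wtSpace V q)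
    (j n : ℤ) (k : ℚ) (z : U.carrier) :
    LProj U (jacobiator (LY U) a b ((p : ℚ) - 1 + delta r + r / g.T + j) n k (LIncl U z)) = 0 := by
  set μ : ℚ := (p : ℚ) - 1 + delta r + r / g.T
  have mem_eig (j : ℤ) : a ∈ g.eig (μ + j) := by
    convert mem_eig_add_int ha' (p - 1 + delta r + j) using 2
    push_cast
    ring
  refine eq_zero_of_succ_eq_add
    (F := fun j n k => LProj U (jacobiator (LY U) a b (μ + j) n k (LIncl U z)))
    (fun j n k => ?_) (fun n hn k => ?_) (fun j n k => ?_) j n k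
  · rw [Int.cast_add, Int.cast_one, ← add_assoc, jacobiator_succ (isTruncated_LY U), map_add]
  · simpa using LProj_jacobiator_of_neg U hr ha ha' hb hn k z
  · rw [jacobiator_natCast (isTruncated_LY U) (hasCommutator_LY U) n _ k b _ (mem_eig j), map_zero]

theorem exists_eq_div_add_int_of_mem_eig {m : ℚ} {a : V} (ha : a ∈ g.eig m) (h0 : a ≠ 0) :
    ∃ r < g.T, ∃ j : ℤ, m = r / g.T + j := by
  obtain ⟨k, rfl⟩ : ∃ k : ℤ, m = k / g.T := by
    by_contra h
    refine h0 ?_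
    rw [← g.proj_apply ha, proj, if_neg h, LinearMap.zero_apply]
  have hT : (g.T : ℤ) ≠ 0 := by exact_mod_cast g.T_pos.ne'
  have hT' : (g.T : ℚ) ≠ 0 := by exact_mod_cast g.T_pos.ne'
  obtain ⟨r, hr⟩ := Int.eq_ofNat_of_zero_le (Int.emod_nonneg k hT)
  have hrT := Int.emod_lt_of_pos k (by exact_mod_cast g.T_pos : (0 : ℤ) < g.T)
  refine ⟨r, by omega, k / g.T, ?_⟩
  have hk : (k : ℚ) = r + g.T * (k / g.T : ℤ) := by
    exact_mod_cast (hr ▸ Int.emod_add_mul_ediv k g.T).symm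
  rw [hk]
  field_simp

theorem LProj_jacobiator (U : AgMod.{u, v} g) {m : ℚ} {a : V} (ha : a ∈ g.eig m) (b : V) (n : ℤ)
    (k : ℚ) (z : U.carrier) : LProj U (jacobiator (LY U) a b m n k (LIncl U z)) = 0 := by
  rw [← g.proj_apply ha]
  clear ha
  induction a using wt_induction with
  | zero => rw [map_zero, jacobiator_zero_left, map_zero]
  | add a a' h h' =>
    rw [map_add, jacobiator_add_left (isTruncated_LY U), map_add, h, h', add_zero]
  | hom p a ha =>
    induction b using wt_induction with
    | zero => rw [jacobiator_zero_right, map_zero]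
    | add b b' h h' => rw [jacobiator_add_right (isTruncated_LY U), map_add, h, h', add_zero]
    | hom q b hb =>
      by_cases h0 : g.proj m a = 0
      · rw [h0, jacobiator_zero_left, map_zero]
      obtain ⟨r, hr, j, hj⟩ := exists_eq_div_add_int_of_mem_eig (g.proj_mem m a) h0
      have eig_eq : g.eig m = g.eig (r / g.T) := by
        rw [← g.eig_sub_int m j, hj, add_sub_cancel_right]
      have mem_eig : g.proj m a ∈ g.eig (r / g.T) := eig_eq ▸ g.proj_mem m a
      convert LProj_jacobiator_of_mem_wtSpace U hr (g.proj_mem_wtSpace ha m) mem_eig hb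
        (j - (p - 1 + delta r)) n k z using 3
      rw [hj]
      push_cast
      ring

theorem jacobiator_LIncl (U : AgMod.{u, v} g) {m : ℚ} {a : V} (ha : a ∈ g.eig m) (b : V) (n : ℤ)
    (k : ℚ) (z : U.carrier) : jacobiator (LY U) a b m n k (LIncl U z) = 0 := by
  let W : Submodule ℂ (LCar U) := Submodule.span ℂ {x | ∃ (m : ℚ) (a b : V) (n : ℤ) (k : ℚ)
    (z : U.carrier), a ∈ g.eig m ∧ x = jacobiator (LY U) a b m n k (LIncl U z)}
  have mem_W (z : U.carrier) (m : ℚ) (a b : V) (n : ℤ) (k : ℚ) (ha : a ∈ g.eig m) :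
      jacobiator (LY U) a b m n k (LIncl U z) ∈ W :=
    Submodule.subset_span ⟨m, a, b, n, k, z, ha, rfl⟩
  have smul_mem_W (d : ℚ) (hd : d ≤ 0) (y : g.Vg) (hy : y ∈ g.VgDeg d) (w : LCar U) (hw : w ∈ W) :
      g.iota y • w ∈ W := by
    refine iota_smul_mem_of_LY_mem U (fun t p c hc hc' hdeg => ?_) hy
    refine (Submodule.span_le (p := W.comap (LY U p c))).mpr ?_ hw
    rintro _ ⟨m, a, b, n, k, z, ha, rfl⟩
    have hsub := apply_jacobiator_sub_mem (isTruncated_LY U) (hasCommutator_LY U) (mem_W z) hc' ha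
      b n k
    rw [LY_apply U p c (LIncl U z), iota_smul_LIncl U hd (hdeg ▸ elem_mem_VgDeg hc p)] at hsub
    exact (Submodule.sub_mem_iff_left _ (mem_W _ m a b n k ha)).mp hsub
  have hker : W ≤ LinearMap.ker (LProj U) := by
    refine Submodule.span_le.mpr ?_
    rintro _ ⟨m, a, b, n, k, z, ha, rfl⟩
    exact LProj_jacobiator U ha b n k z
  exact LCar_eq_zero U fun x => smul_mem_of_triangular smul_mem_W hker
    (fun d hd y hy s _ => LProj_iota_smul U hd hy s) x (mem_W z m a b n k ha)

theorem jacobiator_eq_zero (U : AgMod.{u, v} g) {m : ℚ} {a : V} (ha : a ∈ g.eig m) (b : V) (n : ℤ)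
    (k : ℚ) (w : LCar U) : jacobiator (LY U) a b m n k w = 0 := by
  let S : Submodule ℂ (LCar U) :=
    { carrier := {w | ∀ (m : ℚ) (a b : V) (n : ℤ) (k : ℚ), a ∈ g.eig m →
        jacobiator (LY U) a b m n k w = 0}
      zero_mem' := fun m a b n k _ => by simp [jacobiator]
      add_mem' := fun hx hy m a b n k h => by
        rw [jacobiator_add (isTruncated_LY U), hx m a b n k h, hy m a b n k h, add_zero]
      smul_mem' := fun c x hx m a b n k h => by
        rw [jacobiator_smul (isTruncated_LY U), hx m a b n k h, smul_zero] }
  refine mem_of_iota_smul_mem U (S := S) (fun z m a b n k ha => jacobiator_LIncl U ha b n k z)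
    (fun d y hy s hs => iota_smul_mem_of_LY_mem U (S := S) (fun t p c _ hc _ => ?_) hy)
    w m a b n k ha
  intro m a b n k ha
  have hsub := apply_jacobiator_sub_mem (isTruncated_LY U) (hasCommutator_LY U) (S := ⊥) hs hc ha
    b n k
  rwa [hs m a b n k ha, map_zero, zero_sub, Submodule.neg_mem_iff, Submodule.mem_bot] at hsub

theorem iota_vac_smul (U : AgMod.{u, v} g) (w : LCar U) : g.iota (g.elem (-1) vac) • w = w := by
  refine mem_of_iota_smul_mem U (S := LinearMap.eqLocus (LY U (-1) vac) LinearMap.id)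
    (fun z => ?_) (fun _ y _ s hs => ?_) w
  · have h := LY_LIncl U (vac_mem_wtSpace (V := V)) z
    rwa [U.rho_one, Module.End.one_apply, Int.cast_zero, zero_sub] at h
  · change g.iota (g.elem (-1) vac) • s = s at hs
    change g.iota (g.elem (-1) vac) • g.iota y • s = g.iota y • s
    refine (ι_smul_ι_smul _ _ s).trans ?_
    rw [lie_vac, map_zero, zero_smul, zero_add]
    exact congrArg (g.iota y • ·) hs

theorem isWeakTwisted_L (U : AgMod.{u, v} g) : g.IsWeakTwisted (LY U) where
  support r _ a ha n hn := LinearMap.ext fun w => by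
    rw [LY_apply, elem_eq_zero ha hn, map_zero, zero_smul, LinearMap.zero_apply]
  trunc := isTruncated_LY U
  vacuum n := LinearMap.ext fun w => by
    rw [LY_apply]
    split_ifs with h
    · rw [h, iota_vac_smul, Module.End.one_apply]
    · rw [elem_vac_eq_zero h, map_zero, zero_smul, LinearMap.zero_apply]
  jacobi := by
    rintro r _ a ha b w m n k ⟨j, rfl⟩
    exact sub_eq_zero.mp (jacobiator_eq_zero U (mem_eig_add_int ha j) b n k w)

theorem isAdmissible_L (U : AgMod.{u, v} g) : g.IsAdmissible (LY U) (LGr U) where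
  weak := isWeakTwisted_L U
  internal := DirectSum.isInternal_submodule_of_iSupIndep_of_iSup_eq_top (iSupIndep_LGr U)
    (iSup_LGr U)
  gr_support _ := LGr_eq_bot U
  map_gr _ _ ha m _ _ := LY_mem_LGr U ha m

/-! ### Lowest weight vectors -/

theorem IsAdmissible.apply_mem_Omega {M : Type v} [AddCommGroup M] [Module ℂ M]
    {Y : ℚ → V →ₗ[ℂ] Module.End ℂ M} {gr : ℚ → Submodule ℂ M} (h : g.IsAdmissible Y gr)
    {f : ℚ →₀ M} (hf : ∀ n, f n ∈ gr n) (hsum : (f.sum fun _ x => x) ∈ Omega Y) (n : ℚ) :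
    f n ∈ Omega Y := by
  intro d a ha q hq
  have indep : iSupIndep fun m => gr (m + d - q - 1) :=
    h.internal.submodule_iSupIndep.comp (f := fun m : ℚ => m + d - q - 1) fun x y hxy => by
      simpa using hxy
  exact apply_eq_zero_of_iSupIndep indep (fun m => h.map_gr d a ha q m _ (hf m))
    (hsum d a ha q hq) n

theorem LIncl_mem_Omega (U : AgMod.{u, v} g) (z : U.carrier) : LIncl U z ∈ Omega (LY U) :=
  fun _ _ ha _ hq => LY_LIncl_eq_zero U ha hq z

theorem iota_smul_mem_LGr_inf_Omega (U : AgMod.{u, v} g) {n d : ℚ} (hd : d ≤ 0) {y : g.Vg}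
    (hy : y ∈ g.VgDeg d) {w : LCar U} (hw : w ∈ LGr U n ⊓ Omega (LY U)) :
    g.iota y • w ∈ LGr U n ⊓ Omega (LY U) := by
  refine iota_smul_mem_of_LY_mem U (fun t p c hc _ hdeg => ?_) hy
  rcases hd.lt_or_eq with hd | rfl
  · rw [hw.2 t c hc p (hdeg ▸ hd)]
    exact Submodule.zero_mem _
  · obtain rfl : p = (t : ℚ) - 1 := by linarith
    have mem_LGr := LY_mem_LGr U hc ((t : ℚ) - 1) hw.1
    have mem_Omega := oMap_mem (isWeakTwisted_L U) c hw.2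
    rw [show n + t - ((t : ℚ) - 1) - 1 = n by ring] at mem_LGr
    rw [oMap_apply _ hc] at mem_Omega
    exact ⟨mem_LGr, mem_Omega⟩

theorem LGr_inf_Omega_eq_bot (U : AgMod.{u, v} g) {n : ℚ} (hn : n ≠ 0) :
    LGr U n ⊓ Omega (LY U) = ⊥ :=
  (Submodule.eq_bot_iff _).mpr fun _ hw => LCar_eq_zero U fun x =>
    smul_mem_of_triangular (S := LinearMap.ker (LProj U))
      (fun _ hd _ hy _ => iota_smul_mem_LGr_inf_Omega U hd hy)
      (fun _ hw => LProj_eq_zero U hn hw.1) (fun _ hd _ hy s _ => LProj_iota_smul U hd hy s) x hw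

theorem Omega_LY (U : AgMod.{u, v} g) : Omega (LY U) = LinearMap.range (LIncl U) := by
  refine le_antisymm (fun w hw => ?_) ?_
  · obtain ⟨f, hf, rfl⟩ := (Submodule.mem_iSup_iff_exists_finsupp _ _).mp
      (iSup_LGr U ▸ Submodule.mem_top : w ∈ ⨆ n, LGr U n)
    have apply_eq_zero (n : ℚ) (hn : n ≠ 0) : f n = 0 :=
      (Submodule.eq_bot_iff _).mp (LGr_inf_Omega_eq_bot U hn) _
        ⟨hf n, (isAdmissible_L U).apply_mem_Omega hf hw n⟩
    rw [Finsupp.sum, Finset.sum_eq_single 0 (fun n _ => apply_eq_zero n)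
      Finsupp.notMem_support_iff.mp, ← LGr_zero]
    exact hf 0
  · rintro _ ⟨z, rfl⟩
    exact LIncl_mem_Omega U z

/-! ### Functoriality -/

/-- The morphism of admissible modules `L(f) : L(U) → L(W)` induced by `f : U → W`. -/
def LHom {U W : AgMod.{u, v} g} (f : U ⟶ W) :
    LObj U (isAdmissible_L U) ⟶ LObj W (isAdmissible_L W) :=
  AdmMod.Hom.mk (M := LObj U (isAdmissible_L U)) (N := LObj W (isAdmissible_L W))
    ((LMap f).restrictScalars ℂ) (fun _ _ x => (LMap f).map_smul _ x)
    (fun _ _ hx => LMap_mem_LGr f hx)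

theorem LMap_id (U : AgMod.{u, v} g) (w : LCar U) : LMap (𝟙 U) w = w := by
  induction w using LCar_induction with
  | add w w' h h' => rw [map_add, h, h']
  | smul t z => rw [map_smul, LMap_LIncl]; rfl

theorem LMap_comp {U W X : AgMod.{u, v} g} (f : U ⟶ W) (h : W ⟶ X) (w : LCar U) :
    LMap (f ≫ h) w = LMap h (LMap f w) := by
  induction w using LCar_induction with
  | add w w' hw hw' => simp only [map_add, hw, hw']
  | smul t z => simp only [map_smul, LMap_LIncl]; rfl

theorem LHom_id (U : AgMod.{u, v} g) : LHom (𝟙 U) = 𝟙 (LObj U (isAdmissible_L U)) :=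
  AdmMod.Hom.ext (LinearMap.ext fun w => LMap_id U w)

theorem LHom_comp {U W X : AgMod.{u, v} g} (f : U ⟶ W) (h : W ⟶ X) :
    LHom (f ≫ h) = LHom f ≫ LHom h :=
  AdmMod.Hom.ext (LinearMap.ext fun w => LMap_comp f h w)

variable (g) in
/-- The functor `L` from `A_g(V)`-modules to admissible `g`-twisted `V`-modules. -/
def LFunctor : AgMod.{u, max u v} g ⥤ AdmMod.{u, max u v} g where
  obj U := LObj U (isAdmissible_L U)
  map f := LHom f
  map_id := LHom_id
  map_comp f h := LHom_comp f h

/-- The natural map from `U` onto `Ω(L(U))`, as a linear equivalence. -/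
def OmegaEquiv (U : AgMod.{u, v} g) : U.carrier ≃ₗ[ℂ] Omega (LY U) :=
  (LinearEquiv.ofInjective (LIncl U) (Function.LeftInverse.injective (LProj_LIncl U))).trans
    (LinearEquiv.ofEq _ _ (Omega_LY U).symm)

theorem OmegaEquiv_rho (U : AgMod.{u, v} g) (a : g.Ag) (z : U.carrier) :
    OmegaEquiv U (U.rho a z) = omegaRho (LY U) (isWeakTwisted_L U) a (OmegaEquiv U z) := by
  induction a using Submodule.Quotient.induction_on with
  | H a =>
    apply Subtype.ext
    change LIncl U (U.rho (g.Og.mkQ a) z) = oMap (LY U) a (LIncl U z)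
    induction a using wt_induction with
    | zero => simp only [map_zero, LinearMap.zero_apply]
    | add a b ha hb => simp only [map_add, LinearMap.add_apply, ha, hb]
    | hom n a ha => rw [oMap_apply _ ha, LY_LIncl U ha]

/-- The natural map from `U` onto `Ω(L(U))`, as an isomorphism of `A_g(V)`-modules. -/
def OmegaIso (U : AgMod.{u, max u v} g) : U ≅ OmegaObj (LObj U (isAdmissible_L U)) where
  hom := AgMod.Hom.mk (W := OmegaObj (LObj U (isAdmissible_L U))) (OmegaEquiv U).toLinearMap
    (OmegaEquiv_rho U)
  inv := AgMod.Hom.mk (U := OmegaObj (LObj U (isAdmissible_L U))) (OmegaEquiv U).symm.toLinearMap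
    fun a (x : Omega (LY U)) => by
      apply (OmegaEquiv U).injective
      have h := OmegaEquiv_rho U a ((OmegaEquiv U).symm x)
      rw [LinearEquiv.apply_symm_apply] at h
      exact ((OmegaEquiv U).apply_symm_apply _).trans h.symm
  hom_inv_id := AgMod.Hom.ext (LinearMap.ext fun x => (OmegaEquiv U).symm_apply_apply x)
  inv_hom_id := AgMod.Hom.ext (LinearMap.ext fun x => (OmegaEquiv U).apply_symm_apply x)

variable (g) in
/-- The isomorphisms `U ≅ Ω(L(U))` as a natural isomorphism. -/
def OmegaNatIso : LFunctor.{u, v} g ⋙ OmegaFunctor g ≅ 𝟭 (AgMod.{u, max u v} g) :=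
  (NatIso.ofComponents OmegaIso.{u, v} fun f =>
    AgMod.Hom.ext (LinearMap.ext fun z => Subtype.ext (LMap_LIncl f z).symm)).symm

theorem OmegaNatIso_inv_app (U : AgMod.{u, max u v} g) (z : U.carrier) :
    (Omega (LY U)).subtype (((OmegaNatIso.{u, v} g).inv.app U).toLin z) = LIncl U z := rfl

end

end FiniteOrderAut

open FiniteOrderAut in
theorem theorem6p3 {V : Type u} [AddCommGroup V] [Module ℂ V] [VertexOperatorAlgebra V]
    (g : FiniteOrderAut V) :
    (∀ U : AgMod.{u, max u v} g, IsGreatest {J | IsGradedAvoiding U J} (maxJ U)) ∧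
    ∃ hadm : ∀ U : AgMod.{u, max u v} g, g.IsAdmissible (LY U) (LGr U),
    ∃ (map : ∀ U W : AgMod.{u, max u v} g, (U ⟶ W) → (LObj U (hadm U) ⟶ LObj W (hadm W)))
      (map_id : ∀ U, map U U (𝟙 U) = 𝟙 (LObj U (hadm U)))
      (map_comp : ∀ (U W X : AgMod.{u, max u v} g) (f : U ⟶ W) (h : W ⟶ X),
        map U X (f ≫ h) = map U W f ≫ map W X h),
      (∀ (U W : AgMod.{u, max u v} g) (f : U ⟶ W) (z : U.carrier),
        (map U W f).toLin (LMk U (indIncl U z)) = LMk W (indIncl W (f.toLin z))) ∧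
      ∃ e : ({ obj := fun U => LObj U (hadm U)
               map := fun {U W} f => map U W f
               map_id := map_id
               map_comp := fun {U W X} f h => map_comp U W X f h } :
              AgMod.{u, max u v} g ⥤ AdmMod.{u, max u v} g) ⋙ OmegaFunctor g ≅
            𝟭 (AgMod.{u, max u v} g),
        ∀ (U : AgMod.{u, max u v} g) (z : U.carrier),
          (Omega (LY U)).subtype ((e.inv.app U).toLin z) = LMk U (indIncl U z) :=
  ⟨isGreatest_maxJ, isAdmissible_L, fun _ _ f => LHom f, LHom_id, fun _ _ _ f h => LHom_comp f h,
    fun _ _ f z => LMap_LIncl f z, OmegaNatIso.{u, v} g, OmegaNatIso_inv_app⟩
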